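/- **Setting.** Let $\rho,k\in C^1[0,\infty)$ be positive, $\rho k\in C^2[0,\infty)$, $(\rho k)'(0)=0$, and let $\gamma$ be a real function on $[0,\infty)$; extend $\rho,k,\gamma$ evenly to $\mathbb R$. Put $\sigma(x)=\int_0^x\sqrt{\rho/k}\,d\xi$, $Q_1=\sqrt{k/\rho}\,\frac{(k\rho)'}{4k\rho}$, $Q_2=\sqrt{k/\rho}\,Q_1'+Q_1^2$, $q=Q_2-\gamma$, and assume $$\sigma(x)\to+\infty\ (x\to+\infty),\qquad q\in L^\infty(0,\infty)\cap C^1[0,\infty),\qquad \sqrt{\rho/k}\;q\,\sigma\in L^1(0,\infty).$$ Let $r=q\circ\sigma^{-1}$, $\sigma_0(x)=\int_x^\infty|r|$, $R=\int_0^\infty\xi|r(\xi)|\,d\xi$, $R_0=\frac1{16}\|r\|_{L^\infty(0,\infty)}$. Let $\mathbb D\varphi=\sqrt{k/\rho}\,\varphi'+Q_1\varphi$ (with $\varphi'$ in the sense of distributions) and let $\mathbb H^1$ be the space of real $\varphi\in L^2(\mathbb R;\rho\,dx)$ with $\mathbb D\varphi\in L^2(\mathbb R;\rho\,dx)$, with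 the norm $[\![\varphi]\!]^1=\big(\int(|\varphi|^2+|\mathbb D\varphi|^2)\rho\,dx\big)^{1/2}$; let $\mathbb H^{-1}=(\mathbb H^1)^*$ with its dual norm, into which $\mathbb H^1$ is embedded by $\langle\!\langle f,\varphi\rangle\!\rangle=\int f\varphi\rho\,dx$, and let $\widehat{\mathbb H}^1$ be the subspace of even functions in $\mathbb H^1$. For $\rho=k=1$ these are the usual Sobolev spaces $H^{\pm1}(\mathbb R)$ and $\widehat H^1$, and the norm is denoted $\|\cdot\|^1$. For $T>0$, $u\in L^\infty(0,T)$ and $W^0\in\widehat{\mathbb H}^1$, a *solution* to $$W_t=\mathbb D^2W-qW-2\sqrt{(\rho k)(0)}\,u\,\delta\ \text{ on }\mathbb R\times(0,T),\qquad W(\cdot,0)=W^0\tag{1}$$ is a map $W:[0,T]\to\widehat{\mathbb H}^1$ with $W(\cdot,0)=W^0$ which is absolutely continuous into $\mathbb H^{-1}$ and satisfies the equation in $\mathbb H^{-1}$ for almost every $t\in(0,T)$, where $\langle\!\langle\mathbb D^2W,\varphi\rangle\!\rangle=-\int\mathbb DW\,\mathbb D\varphi\,\rho\,dx$ and $\langle\!\langle\delta,\varphi\rangle\!\rangle=\varphi(0)$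 for $\varphi\in\mathbb H^1$. For $\rho=k=1$, $\gamma=0$ the system (1) is $$Z_t=Z_{\xi\xi}-2u\,\delta,\qquad Z(\cdot,0)=Z^0.\tag{2}$$ Let $\Omega=\{(y_1,y_2): y_2>y_1>0\}$ and let $K\in C^2(\Omega)\cap C(\overline\Omega)$ be a solution to $$K_{y_1y_1}-K_{y_2y_2}=r(y_1)K\ \text{ on }\Omega,\qquad K(y_1,y_1)=\tfrac12\int_{y_1}^\infty r(\xi)\,d\xi\ \ (y_1>0),\qquad \lim_{y_1+y_2\to\infty}(K_{y_1}-K_{y_2})=0\ \text{ on }\Omega .$$ On even functions let $$(\widehat{\mathbb T}g)(x)=\frac{1}{\sqrt[4]{(\rho k)(x)}}\Big(g(\sigma(x))+\int_{|\sigma(x)|}^\infty K(|\sigma(x)|,\xi)\,g(\xi)\,d\xi\Big),\qquad x\in\mathbb R .$$ **Theorem.** There is a constant $M_1>0$ such that $$|K_{y_1}(y_1,y_2)|\le\tfrac14\Big|r\Big(\frac{y_1+y_2}2\Big)\Big|+M_1\,\sigma_0\Big(\frac{y_1+y_2}2\Big)\quad\text{on }\Omega,\tag{3}$$ and there are constants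 $E_0,E_1>0$ such that the following holds for every $M_1>0$ satisfying (3), every $T>0$, every $u^{110}\in L^\infty(0,T)$, every $Z^0\in\widehat H^1$, and every solution $Z$ to (2) with $u=u^{110}$. Put $W(\cdot,t)=\widehat{\mathbb T}Z(\cdot,t)$, $t\in[0,T]$, $W^0=\widehat{\mathbb T}Z^0$, and $$u^{\rho k\gamma}(t)=\frac1{\sqrt[4]{(\rho k)(0)}}\Big(u^{110}(t)+\int_0^\infty K_{y_1}(0,x)Z(x,t)\,dx-\frac12Z(0^+,t)\int_0^\infty r(\xi)\,d\xi\Big).$$ Then $u^{\rho k\gamma}\in L^\infty(0,T)$; $W^0$ and all $W(\cdot,t)$ belong to $\widehat{\mathbb H}^1$; $W$ is a solution to (1) with the control $u=u^{\rho k\gamma}$; the Neumann trace condition $(\mathbb DW)(0^+,t)=u^{\rho k\gamma}(t)$ holds for almost every $t\in(0,T)$; and $$[\![W(\cdot,t)]\!]^1\le E_0\,\|Z(\cdot,t)\|^1,\quad t\in[0,T],$$ $$\|u^{\rho k\gamma}\|_{L^\infty(0,T)}\le G_0(T)\,\|u^{110}\|_{L^\infty(0,T)}+E_1\,\|Z^0\|^1,$$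 $$G_0(T)=\frac1{\sqrt[4]{(\rho k)(0)}}\Big(1+(T+3)\Big(\frac{2\sqrt{\sigma_0(0)}}{\sqrt\pi}\sqrt{R_0+M_1^2R}+\frac{\sigma_0(0)}{\sqrt{2\pi}}\Big)\Big).$$ -/

import Mathlib

open MeasureTheory Set Filter Topology
open scoped ContDiff

noncomputable section

namespace HeatNeumann

/-! ### Coefficients -/

/-- `σ(x) = ∫_0^x √(ρ/k)`. -/
def sigma (ρ k : ℝ → ℝ) (x : ℝ) : ℝ := ∫ ξ in (0 : ℝ)..x, √(ρ ξ / k ξ)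

/-- `Q₁(ρ,k) = √(k/ρ) (kρ)' / (4kρ)`. -/
def Q1 (ρ k : ℝ → ℝ) (x : ℝ) : ℝ :=
  √(k x / ρ x) * deriv (fun y => k y * ρ y) x / (4 * (k x * ρ x))

/-- `Q₂(ρ,k) = √(k/ρ) Q₁' + Q₁²`. -/
def Q2 (ρ k : ℝ → ℝ) (x : ℝ) : ℝ :=
  √(k x / ρ x) * deriv (Q1 ρ k) x + Q1 ρ k x ^ 2

/-- The coefficients of the equation `w_t = (k w_x)_x / ρ + γ w` on the half-axis, already extended
evenly to `ℝ`, with the standing assumptions.  (Since `(ρk)'(0) = 0`, the even extension of `ρk`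
is `C²` on `ℝ`, so the derivatives in `Q1` and `Q2` exist everywhere.) -/
structure Coeffs where
  rho : ℝ → ℝ
  k : ℝ → ℝ
  gamma : ℝ → ℝ
  rho_even : ∀ x, rho (-x) = rho x
  k_even : ∀ x, k (-x) = k x
  gamma_even : ∀ x, gamma (-x) = gamma x
  rho_pos : ∀ x, 0 < rho x
  k_pos : ∀ x, 0 < k x
  rho_C1 : ContDiffOn ℝ 1 rho (Ici 0)
  k_C1 : ContDiffOn ℝ 1 k (Ici 0)
  rho_k_C2 : ContDiffOn ℝ 2 (fun x => rho x * k x) (Ici 0)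
  rho_k_deriv_zero : derivWithin (fun x => rho x * k x) (Ici 0) 0 = 0
  sigma_tendsto : Tendsto (sigma rho k) atTop atTop
  q_C1 : ContDiffOn ℝ 1 (fun x => Q2 rho k x - gamma x) (Ici 0)
  q_bounded : MemLp (fun x => Q2 rho k x - gamma x) ⊤ (volume.restrict (Ioi 0))
  q_integrable :
    IntegrableOn (fun x => √(rho x / k x) * (Q2 rho k x - gamma x) * sigma rho k x) (Ioi 0)

namespace Coeffs

/-- `q = Q₂(ρ,k) - γ`. -/
def q (d : Coeffs) (x : ℝ) : ℝ := Q2 d.rho d.k x - d.gamma x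

/-- `r = q ∘ σ⁻¹` (`σ` is a bijection of `ℝ`). -/
def r (d : Coeffs) (y : ℝ) : ℝ := d.q (Function.invFun (sigma d.rho d.k) y)

/-- The measure `ρ(x) dx` on `ℝ`, so that `L²_ρ(ℝ) = Lp ℝ 2 d.mu`. -/
def mu (d : Coeffs) : Measure ℝ := volume.withDensity fun x => ENNReal.ofReal (d.rho x)

theorem continuous_rho (d : Coeffs) : Continuous d.rho := by
  have h : d.rho = fun x => d.rho |x| := by
    funext x
    rcases abs_choice x with h | h <;> rw [h]
    rw [d.rho_even]
  rw [h]
  exact d.rho_C1.continuousOn.comp_continuous continuous_abs fun x => abs_nonneg x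

theorem volume_ac_mu (d : Coeffs) : volume ≪ d.mu :=
  withDensity_absolutelyContinuous'
    (d.continuous_rho.measurable.ennreal_ofReal.aemeasurable)
    (Eventually.of_forall fun x => (ENNReal.ofReal_pos.2 (d.rho_pos x)).ne')

end Coeffs

theorem sigma_one (x : ℝ) : sigma (fun _ => 1) (fun _ => 1) x = x := by simp [sigma]

theorem Q1_one : Q1 (fun _ => 1) (fun _ => 1) = fun _ => 0 := by funext x; simp [Q1]

theorem Q2_one (x : ℝ) : Q2 (fun _ => 1) (fun _ => 1) x = 0 := by simp [Q2, Q1_one]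

/-- The constant coefficients `ρ = k = 1`, `γ = 0`. -/
def unitCoeffs : Coeffs where
  rho := fun _ => 1
  k := fun _ => 1
  gamma := fun _ => 0
  rho_even := fun _ => rfl
  k_even := fun _ => rfl
  gamma_even := fun _ => rfl
  rho_pos := fun _ => one_pos
  k_pos := fun _ => one_pos
  rho_C1 := contDiffOn_const
  k_C1 := contDiffOn_const
  rho_k_C2 := contDiffOn_const
  rho_k_deriv_zero := by simp
  sigma_tendsto := by
    have h : sigma (fun _ => 1) (fun _ => 1) = id := funext sigma_one
    rw [h]; exact tendsto_id
  q_C1 := by simp only [Q2_one]; exact contDiffOn_const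
  q_bounded := by simp [Q2_one]
  q_integrable := by simp [Q2_one]

/-! ### The modified Sobolev spaces -/

/-- `h` is the derivative of `f` in the sense of distributions on `ℝ`. -/
structure HasWeakDeriv (f h : ℝ → ℝ) : Prop where
  loc : LocallyIntegrable f
  loc_deriv : LocallyIntegrable h
  integral_eq : ∀ ψ : ℝ → ℝ, ContDiff ℝ ∞ ψ → HasCompactSupport ψ →
    ∫ x, f x * deriv ψ x = -∫ x, h x * ψ x

/-- `g = 𝔻_{ρk} f = √(k/ρ) f' + Q₁(ρ,k) f`, with `f'` in the sense of distributions. -/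
def IsD (d : Coeffs) (f g : ℝ → ℝ) : Prop :=
  ∃ h : ℝ → ℝ, HasWeakDeriv f h ∧
    ∀ᵐ x, g x = √(d.k x / d.rho x) * h x + Q1 d.rho d.k x * f x

theorem HasWeakDeriv.zero : HasWeakDeriv (fun _ => 0) (fun _ => 0) :=
  ⟨locallyIntegrable_const 0, locallyIntegrable_const 0, by simp⟩

theorem HasWeakDeriv.smul {f h : ℝ → ℝ} (c : ℝ) (H : HasWeakDeriv f h) :
    HasWeakDeriv (fun x => c * f x) (fun x => c * h x) := by
  refine ⟨H.loc.smul c, H.loc_deriv.smul c, fun ψ hψ hc => ?_⟩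
  simp only [mul_assoc, integral_const_mul, H.integral_eq ψ hψ hc, mul_neg]

theorem HasWeakDeriv.add {f h f' h' : ℝ → ℝ} (H : HasWeakDeriv f h) (H' : HasWeakDeriv f' h') :
    HasWeakDeriv (fun x => f x + f' x) (fun x => h x + h' x) := by
  refine ⟨H.loc.add H'.loc, H.loc_deriv.add H'.loc_deriv, fun ψ hψ hc => ?_⟩
  have hd : Continuous (deriv ψ) := hψ.continuous_deriv (by simp)
  have i1 := H.loc.integrable_smul_right_of_hasCompactSupport hd hc.deriv
  have i2 := H'.loc.integrable_smul_right_of_hasCompactSupport hd hc.deriv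
  have i3 := H.loc_deriv.integrable_smul_right_of_hasCompactSupport hψ.continuous hc
  have i4 := H'.loc_deriv.integrable_smul_right_of_hasCompactSupport hψ.continuous hc
  simp only [smul_eq_mul] at i1 i2 i3 i4
  simp only [add_mul]
  rw [integral_add i1 i2, integral_add i3 i4, H.integral_eq ψ hψ hc, H'.integral_eq ψ hψ hc]
  ring

theorem HasWeakDeriv.congr {f f' h : ℝ → ℝ} (H : HasWeakDeriv f h) (e : f =ᵐ[volume] f') :
    HasWeakDeriv f' h := by
  refine ⟨H.loc.congr e, H.loc_deriv, fun ψ hψ hc => ?_⟩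
  rw [← H.integral_eq ψ hψ hc]
  refine integral_congr_ae ?_
  filter_upwards [e] with x hx
  rw [hx]

/-- The space `ℍ¹ = {f ∈ L²_ρ(ℝ) | 𝔻_{ρk} f ∈ L²_ρ(ℝ)}`: its elements are the pairs
`(f, 𝔻_{ρk} f)`, and its norm is `(‖f‖² + ‖𝔻_{ρk} f‖²)^{1/2}`, the norms being those
of `L²_ρ(ℝ)`.  For `d = unitCoeffs` this is the Sobolev space `H¹` with its norm. -/
def H1 (d : Coeffs) : Submodule ℝ (WithLp 2 (Lp ℝ 2 d.mu × Lp ℝ 2 d.mu)) where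
  carrier := {p | IsD d p.fst p.snd}
  zero_mem' := by
    have e : (⇑(0 : Lp ℝ 2 d.mu)) =ᵐ[volume] 0 := d.volume_ac_mu.ae_eq (Lp.coeFn_zero ℝ 2 d.mu)
    refine ⟨fun _ => 0, HasWeakDeriv.zero.congr ?_, ?_⟩
    · filter_upwards [e] with x hx
      exact hx.symm
    · filter_upwards [e] with x hx
      rw [WithLp.zero_fst, WithLp.zero_snd, hx]
      simp
  add_mem' := by
    rintro p p' ⟨h, H, hg⟩ ⟨h', H', hg'⟩
    have e1 := d.volume_ac_mu.ae_eq (Lp.coeFn_add p.fst p'.fst)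
    have e2 := d.volume_ac_mu.ae_eq (Lp.coeFn_add p.snd p'.snd)
    refine ⟨fun x => h x + h' x, (H.add H').congr ?_, ?_⟩
    · filter_upwards [e1] with x hx
      exact hx.symm
    · filter_upwards [e1, e2, hg, hg'] with x h1 h2 h3 h4
      simp only [WithLp.add_fst, WithLp.add_snd, h1, h2, Pi.add_apply, h3, h4]
      ring
  smul_mem' := by
    rintro c p ⟨h, H, hg⟩
    have e1 := d.volume_ac_mu.ae_eq (Lp.coeFn_smul c p.fst)
    have e2 := d.volume_ac_mu.ae_eq (Lp.coeFn_smul c p.snd)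
    refine ⟨fun x => c * h x, (H.smul c).congr ?_, ?_⟩
    · filter_upwards [e1] with x hx
      exact hx.symm
    · filter_upwards [e1, e2, hg] with x h1 h2 h3
      simp only [WithLp.smul_fst, WithLp.smul_snd, h1, h2, Pi.smul_apply, smul_eq_mul, h3]
      ring

/-- The function underlying an element of `ℍ¹`. -/
def H1.fn {d : Coeffs} (f : H1 d) : Lp ℝ 2 d.mu := f.1.fst

/-- `𝔻_{ρk} f`. -/
def H1.D {d : Coeffs} (f : H1 d) : Lp ℝ 2 d.mu := f.1.snd

/-- `f ∈ ℍ¹` is even, i.e. belongs to the closed subspace `ℍ̂¹`. -/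
def H1.IsEven {d : Coeffs} (f : H1 d) : Prop := ∀ᵐ x, H1.fn f (-x) = H1.fn f x

/-- The dual space `ℍ⁻¹ = (ℍ¹)*` with its (strong) norm topology. -/
abbrev Hneg (d : Coeffs) : Type := StrongDual ℝ (H1 d)

/-- The embedding of `ℍ¹` into `ℍ⁻¹`: `⟨⟨f, φ⟩⟩ = ∫ f φ ρ dx`. -/
def H1.toHneg {d : Coeffs} (f : H1 d) : Hneg d :=
  (innerSL ℝ (H1.fn f)).comp
    ((WithLp.fstL 2 ℝ (Lp ℝ 2 d.mu) (Lp ℝ 2 d.mu)).comp (H1 d).subtypeL)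

/-- The value at `0` of (the continuous representative of) a function: its essential limit. -/
def valueAtZero (f : ℝ → ℝ) : ℝ := limUnder (𝓝 0 ⊓ ae volume) f

/-- The value `f(0⁺)` of a function known up to null sets: its essential limit from the right. -/
def rightValue (f : ℝ → ℝ) : ℝ := limUnder (𝓝[>] 0 ⊓ ae volume) f

/-- `f(0⁺)` exists and equals `c`, for a function known up to null sets. -/
def HasRightValue (f : ℝ → ℝ) (c : ℝ) : Prop := Tendsto f (𝓝[>] 0 ⊓ ae volume) (𝓝 c)

/-! ### The control system -/

/-- `W` is a solution on `[0,T]` to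
`W_t = 𝔻²_{ρk} W - q W - 2 √((ρk)(0)) u δ`, `W(·,0) = W⁰`, with `W(t) ∈ ℍ̂¹`, `W_t(t) ∈ ℍ⁻¹`.
As `u` is only an element of `L^∞(0,T)`, the equation holds in `ℍ⁻¹` for a.e. `t`, and `W` is
absolutely continuous with values in `ℍ⁻¹`.
Here `⟨⟨𝔻²_{ρk} W, φ⟩⟩ = -⟨⟨𝔻_{ρk} W, 𝔻_{ρk} φ⟩⟩` and `⟨⟨δ, φ⟩⟩ = φ(0)`. -/
structure IsSolution (d : Coeffs) (T : ℝ) (u : ℝ → ℝ) (W0 : H1 d) (W : ℝ → H1 d) : Prop where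
  initial : W 0 = W0
  even : ∀ t ∈ Icc 0 T, H1.IsEven (W t)
  abs_cont : AbsolutelyContinuousOnInterval (fun t => H1.toHneg (W t)) 0 T
  equation : ∀ᵐ t ∂(volume.restrict (Ioo 0 T)), ∃ F : Hneg d,
    HasDerivAt (fun s => H1.toHneg (W s)) F t ∧
    ∀ φ : H1 d, F φ =
      -inner ℝ (H1.D (W t)) (H1.D φ)
      - (∫ x, d.q x * H1.fn (W t) x * H1.fn φ x * d.rho x)
      - 2 * √(d.rho 0 * d.k 0) * u t * valueAtZero (H1.fn φ)

/-- The norm of `L^∞(0,T)`. -/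
def normLinfty (T : ℝ) (u : ℝ → ℝ) : ℝ := (eLpNorm u ⊤ (volume.restrict (Ioo 0 T))).toReal

/-! ### The transformation operator -/

/-- `Ω = {(y₁,y₂) | y₂ > y₁ > 0}`. -/
def Omega : Set (ℝ × ℝ) := {p | 0 < p.1 ∧ p.1 < p.2}

/-- The filter `y₁ + y₂ → ∞` in `Ω`. -/
def atInfty : Filter (ℝ × ℝ) := comap (fun p : ℝ × ℝ => p.1 + p.2) atTop ⊓ 𝓟 Omega

/-- The kernel problem `K_{y₁y₁} - K_{y₂y₂} = r(y₁) K` on `Ω`, `K(y₁,y₁) = ½ ∫_{y₁}^∞ r`,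
with decay of the derivatives at infinity.  Only the decay of `K_{y₁} - K_{y₂}` is asked for: this
follows from the decay of both `K_{y₁}` and `K_{y₂}`, it already determines `K`, and it is
the part that does not force `r` to tend to `0` at infinity. -/
structure IsKernel (r : ℝ → ℝ) (K : ℝ → ℝ → ℝ) : Prop where
  contDiff : ContDiffOn ℝ 2 (fun p : ℝ × ℝ => K p.1 p.2) Omega
  continuous : ContinuousOn (fun p : ℝ × ℝ => K p.1 p.2) (closure Omega)
  equation : ∀ p ∈ Omega,
    iteratedDeriv 2 (fun y => K y p.2) p.1 - iteratedDeriv 2 (fun y => K p.1 y) p.2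
      = r p.1 * K p.1 p.2
  diagonal : ∀ y, 0 < y → K y y = (1 / 2) * ∫ ξ in Ioi y, r ξ
  decay : Tendsto (fun p : ℝ × ℝ => deriv (fun y => K y p.2) p.1 - deriv (fun y => K p.1 y) p.2)
    atInfty (𝓝 0)

/-- `σ₀(x) = ∫_x^∞ |r|`. -/
def sigma0 (r : ℝ → ℝ) (x : ℝ) : ℝ := ∫ ξ in Ioi x, |r ξ|

/-- The estimate `|K_{y₁}(y₁,y₂)| ≤ ¼ |r((y₁+y₂)/2)| + M₁ σ₀((y₁+y₂)/2)` on `Ω`. -/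
def KernelBound (r : ℝ → ℝ) (K : ℝ → ℝ → ℝ) (M1 : ℝ) : Prop :=
  ∀ p ∈ Omega, |deriv (fun y => K y p.2) p.1| ≤
    (1 / 4) * |r ((p.1 + p.2) / 2)| + M1 * sigma0 r ((p.1 + p.2) / 2)

/-- `(T̂_r g)(y) = g(y) + ∫_{|y|}^∞ K(|y|,ξ) g(ξ) dξ`. -/
def Tr (K : ℝ → ℝ → ℝ) (g : ℝ → ℝ) (y : ℝ) : ℝ := g y + ∫ ξ in Ioi |y|, K |y| ξ * g ξ

/-- `S ψ = (ψ ∘ σ) / (ρk)^{1/4}`. -/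
def S (d : Coeffs) (ψ : ℝ → ℝ) (x : ℝ) : ℝ :=
  ψ (sigma d.rho d.k x) / (d.rho x * d.k x) ^ (1 / 4 : ℝ)

/-- The transformation operator `𝕋̂ = S T̂_r` on functions. -/
def That (d : Coeffs) (K : ℝ → ℝ → ℝ) (g : ℝ → ℝ) : ℝ → ℝ := S d (Tr K g)

/-- The control
`(ρk)(0)^{-1/4} (u(t) + ∫_0^∞ K_{y₁}(0,x) Z(x,t) dx - ½ Z(0⁺,t) ∫_0^∞ r)`. -/
def newControl (d : Coeffs) (K : ℝ → ℝ → ℝ) (u : ℝ → ℝ) (Z : ℝ → H1 unitCoeffs) (t : ℝ) : ℝ :=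
  1 / (d.rho 0 * d.k 0) ^ (1 / 4 : ℝ) *
    (u t + (∫ x in Ioi 0, derivWithin (fun y => K y x) (Ici 0) 0 * H1.fn (Z t) x)
      - 1 / 2 * rightValue (H1.fn (Z t)) * ∫ ξ in Ioi 0, d.r ξ)

/-- `R = ∫_0^∞ ξ |r(ξ)| dξ`. -/
def R (r : ℝ → ℝ) : ℝ := ∫ ξ in Ioi 0, ξ * |r ξ|

/-- `R₀ = ‖r‖_{L^∞(0,∞)} / 16`. -/
def R0 (r : ℝ → ℝ) : ℝ := 1 / 16 * (eLpNorm r ⊤ (volume.restrict (Ioi 0))).toReal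

/-- The constant `G₀(T)`, for a constant `M₁` in the estimate of `K_{y₁}`. -/
def G0 (d : Coeffs) (M1 T : ℝ) : ℝ :=
  1 / (d.rho 0 * d.k 0) ^ (1 / 4 : ℝ) *
    (1 + (T + 3) * (2 * √(sigma0 d.r 0) / √Real.pi * √(R0 d.r + M1 ^ 2 * R d.r)
      + sigma0 d.r 0 / √(2 * Real.pi)))

end HeatNeumann

end

open HeatNeumann

open MeasureTheory Set Filter Topology
open scoped ContDiff

noncomputable section

namespace HeatNeumann

/-! ### Primitives of locally integrable functions -/

/-! Two changes of unknown reduce the problem to the free heat equation. The map `S` is an isometry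
of `H¹(ℝ)` onto `ℍ¹` which turns `𝔻` into `d/dx` and multiplication by `q` into multiplication by
`r` (`rho_eq`, `isPrim_S`, `exists_isPrim_of_IsD`), so every element of `ℍ¹` is handled through its
continuous representative `rep` on the line. What remains is the Volterra operator `T = I + K`,
which intertwines `d²/dx²` with `d²/dx² - r`.

Since solutions live in `ℍ⁻¹`, the intertwining is used in weak form. Let `Tt` be the transpose of
`T` on the half-line. For `g` and `φ` in `H¹` the form `∫ g' (Tt φ)'` over `(0,∞)` equals `∫ (T g)'
φ' + ∫ r (T g) φ` plus the boundary term `φ(0) (∫ K_{y₁}(0,x) g(x) dx - ½ g(0) ∫ r)`; this is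
`integral_deriv_T`. The boundary term is exactly the correction made to the control. Because `⟨T Z,
φ⟩ = ⟨Z, Tt φ⟩`, the transformed state, seen in `ℍ⁻¹`, is the image of `Z` under a fixed bounded
operator. Absolute continuity and the equation therefore pass to it directly (`toHneg_transform`,
`functional_transform`).

The kernel is `C²` only inside `Ω`, so second derivatives are never used up to the boundary.
Integrating the hyperbolic equation along its characteristics expresses `K_{y₂} - K_{y₁}` as an
integral `Bk` to infinity and `K_{y₁} + K_{y₂}` as `Ak`, an integral to the diagonal minus `½ r`
there (`d2_sub_d1`, `d1_add_d2`). Both extend continuously to the closed region and are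
differentiable along one family of characteristics, which is all that the integrations by parts
need. A Grönwall argument gives `|K| ≤ e^{2R} σ₀` at the mean of the arguments (`abs_K_le`); hence
estimate (3) and, by the first moment of `r`, square integrability of `K` and its first derivatives
over `Ω`. The resulting Hilbert–Schmidt bounds give the constant `E₀`.

For the control, pairing `Z` with backward heat kernels yields Duhamel's formula (`heat_formula`).
Cauchy–Schwarz against `K_{y₁}(0,·)` and the explicit size of the Duhamel term produce `G₀(T)`. For
the Neumann trace, the spatial derivative of the Duhamel term at `x > 0` is an average of `u(t - x²
τ)` against a fixed density of mass one. As `x → 0⁺` it converges at left Lebesgue points of `u`,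
while the initial state contributes nothing because it is even (`heat_neumann`). The terms added by
`T` then have ordinary right limits. -/

/-- `f` is a primitive of the locally integrable function `h`. -/
structure IsPrim (f h : ℝ → ℝ) : Prop where
  loc : LocallyIntegrable h
  eq : ∀ x, f x = f 0 + ∫ t in (0 : ℝ)..x, h t

theorem _root_.MeasureTheory.LocallyIntegrable.intervalIntegrable' {h : ℝ → ℝ}
    (H : LocallyIntegrable h) (a b : ℝ) : IntervalIntegrable h volume a b :=
  (H.integrableOn_isCompact isCompact_uIcc).intervalIntegrable

theorem locallyIntegrable_of_intervalIntegrable {h : ℝ → ℝ}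
    (H : ∀ a b, IntervalIntegrable h volume a b) : LocallyIntegrable h := by
  refine fun x => ⟨Icc (x - 1) (x + 1), Icc_mem_nhds (by linarith) (by linarith), ?_⟩
  have := H (x - 1) (x + 1)
  rwa [intervalIntegrable_iff_integrableOn_Icc_of_le (by linarith)] at this

namespace IsPrim

variable {f h g k : ℝ → ℝ}

theorem sub_eq (H : IsPrim f h) (a b : ℝ) : f b - f a = ∫ t in a..b, h t := by
  rw [H.eq a, H.eq b, ← intervalIntegral.integral_interval_sub_left
    (H.loc.intervalIntegrable' 0 b) (H.loc.intervalIntegrable' 0 a)]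
  ring

theorem continuous (H : IsPrim f h) : Continuous f := by
  have : f = fun x => f 0 + ∫ t in (0 : ℝ)..x, h t := funext H.eq
  rw [this]
  exact continuous_const.add
    (intervalIntegral.continuous_primitive (fun a b => H.loc.intervalIntegrable' a b) 0)

theorem ac (H : IsPrim f h) (a b : ℝ) : AbsolutelyContinuousOnInterval f a b := by
  have e : f = fun x => f a + ∫ t in a..x, h t := by
    funext x; rw [← H.sub_eq a x]; ring
  rw [e]
  have h1 := (H.loc.intervalIntegrable' a b).absolutelyContinuousOnInterval_intervalIntegral
    (c := a) (by simp)
  have h2 : AbsolutelyContinuousOnInterval (fun _ : ℝ => f a) a b :=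
    (contDiffOn_const (𝕜 := ℝ) (n := 1)).absolutelyContinuousOnInterval
  exact h2.add h1

theorem ae_hasDerivAt (H : IsPrim f h) : ∀ᵐ x, HasDerivAt f (h x) x := by
  filter_upwards [LocallyIntegrable.ae_hasDerivAt_integral H.loc] with x hx
  have e : f = fun x => f 0 + ∫ t in (0 : ℝ)..x, h t := funext H.eq
  rw [e]
  exact (hx 0).const_add _

theorem of_ac (H : ∀ a b, AbsolutelyContinuousOnInterval f a b)
    (hd : ∀ᵐ x, HasDerivAt f (h x) x) : IsPrim f h := by
  have e : deriv f =ᵐ[volume] h := by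
    filter_upwards [hd] with x hx using hx.deriv
  refine ⟨(locallyIntegrable_of_intervalIntegrable
    fun a b => (H a b).intervalIntegrable_deriv).congr e, fun x => ?_⟩
  rw [← intervalIntegral.integral_congr_ae (e.mono fun x hx _ => hx), (H 0 x).integral_deriv_eq_sub]
  ring

theorem of_hasDerivAt (hk : Continuous h) (H : ∀ x, HasDerivAt f (h x) x) : IsPrim f h := by
  refine ⟨hk.locallyIntegrable, fun x => ?_⟩
  rw [intervalIntegral.integral_eq_sub_of_hasDerivAt (fun y _ => H y) (hk.intervalIntegrable _ _)]
  ring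

theorem congr_deriv (H : IsPrim f h) (e : h =ᵐ[volume] k) : IsPrim f k := by
  refine ⟨H.loc.congr e, fun x => ?_⟩
  rw [H.eq x, intervalIntegral.integral_congr_ae (e.mono fun x hx _ => hx)]

theorem mul (H : IsPrim f h) (G : IsPrim g k) :
    IsPrim (fun x => f x * g x) (fun x => h x * g x + f x * k x) := by
  refine of_ac (fun a b => (H.ac a b).fun_mul (G.ac a b)) ?_
  filter_upwards [H.ae_hasDerivAt, G.ae_hasDerivAt] with x h1 h2 using h1.mul h2

theorem add (H : IsPrim f h) (G : IsPrim g k) :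
    IsPrim (fun x => f x + g x) (fun x => h x + k x) := by
  refine of_ac (fun a b => (H.ac a b).fun_add (G.ac a b)) ?_
  filter_upwards [H.ae_hasDerivAt, G.ae_hasDerivAt] with x h1 h2 using h1.add h2

theorem const_mul (c : ℝ) (H : IsPrim f h) : IsPrim (fun x => c * f x) (fun x => c * h x) := by
  refine of_ac (fun a b => (H.ac a b).const_mul c) ?_
  filter_upwards [H.ae_hasDerivAt] with x h1 using h1.const_mul c

theorem const_sub_comp (H : IsPrim f h) (m : ℝ) :
    IsPrim (fun x => f (m - x)) (fun x => -h (m - x)) := by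
  have hmp : MeasurePreserving (fun x : ℝ => m - x) :=
    Measure.measurePreserving_sub_left volume m
  refine ⟨?_, fun x => ?_⟩
  · refine locallyIntegrable_of_intervalIntegrable fun a b => ?_
    have := ((H.loc.intervalIntegrable' (m - a) (m - b)).comp_sub_left m).neg
    simp only [sub_sub_cancel] at this
    exact this
  · have := H.sub_eq m (m - x)
    simp only [sub_zero]
    rw [intervalIntegral.integral_neg, intervalIntegral.integral_comp_sub_left (fun x => h x) m,
      sub_zero, ← intervalIntegral.integral_symm, ← this]
    ring

theorem comp_add (H : IsPrim f h) (m : ℝ) :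
    IsPrim (fun x => f (x + m)) (fun x => h (x + m)) := by
  refine ⟨?_, fun x => ?_⟩
  · refine locallyIntegrable_of_intervalIntegrable fun a b => ?_
    have := ((H.loc.intervalIntegrable' (a + m) (b + m)).comp_add_right m)
    simpa using this
  · rw [intervalIntegral.integral_comp_add_right (fun x => h x) m, ← H.sub_eq]
    ring

theorem comp_neg (H : IsPrim f h) : IsPrim (fun x => f (-x)) (fun x => -h (-x)) := by
  simpa using H.const_sub_comp 0

/-- Composition with an increasing `C¹` map. -/
theorem comp {s s' : ℝ → ℝ} (H : IsPrim f h) (hs : ∀ x, HasDerivAt s (s' x) x)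
    (hpos : ∀ x, 0 ≤ s' x) :
    IsPrim (fun x => f (s x)) (fun x => s' x * h (s x)) := by
  have hc : Continuous s := continuous_iff_continuousAt.2 fun x => (hs x).continuousAt
  have key : ∀ a b, a ≤ b → IntegrableOn (fun x => s' x * h (s x)) (Icc a b) ∧
      f (s b) - f (s a) = ∫ x in a..b, s' x * h (s x) := by
    intro a b hab
    have hmono : s a ≤ s b := (monotone_of_hasDerivAt_nonneg hs hpos) hab
    constructor
    · exact (integrableOn_Icc_deriv_smul_iff_of_deriv_nonneg hc.continuousOn
        (fun x _ => hs x) (fun x _ => hpos x) hab (g := h)).2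
        (H.loc.integrableOn_isCompact isCompact_Icc)
    · rw [H.sub_eq, intervalIntegral.integral_of_le hab, intervalIntegral.integral_of_le hmono,
        ← integral_Icc_eq_integral_Ioc, ← integral_Icc_eq_integral_Ioc]
      exact (integral_Icc_deriv_smul_of_deriv_nonneg hc.continuousOn
        (fun x _ => hs x) (fun x _ => hpos x) (g := h) hab).symm
  refine ⟨fun x => ⟨Icc (x - 1) (x + 1), Icc_mem_nhds (by linarith) (by linarith),
    (key _ _ (by linarith)).1⟩, fun x => ?_⟩
  rcases le_total 0 x with hx | hx
  · rw [← (key 0 x hx).2]; ring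
  · rw [intervalIntegral.integral_symm, ← (key x 0 hx).2]; ring

theorem integral_eq_zero (H : IsPrim f h) (hi : Integrable h) (h1 : Tendsto f atTop (𝓝 0))
    (h2 : Tendsto f atBot (𝓝 0)) : ∫ x, h x = 0 := by
  have t1 := intervalIntegral_tendsto_integral hi (tendsto_neg_atTop_atBot (G := ℝ)) tendsto_id
  have t2 : Tendsto (fun i : ℝ => f i - f (-i)) atTop (𝓝 (0 - 0)) :=
    h1.sub (h2.comp tendsto_neg_atTop_atBot)
  refine tendsto_nhds_unique t1 ?_
  simpa [H.sub_eq] using t2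

theorem tendsto_atTop (H : IsPrim f h) (hh : IntegrableOn h (Ioi 0)) :
    Tendsto f atTop (𝓝 (f 0 + ∫ x in Ioi 0, h x)) := by
  have t := (intervalIntegral_tendsto_integral_Ioi 0 hh tendsto_id).const_add (f 0)
  refine t.congr fun x => ?_
  rw [H.eq x]; rfl

theorem tendsto_zero_atTop (H : IsPrim f h) (hf : IntegrableOn f (Ioi 0))
    (hh : IntegrableOn h (Ioi 0)) : Tendsto f atTop (𝓝 0) := by
  have t := H.tendsto_atTop hh
  have : f 0 + ∫ x in Ioi 0, h x = 0 := by
    -- An integrable function can have no limit at infinity other than zero, since half-lines have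
    -- infinite measure.
    refine IntegrableAtFilter.eq_zero_of_tendsto (l := atTop) (μ := volume) ⟨Ioi 0, Ioi_mem_atTop 0, hf⟩
      ?_ t
    intro s hs
    rcases mem_atTop_sets.1 hs with ⟨b, hb⟩
    rw [← top_le_iff, ← Real.volume_Ici (a := b)]
    exact measure_mono hb
  rwa [this] at t

theorem tendsto_zero_atBot (H : IsPrim f h) (hf : Integrable f)
    (hh : Integrable h) : Tendsto f atBot (𝓝 0) := by
  have := H.comp_neg.tendsto_zero_atTop hf.comp_neg.integrableOn hh.comp_neg.neg.integrableOn
  have := this.comp tendsto_neg_atBot_atTop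
  refine this.congr fun x => ?_
  simp

theorem hasWeakDeriv (H : IsPrim f h) : HasWeakDeriv f h := by
  refine ⟨H.continuous.locallyIntegrable, H.loc, fun ψ hψ hc => ?_⟩
  have hd : Continuous (deriv ψ) := hψ.continuous_deriv (by simp)
  have hψ1 : IsPrim ψ (deriv ψ) := of_hasDerivAt hd
    fun x => (hψ.differentiable (by simp) x).hasDerivAt
  have i1 := (H.continuous.locallyIntegrable
    (μ := volume)).integrable_smul_right_of_hasCompactSupport hd hc.deriv
  have i2 := H.loc.integrable_smul_right_of_hasCompactSupport hψ.continuous hc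
  simp only [smul_eq_mul] at i1 i2
  have hz : Tendsto (fun x => f x * ψ x) (cocompact ℝ) (𝓝 0) := by
    have := hasCompactSupport_iff_eventuallyEq.1 hc
    rw [coclosedCompact_eq_cocompact] at this
    refine (tendsto_const_nhds (x := (0 : ℝ))).congr' ?_
    filter_upwards [this] with x hx
    rw [hx]; simp
  have := (H.mul hψ1).integral_eq_zero (i2.add i1) (hz.mono_left atTop_le_cocompact)
    (hz.mono_left atBot_le_cocompact)
  rw [integral_add i2 i1] at this
  linarith

end IsPrim

/-- The lemma of du Bois-Reymond: a function with vanishing weak derivative is constant. -/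
theorem HasWeakDeriv.exists_ae_eq_const {g : ℝ → ℝ} (H : HasWeakDeriv g fun _ => 0) :
    ∃ c, ∀ᵐ x, g x = c := by
  let η : ℝ → ℝ := (default : ContDiffBump (0 : ℝ)).normed volume
  have hη : ContDiff ℝ ∞ η := (default : ContDiffBump (0 : ℝ)).contDiff_normed
  have hηc : HasCompactSupport η := (default : ContDiffBump (0 : ℝ)).hasCompactSupport_normed
  have hη1 : ∫ x, η x = 1 := (default : ContDiffBump (0 : ℝ)).integral_normed
  refine ⟨∫ x, η x * g x, ae_eq_of_integral_contDiff_smul_eq H.loc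
    (locallyIntegrable_const _) fun ψ hψ hc => ?_⟩
  set m := ∫ x, ψ x with hm
  -- Subtracting from `ψ` its mean times a bump of integral one leaves a function of integral zero,
  -- hence the derivative of a compactly supported `χ`. Testing with `χ` gives `∫ g ψ = (∫ g η) ∫
  -- ψ`, so `g` is the constant `∫ g η`.
  let θ : ℝ → ℝ := fun x => ψ x - m * η x
  have hθ : ContDiff ℝ ∞ θ := hψ.sub (contDiff_const.mul hη)
  have hθc : HasCompactSupport θ := hc.sub (hηc.mul_left)
  have iψ : Integrable ψ := hψ.continuous.integrable_of_hasCompactSupport hc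
  have iη : Integrable η := hη.continuous.integrable_of_hasCompactSupport hηc
  have hθ0 : ∫ x, θ x = 0 := by
    simp only [θ]
    rw [integral_sub iψ (iη.const_mul m), integral_const_mul, hη1]
    simp [hm]
  obtain ⟨R, hR⟩ := hθc.isCompact.isBounded.subset_ball (0 : ℝ)
  rw [Real.ball_eq_Ioo] at hR
  simp only [zero_sub, zero_add] at hR
  have hθz : ∀ x, x ∉ Ioo (-R) R → θ x = 0 := fun x hx =>
    image_eq_zero_of_notMem_tsupport fun h => hx (hR h)
  let χ : ℝ → ℝ := fun x => ∫ t in (-R)..x, θ t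
  have hχd : ∀ x, HasDerivAt χ (θ x) x := fun x =>
    intervalIntegral.integral_hasDerivAt_right (hθ.continuous.intervalIntegrable _ _)
      (hθ.continuous.stronglyMeasurableAtFilter _ _) hθ.continuous.continuousAt
  have hχ' : deriv χ = θ := funext fun x => (hχd x).deriv
  have hχ : ContDiff ℝ ∞ χ := by
    rw [contDiff_infty_iff_deriv]
    exact ⟨fun x => (hχd x).differentiableAt, hχ' ▸ hθ⟩
  have hχc : HasCompactSupport χ := by
    refine HasCompactSupport.intro (K := Icc (-R) R) isCompact_Icc fun x hx => ?_
    rcases lt_or_ge x (-R) with h | h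
    · simp only [χ]
      rw [intervalIntegral.integral_congr (g := fun _ => 0), intervalIntegral.integral_zero]
      intro t ht
      rw [uIcc_of_ge h.le] at ht
      exact hθz t fun h' => by linarith [ht.2, h'.1]
    · have hx' : R < x := by
        by_contra h'; exact hx ⟨h, not_lt.1 h'⟩
      simp only [χ]
      rw [intervalIntegral.integral_eq_integral_of_support_subset, hθ0]
      intro t ht
      have : t ∈ Ioo (-R) R := by
        by_contra h'; exact ht (hθz t h')
      exact ⟨this.1, this.2.le.trans hx'.le⟩
  have key := H.integral_eq χ hχ hχc
  rw [hχ'] at key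
  have j1 := H.loc.integrable_smul_right_of_hasCompactSupport hψ.continuous hc
  have j2 := H.loc.integrable_smul_right_of_hasCompactSupport hη.continuous hηc
  simp only [smul_eq_mul] at j1 j2 ⊢
  have e : (fun x => g x * θ x) = fun x => g x * ψ x - m * (g x * η x) := by
    funext x; simp only [θ]; ring
  rw [e, integral_sub j1 (j2.const_mul m), integral_const_mul] at key
  simp only [zero_mul, integral_zero, neg_zero] at key
  rw [integral_mul_const, ← hm]
  simp only [mul_comm _ (g _)]
  linarith

/-- Subtracting the primitive of `h` leaves a function with zero weak derivative, which is constant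
almost everywhere by the preceding lemma. This is the passage from distributional derivatives to
absolutely continuous representatives. -/
theorem HasWeakDeriv.exists_isPrim {f h : ℝ → ℝ} (H : HasWeakDeriv f h) :
    ∃ g, f =ᵐ[volume] g ∧ IsPrim g h := by
  have P : IsPrim (fun x => ∫ t in (0 : ℝ)..x, h t) h := ⟨H.loc_deriv, fun x => by simp⟩
  have W := H.add (P.hasWeakDeriv.smul (-1))
  have e : (fun x => h x + -1 * h x) = fun _ => (0 : ℝ) := by funext x; ring
  rw [e] at W
  obtain ⟨c, hc⟩ := W.exists_ae_eq_const
  refine ⟨fun x => c + ∫ t in (0 : ℝ)..x, h t, ?_, H.loc_deriv, fun x => by simp⟩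
  filter_upwards [hc] with x hx
  linarith

/-! ### The Sobolev space `H¹(ℝ)` in terms of primitives -/

/-- `f ∈ H¹(ℝ)` is the continuous representative, with derivative `h`. -/
structure LineH1 (f h : ℝ → ℝ) : Prop extends IsPrim f h where
  memLp : MemLp f 2
  memLp_deriv : MemLp h 2

/-- `∫ f² + ∫ h²`. -/
def energy (f h : ℝ → ℝ) : ℝ := (∫ x, f x ^ 2) + ∫ x, h x ^ 2

namespace LineH1

variable {f h g k : ℝ → ℝ}

theorem sq_isPrim (H : LineH1 f h) : IsPrim (fun x => f x * f x) (fun x => 2 * (f x * h x)) := by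
  refine (H.toIsPrim.mul H.toIsPrim).congr_deriv (Eventually.of_forall fun x => ?_)
  simp only; ring

theorem integrable_mul (H : LineH1 f h) : Integrable (fun x => 2 * (f x * h x)) :=
  (H.memLp.integrable_mul H.memLp_deriv).const_mul 2

theorem integrable_sq (H : LineH1 f h) : Integrable (fun x => f x * f x) :=
  H.memLp.integrable_mul H.memLp

theorem tendsto_atTop (H : LineH1 f h) : Tendsto f atTop (𝓝 0) := by
  have := H.sq_isPrim.tendsto_zero_atTop H.integrable_sq.integrableOn H.integrable_mul.integrableOn
  have := this.sqrt
  simp only [Real.sqrt_mul_self_eq_abs, Real.sqrt_zero] at this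
  exact (tendsto_zero_iff_abs_tendsto_zero _).2 this

theorem tendsto_atBot (H : LineH1 f h) : Tendsto f atBot (𝓝 0) := by
  have := H.sq_isPrim.tendsto_zero_atBot H.integrable_sq H.integrable_mul
  have := this.sqrt
  simp only [Real.sqrt_mul_self_eq_abs, Real.sqrt_zero] at this
  exact (tendsto_zero_iff_abs_tendsto_zero _).2 this

/-- The Sobolev embedding with constant one: as `f` vanishes at infinity, `f(x)²` is the integral of
`-2 f h` over `(x,∞)`, and `-2 f h ≤ f² + h²`. -/
theorem sq_le_energy (H : LineH1 f h) (x : ℝ) : f x ^ 2 ≤ energy f h := by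
  have t := (intervalIntegral_tendsto_integral_Ioi x H.integrable_mul.integrableOn tendsto_id)
  have t2 : Tendsto (fun y => f y * f y - f x * f x) atTop (𝓝 (0 * 0 - f x * f x)) :=
    (H.tendsto_atTop.mul H.tendsto_atTop).sub_const _
  have e : ∫ y in Ioi x, 2 * (f y * h y) = - (f x * f x) := by
    refine tendsto_nhds_unique t (by simpa using t2.congr fun y => H.sq_isPrim.sub_eq x y)
  have i1 := H.memLp.integrable_sq
  have i2 := H.memLp_deriv.integrable_sq
  have : f x ^ 2 = ∫ y in Ioi x, - (2 * (f y * h y)) := by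
    rw [integral_neg, e]; ring
  rw [this, energy, ← integral_add i1 i2]
  calc ∫ y in Ioi x, - (2 * (f y * h y)) ≤ ∫ y in Ioi x, (f y ^ 2 + h y ^ 2) := by
        refine integral_mono H.integrable_mul.neg.integrableOn (i1.add i2).integrableOn fun y => ?_
        simp only
        nlinarith [sq_nonneg (f y + h y)]
    _ ≤ ∫ y, (f y ^ 2 + h y ^ 2) :=
        setIntegral_le_integral (i1.add i2) (Eventually.of_forall fun y => by positivity)

theorem abs_le_sqrt_energy (H : LineH1 f h) (x : ℝ) : |f x| ≤ √(energy f h) :=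
  Real.abs_le_sqrt (H.sq_le_energy x)

/-- Integration by parts on the line. -/
theorem integral_mul_deriv (H : LineH1 f h) (G : LineH1 g k) :
    ∫ x, f x * k x = -∫ x, h x * g x := by
  have i1 := H.memLp.integrable_mul G.memLp_deriv
  have i2 := H.memLp_deriv.integrable_mul G.memLp
  have := (H.toIsPrim.mul G.toIsPrim).integral_eq_zero (i2.add i1)
    (by simpa using H.tendsto_atTop.mul G.tendsto_atTop)
    (by simpa using H.tendsto_atBot.mul G.tendsto_atBot)
  have e : ∫ x, (h x * g x + f x * k x) = (∫ x, h x * g x) + ∫ x, f x * k x :=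
    integral_add i2 i1
  linarith

theorem add (H : LineH1 f h) (G : LineH1 g k) :
    LineH1 (fun x => f x + g x) (fun x => h x + k x) :=
  ⟨H.toIsPrim.add G.toIsPrim, H.memLp.add G.memLp, H.memLp_deriv.add G.memLp_deriv⟩

theorem const_mul (c : ℝ) (H : LineH1 f h) : LineH1 (fun x => c * f x) (fun x => c * h x) :=
  ⟨H.toIsPrim.const_mul c, H.memLp.const_mul c, H.memLp_deriv.const_mul c⟩

theorem comp_neg (H : LineH1 f h) : LineH1 (fun x => f (-x)) (fun x => -h (-x)) :=
  ⟨H.toIsPrim.comp_neg, H.memLp.comp_measurePreserving (Measure.measurePreserving_neg volume),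
    (H.memLp_deriv.comp_measurePreserving (Measure.measurePreserving_neg volume)).neg⟩

/-- The derivative is determined by the function. -/
theorem _root_.HeatNeumann.IsPrim.deriv_ae_eq (H : IsPrim f h) (G : IsPrim f k) : h =ᵐ[volume] k := by
  filter_upwards [H.ae_hasDerivAt, G.ae_hasDerivAt] with x h1 h2 using h1.unique h2

/-- Two continuous representatives which agree almost everywhere are equal. -/
theorem _root_.HeatNeumann.IsPrim.eq_of_ae_eq (H : IsPrim f h) (G : IsPrim g k)
    (e : f =ᵐ[volume] g) : f = g :=
  Measure.eq_of_ae_eq e H.continuous G.continuous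

theorem _root_.HeatNeumann.memLp_even_ext (hf : MemLp f 2 (volume.restrict (Ioi 0))) :
    MemLp (fun x => f |x|) 2 := by
  have h1 : MemLp ((Ioi 0).indicator f) 2 := (memLp_indicator_iff_restrict measurableSet_Ioi).2 hf
  have h2 := h1.comp_measurePreserving (Measure.measurePreserving_neg volume)
  refine (h1.add h2).ae_eq ?_
  filter_upwards [Measure.ae_ne volume (0 : ℝ)] with x hx
  rcases lt_or_gt_of_ne hx with h | h
  · have : ¬ 0 < x := not_lt.2 h.le
    simp [indicator, this, h, abs_of_neg h]
  · have : ¬ x < 0 := not_lt.2 h.le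
    simp [indicator, this, h, abs_of_pos h]

theorem _root_.HeatNeumann.memLp_odd_ext (hf : MemLp f 2 (volume.restrict (Ioi 0))) :
    MemLp (fun x => SignType.sign x * f |x|) 2 := by
  have h1 : MemLp ((Ioi 0).indicator f) 2 := (memLp_indicator_iff_restrict measurableSet_Ioi).2 hf
  have h2 := h1.comp_measurePreserving (Measure.measurePreserving_neg volume)
  refine (h1.sub h2).ae_eq (Eventually.of_forall fun x => ?_)
  rcases lt_trichotomy x 0 with h | h | h
  · have : ¬ 0 < x := not_lt.2 h.le
    simp [indicator, this, h, abs_of_neg h]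
  · simp [h]
  · have : ¬ x < 0 := not_lt.2 h.le
    simp [indicator, this, h, abs_of_pos h]

/-- The even extension of a function given on the half-line. -/
theorem of_half (hf : MemLp f 2 (volume.restrict (Ioi 0))) (hh : MemLp h 2 (volume.restrict (Ioi 0)))
    (e : ∀ x, 0 ≤ x → f x = f 0 + ∫ t in (0 : ℝ)..x, h t) :
    LineH1 (fun x => f |x|) (fun x => SignType.sign x * h |x|) := by
  have hm := memLp_odd_ext hh
  have key : ∀ x : ℝ, 0 ≤ x → ∫ t in (0 : ℝ)..x, (SignType.sign t * h |t|) =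
      ∫ t in (0 : ℝ)..x, h t := by
    intro x hx
    refine intervalIntegral.integral_congr_ae (Eventually.of_forall fun t ht => ?_)
    rw [uIoc_of_le hx] at ht
    simp [sign_pos ht.1, abs_of_pos ht.1]
  refine ⟨⟨hm.locallyIntegrable (by norm_num), fun x => ?_⟩, memLp_even_ext hf, hm⟩
  rcases le_total 0 x with hx | hx
  · rw [abs_of_nonneg hx, abs_zero, key x hx, e x hx]
  · have := intervalIntegral.integral_comp_neg (a := 0) (b := -x)
      (fun t => (SignType.sign t : ℝ) * h |t|)
    rw [abs_of_nonpos hx, abs_zero, e (-x) (by linarith), ← key (-x) (by linarith)]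
    simp only [neg_neg, neg_zero, abs_neg, Left.sign_neg, SignType.coe_neg, neg_mul] at this
    rw [intervalIntegral.integral_neg, intervalIntegral.integral_symm 0 x] at this
    rw [neg_injective this]

end LineH1

/-! ### The change of variables -/

/-- With `g` the one-sided derivative on the half-line, the derivative of the even extension is
`sign(x) g(|x|)`. It exists and is continuous at the origin because `g(0) = 0`. -/
theorem hasDerivAt_of_even {f : ℝ → ℝ} (he : ∀ x, f (-x) = f x) (hf : ContDiffOn ℝ 1 f (Ici 0))
    (h0 : derivWithin f (Ici 0) 0 = 0) :
    (∀ x, HasDerivAt f (deriv f x) x) ∧ Continuous (deriv f) := by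
  set g : ℝ → ℝ := derivWithin f (Ici 0) with hg
  have hgc : ContinuousOn g (Ici 0) := hf.continuousOn_derivWithin (uniqueDiffOn_Ici 0) le_rfl
  have hd : ∀ x, 0 ≤ x → HasDerivWithinAt f (g x) (Ici 0) x := fun x hx =>
    ((hf.differentiableOn (by norm_num)) x hx).hasDerivWithinAt
  have hpos : ∀ x, 0 < x → HasDerivAt f (g x) x := fun x hx =>
    (hd x hx.le).hasDerivAt (Ici_mem_nhds hx)
  have hneg : ∀ x, x < 0 → HasDerivAt f (-g (-x)) x := fun x hx => by
    have := (hpos (-x) (by linarith)).comp x (hasDerivAt_neg x)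
    have e : f ∘ Neg.neg = f := funext fun y => he y
    rw [e] at this
    simpa using this
  have hz : HasDerivAt f 0 0 := by
    have h1 := hd 0 le_rfl
    rw [h0] at h1
    have h2 : HasDerivWithinAt f 0 (Iic 0) 0 := by
      have := HasDerivWithinAt.scomp (h := Neg.neg) (h' := -1) (t' := Ici 0) (s := Iic 0) (g₁ := f)
        (g₁' := 0) (0 : ℝ) (by simpa using h1) (hasDerivAt_neg (0 : ℝ)).hasDerivWithinAt
        (fun y hy => by simpa using hy)
      have e : f ∘ Neg.neg = f := funext fun y => he y
      rw [e] at this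
      simpa using this
    have := h2.union h1
    rwa [Iic_union_Ici, hasDerivWithinAt_univ] at this
  have hall : ∀ x, HasDerivAt f (SignType.sign x * g |x|) x := by
    intro x
    rcases lt_trichotomy x 0 with h | h | h
    · simpa [sign_neg h, abs_of_neg h] using hneg x h
    · subst h; simpa using hz
    · simpa [sign_pos h, abs_of_pos h] using hpos x h
  have e : deriv f = fun x => SignType.sign x * g |x| := funext fun x => (hall x).deriv
  refine ⟨fun x => (hall x).differentiableAt.hasDerivAt, ?_⟩
  rw [e]
  have hga : Continuous fun x : ℝ => g |x| :=
    hgc.comp_continuous continuous_abs fun x => abs_nonneg x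
  refine continuous_iff_continuousAt.2 fun x => ?_
  rcases lt_trichotomy x 0 with h | h | h
  · refine (hga.neg.continuousAt (x := x)).congr ?_
    filter_upwards [Iio_mem_nhds h] with y hy
    simp [sign_neg (mem_Iio.1 hy)]
  · subst h
    have : Tendsto (fun x : ℝ => |g (|x|)|) (𝓝 0) (𝓝 0) := by
      have := hga.abs.tendsto 0
      simpa [h0] using this
    rw [ContinuousAt]
    simp only [sign_zero, SignType.coe_zero, zero_mul]
    refine squeeze_zero_norm (fun y => ?_) this
    rw [norm_mul, Real.norm_eq_abs, Real.norm_eq_abs]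
    rcases lt_trichotomy y 0 with h | h | h
    · simp [sign_neg h]
    · simp [h]
    · simp [sign_pos h]
  · refine (hga.continuousAt (x := x)).congr ?_
    filter_upwards [Ioi_mem_nhds h] with y hy
    simp [sign_pos (mem_Ioi.1 hy)]

/-- By the area formula the integral of `s'` over the preimage of a null set is the measure of its
image, hence zero; as `s' > 0`, the preimage is null. This lets almost-everywhere identities be
transported by `σ` and by its inverse. -/
theorem quasiMeasurePreserving_of_hasDerivAt_pos {s s' : ℝ → ℝ} (hs : ∀ x, HasDerivAt s (s' x) x)
    (hpos : ∀ x, 0 < s' x) (hm : Measurable s') : Measure.QuasiMeasurePreserving s := by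
  have hc : Continuous s := continuous_iff_continuousAt.2 fun x => (hs x).continuousAt
  have hinj : Function.Injective s :=
    (strictMono_of_hasDerivAt_pos hs hpos).injective
  refine ⟨hc.measurable, Measure.AbsolutelyContinuous.mk fun A hA h0 => ?_⟩
  rw [Measure.map_apply hc.measurable hA]
  have := lintegral_image_eq_lintegral_abs_deriv_mul (hc.measurable hA)
    (fun x _ => (hs x).hasDerivWithinAt) hinj.injOn (fun _ => 1)
  have hle : volume (s '' (s ⁻¹' A)) = 0 := measure_mono_null (image_preimage_subset s A) h0
  simp only [lintegral_const, mul_one, MeasurableSet.univ, Measure.restrict_apply, univ_inter, hle,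
    one_mul] at this
  rw [eq_comm, lintegral_eq_zero_iff (by fun_prop)] at this
  have h1 : ∀ᵐ x ∂(volume.restrict (s ⁻¹' A)), False := by
    filter_upwards [this] with x hx
    have := hpos x
    simp only [Pi.zero_apply, ENNReal.ofReal_eq_zero, abs_nonpos_iff] at hx
    exact this.ne' hx
  rw [ae_iff] at h1
  simpa using h1

namespace Coeffs

variable (d : Coeffs)

theorem continuous_k : Continuous d.k := by
  have h : d.k = fun x => d.k |x| := by
    funext x
    rcases abs_choice x with h | h <;> rw [h]
    rw [d.k_even]
  rw [h]
  exact d.k_C1.continuousOn.comp_continuous continuous_abs fun x => abs_nonneg x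

/-- `ρ k`. -/
def w (x : ℝ) : ℝ := d.rho x * d.k x

theorem w_pos (x : ℝ) : 0 < d.w x := mul_pos (d.rho_pos x) (d.k_pos x)

theorem w_hasDerivAt (x : ℝ) : HasDerivAt d.w (deriv d.w x) x :=
  (hasDerivAt_of_even (f := d.w) (fun x => by simp [w, d.rho_even, d.k_even])
    (d.rho_k_C2.of_le (by norm_num)) d.rho_k_deriv_zero).1 x

theorem w_continuous_deriv : Continuous (deriv d.w) :=
  (hasDerivAt_of_even (f := d.w) (fun x => by simp [w, d.rho_even, d.k_even])
    (d.rho_k_C2.of_le (by norm_num)) d.rho_k_deriv_zero).2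

theorem w_continuous : Continuous d.w := d.continuous_rho.mul d.continuous_k

/-- `σ' = √(ρ/k)`. -/
def dsig (x : ℝ) : ℝ := √(d.rho x / d.k x)

theorem dsig_pos (x : ℝ) : 0 < d.dsig x := Real.sqrt_pos.2 (div_pos (d.rho_pos x) (d.k_pos x))

theorem dsig_continuous : Continuous d.dsig :=
  (d.continuous_rho.div d.continuous_k fun x => (d.k_pos x).ne').sqrt

theorem inv_dsig (x : ℝ) : √(d.k x / d.rho x) = (d.dsig x)⁻¹ := by
  rw [dsig, ← Real.sqrt_inv, inv_div]

/-- `σ` for the coefficients `d`. -/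
def sig (x : ℝ) : ℝ := sigma d.rho d.k x

theorem sig_hasDerivAt (x : ℝ) : HasDerivAt d.sig (d.dsig x) x :=
  intervalIntegral.integral_hasDerivAt_right (d.dsig_continuous.intervalIntegrable _ _)
    (d.dsig_continuous.stronglyMeasurableAtFilter _ _) d.dsig_continuous.continuousAt

theorem sig_continuous : Continuous d.sig :=
  continuous_iff_continuousAt.2 fun x => (d.sig_hasDerivAt x).continuousAt

theorem sig_strictMono : StrictMono d.sig :=
  strictMono_of_hasDerivAt_pos d.sig_hasDerivAt d.dsig_pos

@[simp] theorem sig_zero : d.sig 0 = 0 := by simp [sig, sigma]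

theorem sig_neg (x : ℝ) : d.sig (-x) = -d.sig x := by
  simp only [sig, sigma]
  have := intervalIntegral.integral_comp_neg (a := 0) (b := x) (fun ξ => √(d.rho ξ / d.k ξ))
  simp only [d.rho_even, d.k_even, neg_zero] at this
  rw [this, intervalIntegral.integral_symm]

theorem sig_surjective : Function.Surjective d.sig := by
  have h1 : Tendsto d.sig atTop atTop := d.sigma_tendsto
  have h2 : Tendsto d.sig atBot atBot := by
    have := tendsto_neg_atTop_atBot.comp (h1.comp tendsto_neg_atBot_atTop)
    refine this.congr fun x => ?_
    simp [sig_neg]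
  exact d.sig_continuous.surjective h1 h2

/-- The inverse of `σ`. -/
def tau : ℝ → ℝ := Function.invFun d.sig

theorem tau_sig (x : ℝ) : d.tau (d.sig x) = x :=
  Function.leftInverse_invFun d.sig_strictMono.injective x

theorem sig_tau (y : ℝ) : d.sig (d.tau y) = y :=
  Function.rightInverse_invFun d.sig_surjective y

theorem tau_continuous : Continuous d.tau := by
  have : d.tau = (d.sig_strictMono.orderIsoOfSurjective _ d.sig_surjective).symm := by
    funext y
    apply d.sig_strictMono.injective
    rw [sig_tau]
    exact ((d.sig_strictMono.orderIsoOfSurjective _ d.sig_surjective).apply_symm_apply y).symm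
  rw [this]
  exact OrderIso.continuous _

theorem tau_hasDerivAt (y : ℝ) : HasDerivAt d.tau (d.dsig (d.tau y))⁻¹ y :=
  HasDerivAt.of_local_left_inverse d.tau_continuous.continuousAt (d.sig_hasDerivAt _)
    (d.dsig_pos _).ne' (Eventually.of_forall d.sig_tau)

theorem tau_neg (y : ℝ) : d.tau (-y) = -d.tau y := by
  apply d.sig_strictMono.injective
  rw [sig_tau, sig_neg, sig_tau]

theorem sig_qmp : Measure.QuasiMeasurePreserving d.sig :=
  quasiMeasurePreserving_of_hasDerivAt_pos d.sig_hasDerivAt d.dsig_pos d.dsig_continuous.measurable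

theorem tau_qmp : Measure.QuasiMeasurePreserving d.tau :=
  quasiMeasurePreserving_of_hasDerivAt_pos d.tau_hasDerivAt (fun _ => inv_pos.2 (d.dsig_pos _))
    (d.dsig_continuous.measurable.comp d.tau_continuous.measurable).inv

theorem integral_comp_sig (g : ℝ → ℝ) : ∫ x, d.dsig x * g (d.sig x) = ∫ y, g y := by
  have := integral_image_eq_integral_abs_deriv_smul MeasurableSet.univ
    (fun x _ => (d.sig_hasDerivAt x).hasDerivWithinAt) d.sig_strictMono.injective.injOn g
  rw [image_univ, d.sig_surjective.range_eq] at this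
  simp only [Measure.restrict_univ, abs_of_pos (d.dsig_pos _), smul_eq_mul] at this
  exact this.symm

theorem integrable_comp_sig (g : ℝ → ℝ) :
    Integrable (fun x => d.dsig x * g (d.sig x)) ↔ Integrable g := by
  have := integrableOn_image_iff_integrableOn_abs_deriv_smul MeasurableSet.univ
    (fun x _ => (d.sig_hasDerivAt x).hasDerivWithinAt) d.sig_strictMono.injective.injOn g
  rw [image_univ, d.sig_surjective.range_eq] at this
  simp only [integrableOn_univ, abs_of_pos (d.dsig_pos _), smul_eq_mul] at this
  exact this.symm

/-- `(ρ k)^{1/4}`. -/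
def w4 (x : ℝ) : ℝ := d.w x ^ (1 / 4 : ℝ)

theorem w4_pos (x : ℝ) : 0 < d.w4 x := Real.rpow_pos_of_pos (d.w_pos x) _

theorem w4_hasDerivAt (x : ℝ) : HasDerivAt d.w4 (d.w4 x * deriv d.w x / (4 * d.w x)) x := by
  have := (d.w_hasDerivAt x).rpow_const (p := 1 / 4) (Or.inl (d.w_pos x).ne')
  refine this.congr_deriv ?_
  rw [Real.rpow_sub_one (d.w_pos x).ne']
  have := d.w_pos x
  simp only [w4]
  field_simp

theorem w4_continuous : Continuous d.w4 :=
  continuous_iff_continuousAt.2 fun x => (d.w4_hasDerivAt x).continuousAt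

/-- The reason for the exponent `1/4` in `S`: the weight `ρ` is the Jacobian `σ'` times the square
of `(ρk)^{1/4}`, so `(S f)(S g) ρ dx` is the pull-back of `f g dy`. -/
theorem rho_eq (x : ℝ) : d.rho x = d.dsig x * (d.w4 x * d.w4 x) := by
  have h1 : d.w4 x * d.w4 x = √(d.w x) := by
    rw [w4, ← Real.rpow_add (d.w_pos x), Real.sqrt_eq_rpow]
    norm_num
  rw [h1, dsig, w, ← Real.sqrt_mul (div_pos (d.rho_pos x) (d.k_pos x)).le]
  have : d.rho x / d.k x * (d.rho x * d.k x) = d.rho x * d.rho x := by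
    have := d.k_pos x
    field_simp
  rw [this, Real.sqrt_mul_self (d.rho_pos x).le]

theorem S_apply (f : ℝ → ℝ) (x : ℝ) : S d f x = f (d.sig x) / d.w4 x := rfl

theorem Q1_eq (x : ℝ) : Q1 d.rho d.k x = (d.dsig x)⁻¹ * deriv d.w x / (4 * d.w x) := by
  have e : (fun y => d.k y * d.rho y) = d.w := funext fun y => mul_comm _ _
  rw [Q1, e, inv_dsig, w, mul_comm (d.k x)]

/-- The product rule, together with the fact that `Q₁` is `√(k/ρ)` times the logarithmic derivative
of `(ρk)^{1/4}`. Consequently `𝔻 (S f) = S f'`. -/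
theorem isPrim_S {f h : ℝ → ℝ} (H : IsPrim f h) :
    IsPrim (S d f) (fun x => d.dsig x * (S d h x - Q1 d.rho d.k x * S d f x)) := by
  have h1 := H.comp d.sig_hasDerivAt fun x => (d.dsig_pos x).le
  have h2 : IsPrim (fun x => (d.w4 x)⁻¹)
      (fun x => -(d.w4 x * deriv d.w x / (4 * d.w x)) / d.w4 x ^ 2) := by
    refine IsPrim.of_hasDerivAt ?_ fun x => (d.w4_hasDerivAt x).fun_inv (d.w4_pos x).ne'
    refine (((d.w4_continuous.mul d.w_continuous_deriv).div (continuous_const.mul d.w_continuous)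
      fun x => ?_).neg).div (d.w4_continuous.pow 2) fun x => ?_
    · exact (mul_pos four_pos (d.w_pos x)).ne'
    · exact (pow_pos (d.w4_pos x) 2).ne'
  refine (h1.mul h2).congr_deriv (Eventually.of_forall fun x => ?_)
  have a1 := (d.w4_pos x).ne'
  have a2 := (d.dsig_pos x).ne'
  have a3 := (d.w_pos x).ne'
  simp only [S_apply, Q1_eq]
  field_simp
  ring

theorem continuous_S {f : ℝ → ℝ} (hf : Continuous f) : Continuous (S d f) :=
  (hf.comp d.sig_continuous).div d.w4_continuous fun x => (d.w4_pos x).ne'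

theorem S_congr {f g : ℝ → ℝ} (e : f =ᵐ[volume] g) : S d f =ᵐ[volume] S d g := by
  filter_upwards [d.sig_qmp.ae e] with x hx
  simp only [S_apply]
  rw [hx]

theorem of_S_congr {f g : ℝ → ℝ} (e : S d f =ᵐ[volume] S d g) : f =ᵐ[volume] g := by
  filter_upwards [d.tau_qmp.ae e] with y hy
  simp only [S_apply, sig_tau] at hy
  exact (div_left_inj' (d.w4_pos _).ne').1 hy

theorem ae_mu_iff {p : ℝ → Prop} : (∀ᵐ x ∂d.mu, p x) ↔ ∀ᵐ x, p x :=
  ⟨fun h => d.volume_ac_mu.ae_le h, fun h => (withDensity_absolutelyContinuous _ _).ae_le h⟩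

theorem integral_mu (f : ℝ → ℝ) : ∫ x, f x ∂d.mu = ∫ x, d.rho x * f x := by
  rw [mu, integral_withDensity_eq_integral_toReal_smul (by
    exact d.continuous_rho.measurable.ennreal_ofReal) (by simp)]
  refine integral_congr_ae (Eventually.of_forall fun x => ?_)
  simp [ENNReal.toReal_ofReal (d.rho_pos x).le]

theorem integrable_mu_iff (f : ℝ → ℝ) : Integrable f d.mu ↔ Integrable fun x => d.rho x * f x := by
  rw [mu, integrable_withDensity_iff_integrable_smul' (by
    exact d.continuous_rho.measurable.ennreal_ofReal) (by simp)]
  refine integrable_congr (Eventually.of_forall fun x => ?_)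
  simp [ENNReal.toReal_ofReal (d.rho_pos x).le]

theorem rho_S_mul (f g : ℝ → ℝ) (x : ℝ) :
    d.rho x * (S d f x * S d g x) = d.dsig x * (f (d.sig x) * g (d.sig x)) := by
  have a1 := (d.w4_pos x).ne'
  rw [rho_eq, S_apply, S_apply]
  field_simp

theorem integral_S_mul (f g : ℝ → ℝ) : ∫ x, S d f x * S d g x ∂d.mu = ∫ y, f y * g y := by
  rw [integral_mu, ← d.integral_comp_sig fun y => f y * g y]
  simp only [rho_S_mul]

theorem memLp_S {f : ℝ → ℝ} (hf : MemLp f 2) : MemLp (S d f) 2 d.mu := by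
  have hm : AEStronglyMeasurable (S d f) d.mu := by
    have h1 : AEStronglyMeasurable (S d f) volume :=
      (hf.1.comp_quasiMeasurePreserving d.sig_qmp).div₀ d.w4_continuous.aestronglyMeasurable
    exact h1.mono_ac (withDensity_absolutelyContinuous _ _)
  rw [memLp_two_iff_integrable_sq hm, integrable_mu_iff]
  have := (d.integrable_comp_sig fun y => f y * f y).2 (by simpa [sq] using hf.integrable_sq)
  simpa only [sq, rho_S_mul] using this

theorem memLp_of_S {f : ℝ → ℝ} (hf : MemLp (S d f) 2 d.mu) : MemLp f 2 := by
  have hm : AEStronglyMeasurable f volume := by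
    have h1 : AEStronglyMeasurable (S d f) volume := hf.1.mono_ac d.volume_ac_mu
    have h2 := (h1.comp_quasiMeasurePreserving d.tau_qmp).mul
      (d.w4_continuous.comp d.tau_continuous).aestronglyMeasurable
    refine h2.congr (Eventually.of_forall fun y => ?_)
    have := (d.w4_pos (d.tau y)).ne'
    simp only [Pi.mul_apply, Function.comp_apply, S_apply, sig_tau]
    field_simp
  rw [memLp_two_iff_integrable_sq hm]
  have := hf.integrable_sq
  rw [integrable_mu_iff] at this
  have h2 := (d.integrable_comp_sig fun y => f y * f y).1 (by simpa only [sq, rho_S_mul] using this)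
  simpa only [sq] using h2

theorem IsD_S {f h : ℝ → ℝ} (H : IsPrim f h) : IsD d (S d f) (S d h) := by
  refine ⟨_, (d.isPrim_S H).hasWeakDeriv, Eventually.of_forall fun x => ?_⟩
  have a2 := (d.dsig_pos x).ne'
  rw [inv_dsig]
  field_simp
  ring

/-- The inverse of `S`. -/
theorem exists_isPrim_of_IsD {p g : ℝ → ℝ} (H : IsD d p g) :
    ∃ f h, IsPrim f h ∧ p =ᵐ[volume] S d f ∧ g =ᵐ[volume] S d h := by
  obtain ⟨h, hw, hg⟩ := H
  obtain ⟨F, e, hF⟩ := hw.exists_isPrim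
  have h1 := hF.comp d.tau_hasDerivAt fun y => (inv_pos.2 (d.dsig_pos _)).le
  have h2 : IsPrim d.w4 (fun x => d.w4 x * deriv d.w x / (4 * d.w x)) :=
    IsPrim.of_hasDerivAt ((d.w4_continuous.mul d.w_continuous_deriv).div
      (continuous_const.mul d.w_continuous) fun x => (mul_pos four_pos (d.w_pos x)).ne')
      d.w4_hasDerivAt
  have h3 := h1.mul (h2.comp d.tau_hasDerivAt fun y => (inv_pos.2 (d.dsig_pos _)).le)
  refine ⟨_, _, h3, ?_, ?_⟩
  · filter_upwards [e] with x hx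
    rw [hx, S_apply]
    simp only [tau_sig]
    rw [mul_div_cancel_right₀ _ (d.w4_pos x).ne']
  · filter_upwards [e, hg] with x hx hx2
    rw [hx2, hx, S_apply]
    have a1 := (d.w4_pos x).ne'
    have a2 := (d.dsig_pos x).ne'
    have a3 := (d.w_pos x).ne'
    simp only [tau_sig, inv_dsig, Q1_eq]
    field_simp

theorem q_eq_r (x : ℝ) : d.q x = d.r (d.sig x) := by
  have : d.r (d.sig x) = d.q (d.tau (d.sig x)) := rfl
  rw [this, tau_sig]

theorem r_eq (y : ℝ) : d.r y = d.q (d.tau y) := rfl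

end Coeffs

/-! ### Elements of `ℍ¹` as functions of `H¹(ℝ)` through `S` -/

namespace H1

variable {d : Coeffs}

/-- The element of `ℍ¹` given by a function in `H¹(ℝ)` via the transformation `S`. -/
def mk (d : Coeffs) {f h : ℝ → ℝ} (L : LineH1 f h) : H1 d :=
  ⟨WithLp.toLp 2 ((d.memLp_S L.memLp).toLp _, (d.memLp_S L.memLp_deriv).toLp _), by
    obtain ⟨k, hk, e⟩ := d.IsD_S L.toIsPrim
    have e1 := d.volume_ac_mu.ae_eq (d.memLp_S L.memLp).coeFn_toLp
    have e2 := d.volume_ac_mu.ae_eq (d.memLp_S L.memLp_deriv).coeFn_toLp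
    refine ⟨k, hk.congr e1.symm, ?_⟩
    filter_upwards [e1, e2, e] with x h1 h2 h3
    change ((d.memLp_S L.memLp_deriv).toLp _ : ℝ → ℝ) x =
      _ + _ * ((d.memLp_S L.memLp).toLp _ : ℝ → ℝ) x
    rw [h1, h2, h3]⟩

theorem fn_mk {f h : ℝ → ℝ} (L : LineH1 f h) : fn (mk d L) =ᵐ[volume] S d f :=
  d.volume_ac_mu.ae_eq (d.memLp_S L.memLp).coeFn_toLp

theorem D_mk {f h : ℝ → ℝ} (L : LineH1 f h) : D (mk d L) =ᵐ[volume] S d h :=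
  d.volume_ac_mu.ae_eq (d.memLp_S L.memLp_deriv).coeFn_toLp

theorem exists_rep (p : H1 d) :
    ∃ f h, LineH1 f h ∧ fn p =ᵐ[volume] S d f ∧ D p =ᵐ[volume] S d h := by
  obtain ⟨f, h, H, e1, e2⟩ := d.exists_isPrim_of_IsD p.2
  refine ⟨f, h, ⟨H, d.memLp_of_S ?_, d.memLp_of_S ?_⟩, e1, e2⟩
  · exact (Lp.memLp (fn p)).ae_eq (d.ae_mu_iff.2 e1)
  · exact (Lp.memLp (D p)).ae_eq (d.ae_mu_iff.2 e2)

/-- The continuous function in `H¹(ℝ)` corresponding to an element of `ℍ¹` under `S`. -/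
def rep (p : H1 d) : ℝ → ℝ := (exists_rep p).choose

/-- The derivative of `rep`. -/
def repD (p : H1 d) : ℝ → ℝ := (exists_rep p).choose_spec.choose

theorem lineH1_rep (p : H1 d) : LineH1 (rep p) (repD p) :=
  (exists_rep p).choose_spec.choose_spec.1

theorem fn_ae_eq (p : H1 d) : fn p =ᵐ[volume] S d (rep p) :=
  (exists_rep p).choose_spec.choose_spec.2.1

theorem D_ae_eq (p : H1 d) : D p =ᵐ[volume] S d (repD p) :=
  (exists_rep p).choose_spec.choose_spec.2.2

theorem rep_eq {p : H1 d} {f h : ℝ → ℝ} (L : LineH1 f h) (e : fn p =ᵐ[volume] S d f) :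
    rep p = f :=
  (lineH1_rep p).toIsPrim.eq_of_ae_eq L.toIsPrim (d.of_S_congr ((fn_ae_eq p).symm.trans e))

theorem repD_ae_eq {p : H1 d} {f h : ℝ → ℝ} (L : LineH1 f h) (e : fn p =ᵐ[volume] S d f) :
    repD p =ᵐ[volume] h := by
  have h1 := (lineH1_rep p).toIsPrim
  rw [rep_eq L e] at h1
  exact h1.deriv_ae_eq L.toIsPrim

theorem rep_mk {f h : ℝ → ℝ} (L : LineH1 f h) : rep (mk d L) = f := rep_eq L (fn_mk L)

theorem repD_mk {f h : ℝ → ℝ} (L : LineH1 f h) : repD (mk d L) =ᵐ[volume] h :=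
  repD_ae_eq L (fn_mk L)

/-- The second component of an element is determined by the weak derivative of the first, so
representatives suffice to identify elements. Linearity of the test-function operator is checked in
this way. -/
theorem ext_rep {p p' : H1 d} (e : rep p = rep p') : p = p' := by
  have e1 : fn p = fn p' := by
    refine Lp.ext (d.ae_mu_iff.2 ?_)
    filter_upwards [fn_ae_eq p, fn_ae_eq p'] with x h1 h2
    rw [h1, h2, e]
  have e2 : D p = D p' := by
    refine Lp.ext (d.ae_mu_iff.2 ?_)
    have h1 := (lineH1_rep p).toIsPrim
    rw [e] at h1
    filter_upwards [D_ae_eq p, D_ae_eq p',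
      d.S_congr (h1.deriv_ae_eq (lineH1_rep p').toIsPrim)] with x h1 h2 h3
    rw [h1, h2, h3]
  apply Subtype.ext
  apply (WithLp.equiv 2 _).injective
  exact Prod.ext e1 e2

theorem rep_add (p p' : H1 d) : rep (p + p') = fun x => rep p x + rep p' x := by
  refine rep_eq ((lineH1_rep p).add (lineH1_rep p')) ?_
  have : fn (p + p') = fn p + fn p' := rfl
  rw [this]
  filter_upwards [d.volume_ac_mu.ae_eq (Lp.coeFn_add (fn p) (fn p')), fn_ae_eq p, fn_ae_eq p']
    with x h1 h2 h3
  rw [h1, Pi.add_apply, h2, h3]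
  simp only [Coeffs.S_apply]
  ring

theorem rep_smul (c : ℝ) (p : H1 d) : rep (c • p) = fun x => c * rep p x := by
  refine rep_eq ((lineH1_rep p).const_mul c) ?_
  have : fn (c • p) = c • fn p := rfl
  rw [this]
  filter_upwards [d.volume_ac_mu.ae_eq (Lp.coeFn_smul c (fn p)), fn_ae_eq p] with x h1 h2
  rw [h1, Pi.smul_apply, h2, smul_eq_mul]
  simp only [Coeffs.S_apply]
  ring

theorem inner_eq {F G : Lp ℝ 2 d.mu} {f g : ℝ → ℝ} (hF : F =ᵐ[volume] S d f)
    (hG : G =ᵐ[volume] S d g) : inner ℝ F G = ∫ y, f y * g y := by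
  rw [L2.inner_def, ← d.integral_S_mul]
  refine integral_congr_ae (d.ae_mu_iff.2 ?_)
  filter_upwards [hF, hG] with x h1 h2
  rw [h1, h2]
  simp [mul_comm]

theorem inner_fn (p p' : H1 d) : inner ℝ (fn p) (fn p') = ∫ y, rep p y * rep p' y :=
  inner_eq (fn_ae_eq p) (fn_ae_eq p')

theorem inner_D (p p' : H1 d) : inner ℝ (D p) (D p') = ∫ y, repD p y * repD p' y :=
  inner_eq (D_ae_eq p) (D_ae_eq p')

theorem toHneg_apply (p p' : H1 d) : toHneg p p' = ∫ y, rep p y * rep p' y :=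
  inner_fn p p'

theorem norm_sq (p : H1 d) : ‖p‖ ^ 2 = energy (rep p) (repD p) := by
  have h1 : ‖p‖ ^ 2 = ‖fn p‖ ^ 2 + ‖D p‖ ^ 2 := WithLp.prod_norm_sq_eq_of_L2 _
  rw [h1, ← real_inner_self_eq_norm_sq, ← real_inner_self_eq_norm_sq, inner_fn, inner_D, energy]
  simp only [sq]

theorem norm_eq (p : H1 d) : ‖p‖ = √(energy (rep p) (repD p)) := by
  rw [← norm_sq, Real.sqrt_sq (norm_nonneg _)]

theorem abs_rep_le (p : H1 d) (x : ℝ) : |rep p x| ≤ ‖p‖ := by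
  rw [norm_eq]
  exact (lineH1_rep p).abs_le_sqrt_energy x

theorem energy_mk {f h : ℝ → ℝ} (L : LineH1 f h) : ‖mk d L‖ ^ 2 = energy f h := by
  rw [norm_sq, rep_mk, energy, energy]
  congr 1
  refine integral_congr_ae ?_
  filter_upwards [repD_mk (d := d) L] with x hx
  rw [hx]

theorem integral_q (p p' : H1 d) :
    ∫ x, d.q x * fn p x * fn p' x * d.rho x = ∫ y, d.r y * rep p y * rep p' y := by
  rw [← d.integral_comp_sig fun y => d.r y * rep p y * rep p' y]
  refine integral_congr_ae ?_
  filter_upwards [fn_ae_eq p, fn_ae_eq p'] with x h1 h2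
  rw [h1, h2, d.q_eq_r]
  linear_combination d.r (d.sig x) * d.rho_S_mul (rep p) (rep p') x

theorem isEven_iff (p : H1 d) : IsEven p ↔ ∀ y, rep p (-y) = rep p y := by
  have hw : ∀ x, d.w4 (-x) = d.w4 x := fun x => by
    simp [Coeffs.w4, Coeffs.w, d.rho_even, d.k_even]
  have h0 := fn_ae_eq p
  have h1 := (Measure.measurePreserving_neg (volume : Measure ℝ)).quasiMeasurePreserving.ae h0
  constructor
  · intro h
    have e : S d (fun y => rep p (-y)) =ᵐ[volume] S d (rep p) := by
      filter_upwards [h, h0, h1] with x h h0 h1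
      rw [h0, h1] at h
      simpa only [Coeffs.S_apply, Coeffs.sig_neg, hw] using h
    exact fun y => congrFun ((lineH1_rep p).comp_neg.toIsPrim.eq_of_ae_eq (lineH1_rep p).toIsPrim
      (d.of_S_congr e)) y
  · intro h
    filter_upwards [h0, h1] with x h0 h1
    rw [h0, h1, Coeffs.S_apply, Coeffs.S_apply, Coeffs.sig_neg, hw, h]

end H1

/-! ### Essential limits -/

/-- One-sided neighbourhoods of the origin have positive measure and so meet every set of full
measure. Hence essential limits are unique, and `limUnder` returns the intended value. -/
instance nhdsGT_inf_ae_neBot : NeBot (𝓝[>] (0 : ℝ) ⊓ ae volume) := by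
  refine inf_neBot_iff.2 fun {s} hs {t} ht => ?_
  obtain ⟨ε, hε, hs⟩ := mem_nhdsGT_iff_exists_Ioo_subset.1 hs
  by_contra hne
  have : Ioo 0 ε ⊆ tᶜ := fun x hx hxt => hne ⟨x, hs hx, hxt⟩
  have h0 := measure_mono_null this ht
  simp only [Real.volume_Ioo, ENNReal.ofReal_eq_zero, sub_zero] at h0
  exact absurd hε (not_lt.2 h0)

instance nhds_inf_ae_neBot : NeBot (𝓝 (0 : ℝ) ⊓ ae volume) :=
  nhdsGT_inf_ae_neBot.mono (inf_le_inf_right _ nhdsWithin_le_nhds)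

theorem tendsto_inf_ae_congr {l : Filter ℝ} {f g : ℝ → ℝ} {c : ℝ} (e : f =ᵐ[volume] g)
    (h : Tendsto g l (𝓝 c)) : Tendsto f (l ⊓ ae volume) (𝓝 c) :=
  (h.mono_left inf_le_left).congr' ((e.filter_mono inf_le_right).symm)

theorem H1.valueAtZero_fn {d : Coeffs} (p : H1 d) :
    valueAtZero (H1.fn p) = H1.rep p 0 / d.w4 0 := by
  refine Tendsto.limUnder_eq (tendsto_inf_ae_congr (H1.fn_ae_eq p) ?_)
  have := (d.continuous_S (H1.lineH1_rep p).continuous).tendsto 0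
  rwa [Coeffs.S_apply, Coeffs.sig_zero] at this

theorem H1.rightValue_fn {d : Coeffs} (p : H1 d) :
    rightValue (H1.fn p) = H1.rep p 0 / d.w4 0 := by
  refine Tendsto.limUnder_eq (tendsto_inf_ae_congr (H1.fn_ae_eq p) ?_)
  have := (d.continuous_S (H1.lineH1_rep p).continuous).tendsto 0
  rw [Coeffs.S_apply, Coeffs.sig_zero] at this
  exact this.mono_left nhdsWithin_le_nhds

theorem S_unit (f : ℝ → ℝ) : S unitCoeffs f = f := by
  funext x
  have h : unitCoeffs.rho = fun _ => 1 := rfl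
  have h' : unitCoeffs.k = fun _ => 1 := rfl
  simp [S, h, h', sigma_one]

/-! ### The potential -/

/-- The properties of the potential `r` (extended evenly) which are used. -/
structure Pot (r : ℝ → ℝ) : Prop where
  even : ∀ x, r (-x) = r x
  continuous : Continuous r
  bounded : ∃ C, ∀ x, |r x| ≤ C
  moment : IntegrableOn (fun ξ => ξ * |r ξ|) (Ioi 0)

namespace Coeffs

variable (d : Coeffs)

/-- As `ρk` is even, its derivative and `Q₁` are odd, and `Q₁'` is even. The rule for `deriv` under
`x ↦ -x` holds for arbitrary functions, so no differentiability of `Q₁` enters. -/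
theorem q_even (x : ℝ) : d.q (-x) = d.q x := by
  have hw : ∀ x, d.w (-x) = d.w x := fun x => by simp [w, d.rho_even, d.k_even]
  have hs : ∀ x, d.dsig (-x) = d.dsig x := fun x => by simp [dsig, d.rho_even, d.k_even]
  have hdw : ∀ x, deriv d.w (-x) = -deriv d.w x := fun x => by
    have := deriv_comp_neg d.w x
    simp only [hw] at this
    linarith
  have h1 : ∀ x, Q1 d.rho d.k (-x) = -Q1 d.rho d.k x := fun x => by
    rw [Q1_eq, Q1_eq, hw, hs, hdw]; ring
  have h2 : deriv (Q1 d.rho d.k) (-x) = deriv (Q1 d.rho d.k) x := by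
    have := deriv_comp_neg (Q1 d.rho d.k) x
    simp only [h1, deriv.fun_neg] at this
    linarith
  simp only [q, Q2, h1, h2, d.rho_even, d.k_even, d.gamma_even]
  ring

theorem r_even (y : ℝ) : d.r (-y) = d.r y := by
  rw [r_eq, tau_neg, q_even, ← r_eq]

theorem q_continuous : Continuous d.q := by
  have h : d.q = fun x => d.q |x| := by
    funext x
    rcases abs_choice x with h | h <;> rw [h]
    rw [d.q_even]
  rw [h]
  exact d.q_C1.continuousOn.comp_continuous continuous_abs fun x => abs_nonneg x

/-- By continuity the set where the bound fails is open; it is null in the open half-line, hence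
empty there, and the endpoint follows by closure. -/
theorem abs_le_of_ae_Ioi {f : ℝ → ℝ} (hf : Continuous f) {C : ℝ}
    (h : ∀ᵐ x ∂(volume.restrict (Ioi 0)), |f x| ≤ C) {x : ℝ} (hx : 0 ≤ x) : |f x| ≤ C := by
  have hcl : IsClosed {x | |f x| ≤ C} := isClosed_le hf.abs continuous_const
  have hpos : ∀ x, 0 < x → |f x| ≤ C := by
    intro x hx
    by_contra hC
    have ho : IsOpen ({x | |f x| ≤ C}ᶜ ∩ Ioi 0) := hcl.isOpen_compl.inter isOpen_Ioi
    have := ho.measure_pos volume ⟨x, hC, hx⟩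
    rw [ae_iff, Measure.restrict_apply (by exact hcl.isOpen_compl.measurableSet)] at h
    exact this.ne' h
  have : closure (Ioi (0 : ℝ)) ⊆ {x | |f x| ≤ C} := closure_minimal (fun x hx => hpos x hx) hcl
  rw [closure_Ioi] at this
  exact this hx

theorem pot : Pot d.r where
  even := d.r_even
  continuous := d.q_continuous.comp d.tau_continuous
  bounded := by
    have h := ae_le_eLpNormEssSup (f := d.q) (μ := volume.restrict (Ioi (0 : ℝ)))
    have hfin : eLpNormEssSup d.q (volume.restrict (Ioi 0)) ≠ ⊤ := by
      have := d.q_bounded.2.ne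
      rwa [eLpNorm_exponent_top] at this
    have hb : ∀ x, 0 ≤ x → |d.q x| ≤ (eLpNormEssSup d.q (volume.restrict (Ioi 0))).toReal := by
      intro x hx
      refine abs_le_of_ae_Ioi d.q_continuous ?_ hx
      filter_upwards [h] with x hx
      rw [← Real.norm_eq_abs, ← toReal_enorm]
      exact ENNReal.toReal_mono hfin hx
    refine ⟨(eLpNormEssSup d.q (volume.restrict (Ioi 0))).toReal, fun y => ?_⟩
    rw [r_eq]
    rcases le_total 0 (d.tau y) with h | h
    · exact hb _ h
    · rw [← d.q_even]; exact hb _ (by linarith)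
  moment := by
    have := integrableOn_image_iff_integrableOn_abs_deriv_smul measurableSet_Ioi
      (fun x _ => (d.sig_hasDerivAt x).hasDerivWithinAt) d.sig_strictMono.injective.injOn
      (s := Ioi 0) (fun y => y * d.r y)
    have hi : d.sig '' Ioi 0 = Ioi 0 := by
      ext y
      constructor
      · rintro ⟨x, hx, rfl⟩
        have := d.sig_strictMono hx
        rwa [sig_zero] at this
      · intro hy
        refine ⟨d.tau y, ?_, d.sig_tau y⟩
        by_contra hneg
        have := d.sig_strictMono.monotone (not_lt.1 hneg)
        rw [sig_tau, sig_zero] at this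
        exact absurd hy (not_lt.2 this)
    rw [hi] at this
    have h2 := (this.2 ?_).norm
    · refine IntegrableOn.congr_fun h2 (fun y hy => ?_) measurableSet_Ioi
      simp [abs_of_pos (mem_Ioi.1 hy)]
    · refine d.q_integrable.congr_fun (fun x _ => ?_) measurableSet_Ioi
      simp only [smul_eq_mul, abs_of_pos (d.dsig_pos x), ← q_eq_r]
      change d.dsig x * d.q x * d.sig x = _
      ring

end Coeffs

namespace Pot

variable {r : ℝ → ℝ}

theorem integrableOn (hr : Pot r) : IntegrableOn r (Ioi 0) := by
  rw [← Ioc_union_Ioi_eq_Ioi zero_le_one]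
  refine IntegrableOn.union ?_ ?_
  · exact (hr.continuous.integrableOn_Icc).mono_set Ioc_subset_Icc_self
  · refine Integrable.mono' (hr.moment.mono_set (Ioi_subset_Ioi zero_le_one))
      hr.continuous.aestronglyMeasurable ?_
    filter_upwards [ae_restrict_mem measurableSet_Ioi] with x hx
    have : (1 : ℝ) < x := hx
    rw [Real.norm_eq_abs]
    nlinarith [abs_nonneg (r x)]

theorem integrable (hr : Pot r) : Integrable r := by
  have h1 : IntegrableOn r (Iic 0) := by
    rw [integrableOn_Iic_iff_integrableOn_Iio]
    have h := (integrable_indicator_iff measurableSet_Ioi).2 hr.integrableOn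
    refine (integrable_indicator_iff measurableSet_Iio).1 (h.comp_neg.congr ?_)
    refine Eventually.of_forall fun x => ?_
    simp [indicator, hr.even]
  have := h1.union hr.integrableOn
  rwa [Iic_union_Ioi, integrableOn_univ] at this

theorem sigma0_nonneg (r : ℝ → ℝ) (x : ℝ) : 0 ≤ sigma0 r x :=
  integral_nonneg fun _ => abs_nonneg _

theorem sigma0_eq (hr : Pot r) (a x : ℝ) :
    sigma0 r x = sigma0 r a - ∫ ξ in a..x, |r ξ| := by
  have := intervalIntegral.integral_Ioi_sub_Ioi' (a := a) (b := x) hr.integrable.abs.integrableOn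
    hr.integrable.abs.integrableOn
  simp only [sigma0]
  linarith

theorem sigma0_hasDerivAt (hr : Pot r) (x : ℝ) : HasDerivAt (sigma0 r) (-|r x|) x := by
  have e : sigma0 r = fun x => sigma0 r 0 - ∫ ξ in (0 : ℝ)..x, |r ξ| :=
    funext fun x => hr.sigma0_eq 0 x
  rw [e]
  exact (intervalIntegral.integral_hasDerivAt_right (hr.continuous.abs.intervalIntegrable _ _)
    (hr.continuous.abs.stronglyMeasurableAtFilter _ _) hr.continuous.abs.continuousAt).const_sub _

theorem sigma0_continuous (hr : Pot r) : Continuous (sigma0 r) :=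
  continuous_iff_continuousAt.2 fun x => (hr.sigma0_hasDerivAt x).continuousAt

theorem sigma0_anti (hr : Pot r) : Antitone (sigma0 r) :=
  antitone_of_hasDerivAt_nonpos hr.sigma0_hasDerivAt fun x => by
    simp

theorem mul_sigma0_le (hr : Pot r) {x : ℝ} (hx : 0 ≤ x) :
    x * sigma0 r x ≤ ∫ ξ in Ioi x, ξ * |r ξ| := by
  rw [sigma0, ← integral_const_mul]
  refine setIntegral_mono_on (hr.integrable.abs.integrableOn.const_mul x)
    (hr.moment.mono_set (Ioi_subset_Ioi hx)) measurableSet_Ioi fun ξ hξ => ?_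
  exact mul_le_mul_of_nonneg_right (le_of_lt hξ) (abs_nonneg _)

/-- Integrating the derivative `σ₀ - ξ |r|` of `ξ σ₀(ξ)` leaves the boundary term `x σ₀(x)`, which
is at most the part of the moment beyond `x`. Thus the finite first moment makes `σ₀` integrable,
with integral at most `R`. -/
theorem integral_sigma0_le (hr : Pot r) {x : ℝ} (hx : 0 ≤ x) :
    ∫ ξ in (0 : ℝ)..x, sigma0 r ξ ≤ R r := by
  have hd : ∀ ξ ∈ uIcc 0 x, HasDerivAt (fun ξ => ξ * sigma0 r ξ) (sigma0 r ξ - ξ * |r ξ|) ξ := by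
    intro ξ _
    refine ((hasDerivAt_id ξ).mul (hr.sigma0_hasDerivAt ξ)).congr_deriv ?_
    simp; ring
  have c1 : Continuous fun ξ : ℝ => ξ * |r ξ| := continuous_id.mul hr.continuous.abs
  have h := intervalIntegral.integral_eq_sub_of_hasDerivAt hd
    ((hr.sigma0_continuous.sub c1).intervalIntegrable _ _)
  rw [intervalIntegral.integral_sub (hr.sigma0_continuous.intervalIntegrable _ _)
    (c1.intervalIntegrable _ _)] at h
  have h1 := hr.mul_sigma0_le hx
  have h2 := intervalIntegral.integral_Ioi_sub_Ioi hr.moment hx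
  have h3 : R r = ∫ ξ in Ioi 0, ξ * |r ξ| := rfl
  linarith

theorem sigma0_integrableOn (hr : Pot r) : IntegrableOn (sigma0 r) (Ioi 0) := by
  refine integrableOn_Ioi_of_intervalIntegral_norm_bounded (R r) 0 (b := id) (l := atTop)
    (fun x => hr.sigma0_continuous.integrableOn_Ioc) tendsto_id ?_
  filter_upwards [Ici_mem_atTop 0] with x hx
  simp only [Real.norm_eq_abs, abs_of_nonneg (sigma0_nonneg r _)]
  exact hr.integral_sigma0_le hx

theorem integral_Ioi_sigma0_le (hr : Pot r) : ∫ ξ in Ioi 0, sigma0 r ξ ≤ R r := by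
  refine le_of_tendsto (intervalIntegral_tendsto_integral_Ioi 0 hr.sigma0_integrableOn tendsto_id) ?_
  filter_upwards [Ici_mem_atTop 0] with x hx using hr.integral_sigma0_le hx

theorem mul_sigma0_le_R (hr : Pot r) {x : ℝ} (hx : 0 ≤ x) : x * sigma0 r x ≤ R r :=
  (hr.mul_sigma0_le hx).trans (setIntegral_mono_set hr.moment
    (by filter_upwards [ae_restrict_mem measurableSet_Ioi] with ξ hξ
        exact mul_nonneg (le_of_lt hξ) (abs_nonneg _))
    (Ioi_subset_Ioi hx).eventuallyLE)

theorem abs_integral_Ioi_le (r : ℝ → ℝ) (x : ℝ) : |∫ ξ in Ioi x, r ξ| ≤ sigma0 r x :=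
  norm_integral_le_integral_norm (μ := volume.restrict (Ioi x)) r

end Pot

/-! ### The kernel -/

/-- The continuous extension of the kernel from `closure Ω` to the plane. -/
def Ke (K : ℝ → ℝ → ℝ) (a b : ℝ) : ℝ := K |a| (max |a| |b|)

theorem isOpen_Omega : IsOpen Omega :=
  (isOpen_lt continuous_const continuous_fst).inter (isOpen_lt continuous_fst continuous_snd)

theorem mem_closure_Omega {a b : ℝ} (ha : 0 ≤ a) (hab : a ≤ b) : (a, b) ∈ closure Omega := by
  have t : Tendsto (fun ε : ℝ => (a + ε, b + 2 * ε)) (𝓝[>] 0) (𝓝 (a, b)) := by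
    have : Continuous fun ε : ℝ => (a + ε, b + 2 * ε) := by fun_prop
    simpa using (this.tendsto 0).mono_left nhdsWithin_le_nhds
  refine mem_closure_of_tendsto t ?_
  filter_upwards [self_mem_nhdsWithin] with ε hε
  have : (0 : ℝ) < ε := hε
  exact ⟨by simp only; linarith, by simp only; linarith⟩

theorem Ke_eq {K : ℝ → ℝ → ℝ} {a b : ℝ} (ha : 0 ≤ a) (hab : a ≤ b) : Ke K a b = K a b := by
  rw [Ke, abs_of_nonneg ha, abs_of_nonneg (ha.trans hab), max_eq_right hab]

namespace IsKernel

variable {r : ℝ → ℝ} {K : ℝ → ℝ → ℝ}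

theorem continuous_Ke (hK : IsKernel r K) : Continuous fun p : ℝ × ℝ => Ke K p.1 p.2 := by
  have : Continuous fun p : ℝ × ℝ => (|p.1|, max |p.1| |p.2|) := by fun_prop
  exact hK.continuous.comp_continuous this fun p =>
    mem_closure_Omega (abs_nonneg _) (le_max_left _ _)

/-- `K_{y₁}`. -/
def d1 (K : ℝ → ℝ → ℝ) (a b : ℝ) : ℝ := deriv (fun y => K y b) a

/-- `K_{y₂}`. -/
def d2 (K : ℝ → ℝ → ℝ) (a b : ℝ) : ℝ := deriv (fun y => K a y) b

theorem contDiffAt (hK : IsKernel r K) {p : ℝ × ℝ} (hp : p ∈ Omega) :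
    ContDiffAt ℝ 2 (fun p : ℝ × ℝ => K p.1 p.2) p :=
  hK.contDiff.contDiffAt (isOpen_Omega.mem_nhds hp)

theorem hasFDerivAt (hK : IsKernel r K) {p : ℝ × ℝ} (hp : p ∈ Omega) :
    HasFDerivAt (fun p : ℝ × ℝ => K p.1 p.2) (fderiv ℝ (fun p : ℝ × ℝ => K p.1 p.2) p) p :=
  ((hK.contDiffAt hp).differentiableAt (by norm_num)).hasFDerivAt

theorem hasDerivAt_d1 (hK : IsKernel r K) {a b : ℝ} (hp : (a, b) ∈ Omega) :
    HasDerivAt (fun y => K y b) (fderiv ℝ (fun p : ℝ × ℝ => K p.1 p.2) (a, b) (1, 0)) a :=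
  HasFDerivAt.comp_hasDerivAt (f := fun y => (y, b)) a (hK.hasFDerivAt hp) ((hasDerivAt_id a).prodMk (hasDerivAt_const a b))

theorem hasDerivAt_d2 (hK : IsKernel r K) {a b : ℝ} (hp : (a, b) ∈ Omega) :
    HasDerivAt (fun y => K a y) (fderiv ℝ (fun p : ℝ × ℝ => K p.1 p.2) (a, b) (0, 1)) b :=
  (hK.hasFDerivAt hp).comp_hasDerivAt b ((hasDerivAt_const b a).prodMk (hasDerivAt_id b))

theorem fderiv_apply (hK : IsKernel r K) {a b : ℝ} (hp : (a, b) ∈ Omega) (u v : ℝ) :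
    fderiv ℝ (fun p : ℝ × ℝ => K p.1 p.2) (a, b) (u, v) = u * d1 K a b + v * d2 K a b := by
  rw [d1, d2, (hK.hasDerivAt_d1 hp).deriv, (hK.hasDerivAt_d2 hp).deriv]
  have : ((u, v) : ℝ × ℝ) = u • (1, 0) + v • (0, 1) := by simp
  rw [this, map_add, map_smul, map_smul, smul_eq_mul, smul_eq_mul]

/-- The derivative along a curve in `Ω`. -/
theorem hasDerivAt_curve (hK : IsKernel r K) {x y : ℝ → ℝ} {x' y' t : ℝ} (hx : HasDerivAt x x' t)
    (hy : HasDerivAt y y' t) (hp : (x t, y t) ∈ Omega) :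
    HasDerivAt (fun t => K (x t) (y t)) (x' * d1 K (x t) (y t) + y' * d2 K (x t) (y t)) t := by
  rw [← hK.fderiv_apply hp]
  exact (hK.hasFDerivAt hp).comp_hasDerivAt t (hx.prodMk hy)

/-- Differentiating `K_{y₂} - K_{y₁}` in the direction `(1,1)` gives the second derivative evaluated
on `(1,1)` and `(-1,1)`. By symmetry the mixed terms cancel and `K_{y₂y₂} - K_{y₁y₁} = -r K`
remains. -/
theorem hasDerivAt_char (hK : IsKernel r K) {a c : ℝ} (ha : 0 < a) (hc : 0 < c) :
    HasDerivAt (fun α => d2 K α (α + c) - d1 K α (α + c)) (-(r a * K a (a + c))) a := by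
  set F : ℝ × ℝ → ℝ := fun p => K p.1 p.2 with hF
  have hp : (a, a + c) ∈ Omega := ⟨ha, by simp only; linarith⟩
  have hC : ContDiffAt ℝ 1 (fderiv ℝ F) (a, a + c) :=
    (hK.contDiffAt hp).fderiv_right (by norm_num)
  have hD : HasFDerivAt (fderiv ℝ F) (fderiv ℝ (fderiv ℝ F) (a, a + c)) (a, a + c) :=
    (hC.differentiableAt (by norm_num)).hasFDerivAt
  set D := fderiv ℝ (fderiv ℝ F) (a, a + c) with hDdef
  have hsymm : ∀ u v, D u v = D v u := fun u v =>
    ((hK.contDiffAt hp).isSymmSndFDerivAt (by simp)).eq u v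
  have h11 : iteratedDeriv 2 (fun y => K y (a + c)) a = D (1, 0) (1, 0) := by
    rw [iteratedDeriv_succ, iteratedDeriv_one]
    have e : deriv (fun y => K y (a + c)) =ᶠ[𝓝 a] fun y => fderiv ℝ F (y, a + c) (1, 0) := by
      have : ∀ᶠ y in 𝓝 a, (y, a + c) ∈ Omega :=
        (by fun_prop : Continuous fun y : ℝ => (y, a + c)).continuousAt.eventually
          (isOpen_Omega.mem_nhds hp)
      filter_upwards [this] with y hy using (hK.hasDerivAt_d1 hy).deriv
    rw [e.deriv_eq]
    have h := hD.comp_hasDerivAt a ((hasDerivAt_id a).prodMk (hasDerivAt_const a (a + c)))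
    exact ((ContinuousLinearMap.apply ℝ ℝ ((1 : ℝ), (0 : ℝ))).hasFDerivAt.comp_hasDerivAt a h).deriv
  have h22 : iteratedDeriv 2 (fun y => K a y) (a + c) = D (0, 1) (0, 1) := by
    rw [iteratedDeriv_succ, iteratedDeriv_one]
    have e : deriv (fun y => K a y) =ᶠ[𝓝 (a + c)] fun y => fderiv ℝ F (a, y) (0, 1) := by
      have : ∀ᶠ y in 𝓝 (a + c), (a, y) ∈ Omega :=
        (by fun_prop : Continuous fun y : ℝ => (a, y)).continuousAt.eventually
          (isOpen_Omega.mem_nhds hp)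
      filter_upwards [this] with y hy using (hK.hasDerivAt_d2 hy).deriv
    rw [e.deriv_eq]
    have h := hD.comp_hasDerivAt (a + c) ((hasDerivAt_const (a + c) a).prodMk (hasDerivAt_id (a + c)))
    exact ((ContinuousLinearMap.apply ℝ ℝ ((0 : ℝ), (1 : ℝ))).hasFDerivAt.comp_hasDerivAt
      (a + c) h).deriv
  have heq := hK.equation _ hp
  simp only [h11, h22] at heq
  have h := hD.comp_hasDerivAt a ((hasDerivAt_id a).prodMk ((hasDerivAt_id a).add_const c))
  have h2 := (ContinuousLinearMap.apply ℝ ℝ ((-1 : ℝ), (1 : ℝ))).hasFDerivAt.comp_hasDerivAt a h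
  have hval : D (1, 1) (-1, 1) = -(r a * K a (a + c)) := by
    have e1 : ((1 : ℝ), (1 : ℝ)) = (1, 0) + (0, 1) := by simp
    have e2 : ((-1 : ℝ), (1 : ℝ)) = -(1, 0) + (0, 1) := by simp
    rw [e1, e2]
    simp only [map_add, map_neg, add_apply]
    rw [hsymm (0, 1) (1, 0), ← heq]
    ring
  rw [← hval]
  refine h2.congr_of_eventuallyEq ?_
  filter_upwards [Ioi_mem_nhds ha] with α hα
  have hα' : (α, α + c) ∈ Omega := ⟨hα, by simp only; linarith⟩
  have := hK.fderiv_apply hα' (-1) 1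
  simp only [Function.comp_apply, ContinuousLinearMap.apply_apply, id]
  rw [this]; ring

end IsKernel

/-- Both `B - f` and `B + f` are monotone. Derivatives are required only in the open interval
because `K` is merely continuous on the boundary of `Ω`, where the endpoints may lie. -/
theorem abs_sub_le_of_abs_deriv_le {f f' B B' : ℝ → ℝ} {a b : ℝ} (hab : a ≤ b)
    (hf : ContinuousOn f (Icc a b)) (hB : ContinuousOn B (Icc a b))
    (hf' : ∀ x ∈ Ioo a b, HasDerivAt f (f' x) x) (hB' : ∀ x ∈ Ioo a b, HasDerivAt B (B' x) x)
    (h : ∀ x ∈ Ioo a b, |f' x| ≤ B' x) : |f b - f a| ≤ B b - B a := by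
  have key : ∀ g g' : ℝ → ℝ, ContinuousOn g (Icc a b) → (∀ x ∈ Ioo a b, HasDerivAt g (g' x) x) →
      (∀ x ∈ Ioo a b, 0 ≤ g' x) → g a ≤ g b := by
    intro g g' hg hg' h0
    refine monotoneOn_of_deriv_nonneg (convex_Icc a b) hg ?_ ?_ (left_mem_Icc.2 hab)
      (right_mem_Icc.2 hab) hab
    · rw [interior_Icc]
      exact fun x hx => (hg' x hx).differentiableAt.differentiableWithinAt
    · rw [interior_Icc]
      intro x hx
      rw [(hg' x hx).deriv]
      exact h0 x hx
  have h1 := key (fun x => B x - f x) (fun x => B' x - f' x) (hB.sub hf)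
    (fun x hx => (hB' x hx).sub (hf' x hx)) fun x hx => by linarith [(abs_le.1 (h x hx)).2]
  have h2 := key (fun x => B x + f x) (fun x => B' x + f' x) (hB.add hf)
    (fun x hx => (hB' x hx).add (hf' x hx)) fun x hx => by linarith [(abs_le.1 (h x hx)).1]
  rw [abs_le]
  constructor <;> linarith

/-! ### The kernel along characteristics and its a priori bound -/

namespace IsKernel

variable {r : ℝ → ℝ} {K : ℝ → ℝ → ℝ}

/-- `∫_a^∞ r(α) K(α, α + c) dα`, which equals `K_{y₂} - K_{y₁}` at `(a, a + c)`. -/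
def Bk (r : ℝ → ℝ) (K : ℝ → ℝ → ℝ) (a c : ℝ) : ℝ := ∫ α in Ioi a, r α * Ke K α (α + c)

/-- `-½ r(m/2) - ∫_a^{m/2} r(α) K(α, m - α) dα`, which equals `K_{y₁} + K_{y₂}` at
`(a, m - a)`. -/
def Ak (r : ℝ → ℝ) (K : ℝ → ℝ → ℝ) (a m : ℝ) : ℝ :=
  -(1 / 2) * r (m / 2) - ∫ α in a..(m / 2), r α * Ke K α (m - α)

/-- Along the diagonal direction `t ↦ (s - t, s + t)`. -/
theorem hasDerivAt_anti (hK : IsKernel r K) {s t : ℝ} (ht : 0 < t) (hts : t < s) :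
    HasDerivAt (fun t => Ke K (s - t) (s + t)) (d2 K (s - t) (s + t) - d1 K (s - t) (s + t)) t := by
  have h := hK.hasDerivAt_curve ((hasDerivAt_id t).const_sub s) ((hasDerivAt_id t).const_add s)
    (t := t) ⟨by simp only [id]; linarith, by simp only [id]; linarith⟩
  simp only [id] at h
  have h2 : HasDerivAt (fun t => K (s - t) (s + t))
      (d2 K (s - t) (s + t) - d1 K (s - t) (s + t)) t := h.congr_deriv (by ring)
  refine h2.congr_of_eventuallyEq ?_
  filter_upwards [Ioo_mem_nhds ht hts] with x hx
  exact Ke_eq (by linarith [hx.2]) (by linarith [hx.1])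

theorem continuous_anti (hK : IsKernel r K) (s : ℝ) : Continuous fun t => Ke K (s - t) (s + t) :=
  hK.continuous_Ke.comp (by fun_prop : Continuous fun t : ℝ => (s - t, s + t))

theorem Ke_diag (hK : IsKernel r K) {s : ℝ} (hs : 0 < s) :
    Ke K s s = (1 / 2) * ∫ ξ in Ioi s, r ξ := by
  rw [Ke_eq hs.le le_rfl, hK.diagonal s hs]

theorem abs_Ke_diag_le (hK : IsKernel r K) {s : ℝ} (hs : 0 < s) :
    |Ke K s s| ≤ 1 / 2 * sigma0 r s := by
  rw [hK.Ke_diag hs, abs_mul, abs_of_pos (by norm_num : (0 : ℝ) < 1 / 2)]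
  exact mul_le_mul_of_nonneg_left (Pot.abs_integral_Ioi_le r s) (by norm_num)

/-- A preliminary bound near the diagonal. -/
theorem exists_bound_strip (hr : Pot r) (hK : IsKernel r K) (T : ℝ) :
    ∃ C, ∀ a c, 0 < a → 0 < c → c ≤ T → |Ke K a (a + c)| ≤ C := by
  have hd := hK.decay
  rw [Metric.tendsto_nhds] at hd
  have h1 := hd 1 one_pos
  rw [atInfty, eventually_inf_principal, eventually_comap] at h1
  obtain ⟨S, hS⟩ := eventually_atTop.1 h1
  have hcomp : IsCompact (Icc (0 : ℝ) (max S 0) ×ˢ Icc (0 : ℝ) T) := isCompact_Icc.prod isCompact_Icc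
  have hcont : Continuous fun p : ℝ × ℝ => Ke K p.1 (p.1 + p.2) :=
    hK.continuous_Ke.comp (by fun_prop : Continuous fun p : ℝ × ℝ => (p.1, p.1 + p.2))
  obtain ⟨C, hC⟩ := hcomp.exists_bound_of_continuousOn hcont.continuousOn
  -- Points with `a ≤ max S 0` lie in a compact set. Beyond it, decay bounds the derivative along
  -- the antidiagonal by one; the parameter runs from the diagonal, where `|K| ≤ ½ σ₀(0)`, over a
  -- length `c / 2 ≤ T`.
  refine ⟨max C (1 / 2 * sigma0 r 0 + T), fun a c ha hc hcT => ?_⟩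
  rcases le_or_gt a (max S 0) with h | h
  · exact (hC (a, c) ⟨⟨ha.le, h⟩, ⟨hc.le, hcT⟩⟩).trans (le_max_left _ _)
  · refine le_trans ?_ (le_max_right _ _)
    have hSa : S < a := (le_max_left _ _).trans_lt h
    set s := a + c / 2 with hs
    have hsp : 0 < s := by positivity
    have key := abs_sub_le_of_abs_deriv_le (f := fun t => Ke K (s - t) (s + t)) (B := id)
      (B' := fun _ => 1) (a := 0) (b := c / 2) (by linarith) (hK.continuous_anti s).continuousOn
      continuousOn_id (fun x hx => hK.hasDerivAt_anti hx.1 (by linarith [hx.2]))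
      (fun x _ => hasDerivAt_id x) (fun x hx => by
        have := hS (2 * s) (by linarith) (s - x, s + x) (by simp only; ring)
          ⟨by simp only; linarith [hx.2], by simp only; linarith [hx.1]⟩
        rw [Real.dist_eq, sub_zero] at this
        rw [abs_sub_comm]
        exact this.le)
    have e1 : s - c / 2 = a := by rw [hs]; ring
    have e2 : s + c / 2 = a + c := by rw [hs]; ring
    simp only [e1, e2, sub_zero, add_zero, id] at key
    have h3 := hK.abs_Ke_diag_le hsp
    have h4 := hr.sigma0_anti hsp.le
    have h5 := abs_sub_abs_le_abs_sub (Ke K a (a + c)) (Ke K s s)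
    linarith

theorem continuous_rKe (hr : Pot r) (hK : IsKernel r K) (c : ℝ) :
    Continuous fun α => r α * Ke K α (α + c) :=
  hr.continuous.mul (hK.continuous_Ke.comp (by fun_prop : Continuous fun α : ℝ => (α, α + c)))

theorem integrableOn_rKe (hr : Pot r) (hK : IsKernel r K) {a c : ℝ} (ha : 0 ≤ a) (hc : 0 < c) :
    IntegrableOn (fun α => r α * Ke K α (α + c)) (Ioi a) := by
  obtain ⟨C, hC⟩ := hK.exists_bound_strip hr c
  refine Integrable.mono' (hr.integrable.abs.integrableOn.mul_const C)
    (hK.continuous_rKe hr c).aestronglyMeasurable ?_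
  filter_upwards [ae_restrict_mem measurableSet_Ioi] with α hα
  rw [norm_mul, Real.norm_eq_abs, Real.norm_eq_abs]
  exact mul_le_mul_of_nonneg_left (hC α c (ha.trans_lt hα) hc le_rfl) (abs_nonneg _)

/-- The identity of `hasDerivAt_char` is integrated along `b - a = c` from `a` to infinity, where
the decay condition makes `K_{y₂} - K_{y₁}` vanish. The bound on the strip ensures that `r K` is
integrable on that line. -/
theorem d2_sub_d1 (hr : Pot r) (hK : IsKernel r K) {a c : ℝ} (ha : 0 < a) (hc : 0 < c) :
    d2 K a (a + c) - d1 K a (a + c) = Bk r K a c := by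
  have ht : Tendsto (fun α => d2 K α (α + c) - d1 K α (α + c)) atTop (𝓝 0) := by
    have h1 : Tendsto (fun α : ℝ => (α, α + c)) atTop atInfty := by
      refine tendsto_inf.2 ⟨tendsto_comap_iff.2 ?_, tendsto_principal.2 ?_⟩
      · have : Tendsto (fun α : ℝ => α + (α + c)) atTop atTop :=
          tendsto_id.atTop_add_atTop (tendsto_atTop_add_const_right _ _ tendsto_id)
        exact this
      · filter_upwards [Ioi_mem_atTop 0] with α hα
        exact ⟨hα, by simp only; linarith⟩
    have := (hK.decay.comp h1).neg
    simp only [neg_zero] at this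
    refine this.congr fun α => ?_
    simp [d1, d2]
  have hi := hK.integrableOn_rKe hr ha.le hc
  have hcongr : ∀ α ∈ Ioi a, r α * Ke K α (α + c) = r α * K α (α + c) := fun α hα => by
    rw [Ke_eq (ha.le.trans (le_of_lt hα)) (by linarith)]
  have h := integral_Ioi_of_hasDerivAt_of_tendsto'
    (fun α (hα : α ∈ Ici a) => hK.hasDerivAt_char (ha.trans_le hα) hc)
    (hi.congr_fun hcongr measurableSet_Ioi).neg ht
  rw [Bk, setIntegral_congr_fun measurableSet_Ioi hcongr]
  rw [integral_neg] at h
  linarith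

/-- The constant in the bound of the kernel. -/
def CK (r : ℝ → ℝ) : ℝ := Real.exp (2 * R r)

/-- A Grönwall argument along antidiagonals `t ↦ (s - t, s + t)`. The derivative in `t` is an
integral of `r K` over points with the same `t` and larger `s`, so the supremum has to be taken over
all centres `s' ≥ s` at once. -/
theorem abs_K_le (hr : Pot r) (hK : IsKernel r K) {s t : ℝ} (ht : 0 < t) (hts : t < s) :
    |Ke K (s - t) (s + t)| ≤ CK r * sigma0 r s := by
  obtain ⟨C, hC⟩ := hK.exists_bound_strip hr (2 * t)
  have hs : 0 < s := ht.trans hts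
  let P : ℝ → ℝ := fun x => ∫ ξ in (0 : ℝ)..x, sigma0 r (s - ξ)
  have hsc : Continuous fun ξ => sigma0 r (s - ξ) :=
    hr.sigma0_continuous.comp (continuous_const.sub continuous_id)
  have hP : ∀ x, HasDerivAt P (sigma0 r (s - x)) x := fun x =>
    intervalIntegral.integral_hasDerivAt_right (hsc.intervalIntegrable _ _)
      (hsc.stronglyMeasurableAtFilter _ _) hsc.continuousAt
  have hP0 : P 0 = 0 := intervalIntegral.integral_same
  have hPnn : ∀ x, 0 ≤ x → 0 ≤ P x := fun x hx =>
    intervalIntegral.integral_nonneg hx fun _ _ => Pot.sigma0_nonneg _ _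
  have hPR : P t ≤ R r := by
    have e : P t = ∫ ξ in (s - t)..s, sigma0 r ξ := by
      simp only [P]
      rw [intervalIntegral.integral_comp_sub_left (fun ξ => sigma0 r ξ) s, sub_zero]
    have h1 := intervalIntegral.integral_add_adjacent_intervals
      (hr.sigma0_continuous.intervalIntegrable (μ := volume) 0 (s - t))
      (hr.sigma0_continuous.intervalIntegrable (s - t) s)
    have h2 : 0 ≤ ∫ ξ in (0 : ℝ)..(s - t), sigma0 r ξ :=
      intervalIntegral.integral_nonneg (by linarith) fun _ _ => Pot.sigma0_nonneg _ _
    have h3 := hr.integral_sigma0_le hs.le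
    linarith
  -- The supremum `N` of `E` is finite by the strip bound, which is the sole use of that bound here.
  -- If `|K| ≤ N e^{2P}`, the derivative in `t` at `x` is at most `N e^{2P(x)} σ₀(s - x)`, the
  -- derivative of `(N/2) e^{2P}`. The factor two in the exponent thus yields `N ≤ ½ σ₀(s) + N/2`,
  -- hence `N ≤ σ₀(s)`, and `P(t) ≤ R` gives the constant `e^{2R}`.
  let E : Set ℝ := {v | ∃ s' t', s ≤ s' ∧ 0 < t' ∧ t' ≤ t ∧
    v = |Ke K (s' - t') (s' + t')| * Real.exp (-(2 * P t'))}
  have hEb : BddAbove E := by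
    refine ⟨C, ?_⟩
    rintro v ⟨s', t', h1, h2, h3, rfl⟩
    have hb := hC (s' - t') (2 * t') (by linarith) (by linarith) (by linarith)
    have e : s' - t' + 2 * t' = s' + t' := by ring
    rw [e] at hb
    have : Real.exp (-(2 * P t')) ≤ 1 := Real.exp_le_one_iff.2 (by linarith [hPnn t' h2.le])
    calc _ ≤ |Ke K (s' - t') (s' + t')| * 1 := mul_le_mul_of_nonneg_left this (abs_nonneg _)
      _ ≤ C := by linarith
  set N := sSup E with hN
  have hmem : |Ke K (s - t) (s + t)| * Real.exp (-(2 * P t)) ∈ E := ⟨s, t, le_rfl, ht, le_rfl, rfl⟩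
  have hN0 : 0 ≤ N := le_trans (by positivity) (le_csSup hEb hmem)
  have hbd : ∀ s' t', s ≤ s' → 0 < t' → t' ≤ t →
      |Ke K (s' - t') (s' + t')| ≤ N * Real.exp (2 * P t') := by
    intro s' t' h1 h2 h3
    have := le_csSup hEb ⟨s', t', h1, h2, h3, rfl⟩
    rw [Real.exp_neg, ← div_eq_mul_inv, div_le_iff₀ (Real.exp_pos _)] at this
    exact this
  have hNle : N ≤ 1 / 2 * sigma0 r s + N / 2 := by
    refine csSup_le ⟨_, hmem⟩ ?_
    rintro v ⟨s', t', h1, h2, h3, rfl⟩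
    have key := abs_sub_le_of_abs_deriv_le (f := fun x => Ke K (s' - x) (s' + x))
      (B := fun x => N / 2 * Real.exp (2 * P x)) (a := 0) (b := t') h2.le
      (f' := fun x => d2 K (s' - x) (s' + x) - d1 K (s' - x) (s' + x))
      (B' := fun x => N * Real.exp (2 * P x) * sigma0 r (s - x))
      (hK.continuous_anti s').continuousOn
      (fun x _ => ((((hP x).const_mul 2).exp.const_mul (N / 2)).continuousAt).continuousWithinAt)
      (fun x hx => hK.hasDerivAt_anti hx.1 (by linarith [hx.2]))
      (fun x _ => (((hP x).const_mul 2).exp.const_mul (N / 2)).congr_deriv (by ring))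
      (fun x hx => by
        have e : s' + x = s' - x + 2 * x := by ring
        rw [e, hK.d2_sub_d1 hr (by linarith [hx.2]) (by linarith [hx.1]), Bk]
        rw [← Real.norm_eq_abs]
        refine (norm_integral_le_integral_norm _).trans ?_
        have hle : ∫ α in Ioi (s' - x), ‖r α * Ke K α (α + 2 * x)‖ ≤
            ∫ α in Ioi (s' - x), |r α| * (N * Real.exp (2 * P x)) := by
          refine setIntegral_mono_on
            (hK.integrableOn_rKe hr (by linarith [hx.2]) (by linarith [hx.1])).norm
            (hr.integrable.abs.integrableOn.mul_const _) measurableSet_Ioi fun α hα => ?_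
          have hα' : s' - x < α := hα
          have := hbd (α + x) x (by linarith) hx.1 (by linarith [hx.2])
          have e2 : α + x - x = α := by ring
          have e3 : α + x + x = α + 2 * x := by ring
          rw [e2, e3] at this
          rw [norm_mul, Real.norm_eq_abs, Real.norm_eq_abs]
          exact mul_le_mul_of_nonneg_left this (abs_nonneg _)
        refine hle.trans ?_
        rw [integral_mul_const, mul_comm]
        refine mul_le_mul_of_nonneg_left (hr.sigma0_anti (by linarith : s - x ≤ s' - x)) ?_
        positivity)
    simp only [hP0, sub_zero, add_zero, mul_zero, Real.exp_zero, mul_one] at key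
    have hs' : 0 < s' := hs.trans_le h1
    have h4 := hK.abs_Ke_diag_le hs'
    have h5 := hr.sigma0_anti h1
    have h6 := abs_sub_abs_le_abs_sub (Ke K (s' - t') (s' + t')) (Ke K s' s')
    have h7 : |Ke K (s' - t') (s' + t')| ≤ 1 / 2 * sigma0 r s + N / 2 * Real.exp (2 * P t') := by
      linarith
    rw [Real.exp_neg, ← div_eq_mul_inv, div_le_iff₀ (Real.exp_pos _)]
    have h8 : 1 ≤ Real.exp (2 * P t') := Real.one_le_exp (by linarith [hPnn t' h2.le])
    have h9 := Pot.sigma0_nonneg r s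
    nlinarith
  have hfin := hbd s t le_rfl ht le_rfl
  have h1 : N ≤ sigma0 r s := by linarith
  have h2 : Real.exp (2 * P t) ≤ CK r := Real.exp_le_exp.2 (by linarith)
  calc _ ≤ N * Real.exp (2 * P t) := hfin
    _ ≤ sigma0 r s * CK r := mul_le_mul h1 h2 (Real.exp_pos _).le (Pot.sigma0_nonneg _ _)
    _ = _ := mul_comm _ _

theorem CK_pos (r : ℝ → ℝ) : 0 < CK r := Real.exp_pos _

theorem abs_Ke_le (hr : Pot r) (hK : IsKernel r K) (a b : ℝ) :
    |Ke K a b| ≤ CK r * sigma0 r ((|a| + max |a| |b|) / 2) := by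
  have hcl : IsClosed {p : ℝ × ℝ | |Ke K p.1 p.2| ≤ CK r * sigma0 r ((p.1 + p.2) / 2)} :=
    isClosed_le hK.continuous_Ke.abs
      (continuous_const.mul (hr.sigma0_continuous.comp (by fun_prop)))
  have hsub : Omega ⊆ {p : ℝ × ℝ | |Ke K p.1 p.2| ≤ CK r * sigma0 r ((p.1 + p.2) / 2)} := by
    rintro ⟨a, b⟩ ⟨h1, h2⟩
    simp only at h1 h2
    have := hK.abs_K_le hr (s := (a + b) / 2) (t := (b - a) / 2) (by linarith) (by linarith)
    have e1 : (a + b) / 2 - (b - a) / 2 = a := by ring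
    have e2 : (a + b) / 2 + (b - a) / 2 = b := by ring
    rwa [e1, e2] at this
  have h := closure_minimal hsub hcl (mem_closure_Omega (abs_nonneg a) (le_max_left |a| |b|))
  have e : Ke K |a| (max |a| |b|) = Ke K a b := by
    simp [Ke, abs_of_nonneg (le_max_of_le_left (abs_nonneg a) : 0 ≤ max |a| |b|)]
  simpa only [mem_ofPred_eq, e] using h

theorem abs_Ke_le' (hr : Pot r) (hK : IsKernel r K) {a b : ℝ} (ha : 0 ≤ a) (hab : a ≤ b) :
    |Ke K a b| ≤ CK r * sigma0 r ((a + b) / 2) := by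
  have := hK.abs_Ke_le hr a b
  rwa [abs_of_nonneg ha, abs_of_nonneg (ha.trans hab), max_eq_right hab] at this

theorem abs_Ke_le_const (hr : Pot r) (hK : IsKernel r K) (a b : ℝ) :
    |Ke K a b| ≤ CK r * sigma0 r 0 :=
  (hK.abs_Ke_le hr a b).trans (mul_le_mul_of_nonneg_left (hr.sigma0_anti (by positivity))
    (CK_pos r).le)

theorem norm_rKe_le (hr : Pot r) (hK : IsKernel r K) (α b : ℝ) :
    ‖r α * Ke K α b‖ ≤ |r α| * (CK r * sigma0 r 0) := by
  rw [norm_mul, Real.norm_eq_abs, Real.norm_eq_abs]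
  exact mul_le_mul_of_nonneg_left (hK.abs_Ke_le_const hr _ _) (abs_nonneg _)

theorem integrable_rKe (hr : Pot r) (hK : IsKernel r K) (c : ℝ) :
    Integrable (fun α => r α * Ke K α (α + c)) :=
  Integrable.mono' (hr.integrable.abs.mul_const _) (hK.continuous_rKe hr c).aestronglyMeasurable
    (Eventually.of_forall fun _ => hK.norm_rKe_le hr _ _)

/-! ### Extension of the first derivatives of the kernel to the closed region -/

theorem Bk_eq (hr : Pot r) (hK : IsKernel r K) (a c : ℝ) :
    Bk r K a c = Bk r K 0 c - ∫ α in (0 : ℝ)..a, r α * Ke K α (α + c) := by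
  have := intervalIntegral.integral_Ioi_sub_Ioi' (a := 0) (b := a)
    (hK.integrable_rKe hr c).integrableOn (hK.integrable_rKe hr c).integrableOn
  simp only [Bk]
  linarith

theorem continuous_Bk (hr : Pot r) (hK : IsKernel r K) :
    Continuous fun p : ℝ × ℝ => Bk r K p.1 p.2 := by
  have h1 : Continuous fun c => Bk r K 0 c := by
    refine continuous_of_dominated (bound := fun α => |r α| * (CK r * sigma0 r 0))
      (fun c => (hK.continuous_rKe hr c).aestronglyMeasurable)
      (fun c => Eventually.of_forall fun _ => hK.norm_rKe_le hr _ _)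
      (hr.integrable.abs.integrableOn.mul_const _) (Eventually.of_forall fun α => ?_)
    exact continuous_const.mul (hK.continuous_Ke.comp (by fun_prop : Continuous fun c : ℝ => (α, α + c)))
  have h2 : Continuous fun p : ℝ × ℝ => ∫ α in (0 : ℝ)..p.1, r α * Ke K α (α + p.2) := by
    refine intervalIntegral.continuous_parametric_intervalIntegral_of_continuous
      (f := fun (p : ℝ × ℝ) α => r α * Ke K α (α + p.2)) ?_ continuous_fst
    exact (hr.continuous.comp continuous_snd).mul (hK.continuous_Ke.comp
      (by fun_prop : Continuous fun q : (ℝ × ℝ) × ℝ => (q.2, q.2 + q.1.2)))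
  have e : (fun p : ℝ × ℝ => Bk r K p.1 p.2) = fun p =>
      Bk r K 0 p.2 - ∫ α in (0 : ℝ)..p.1, r α * Ke K α (α + p.2) := funext fun p => hK.Bk_eq hr _ _
  rw [e]
  exact (h1.comp continuous_snd).sub h2

theorem hasDerivAt_Bk (hr : Pot r) (hK : IsKernel r K) (a c : ℝ) :
    HasDerivAt (fun a => Bk r K a c) (-(r a * Ke K a (a + c))) a := by
  have e : (fun a => Bk r K a c) = fun a =>
      Bk r K 0 c - ∫ α in (0 : ℝ)..a, r α * Ke K α (α + c) := funext fun a => hK.Bk_eq hr _ _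
  rw [e]
  have hc := hK.continuous_rKe hr c
  exact (intervalIntegral.integral_hasDerivAt_right (hc.intervalIntegrable _ _)
    (hc.stronglyMeasurableAtFilter _ _) hc.continuousAt).const_sub _

theorem continuous_rKe_sub (hr : Pot r) (hK : IsKernel r K) (m : ℝ) :
    Continuous fun α => r α * Ke K α (m - α) :=
  hr.continuous.mul (hK.continuous_Ke.comp (by fun_prop : Continuous fun α : ℝ => (α, m - α)))

theorem Ak_eq (hr : Pot r) (hK : IsKernel r K) (a m : ℝ) :
    Ak r K a m = Ak r K 0 m + ∫ α in (0 : ℝ)..a, r α * Ke K α (m - α) := by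
  have hc := hK.continuous_rKe_sub hr m
  have := intervalIntegral.integral_add_adjacent_intervals
    (hc.intervalIntegrable (μ := volume) 0 a) (hc.intervalIntegrable a (m / 2))
  simp only [Ak]
  linarith

theorem continuous_Ak (hr : Pot r) (hK : IsKernel r K) :
    Continuous fun p : ℝ × ℝ => Ak r K p.1 p.2 := by
  have hf : Continuous (Function.uncurry fun (p : ℝ × ℝ) α => r α * Ke K α (p.2 - α)) :=
    (hr.continuous.comp continuous_snd).mul (hK.continuous_Ke.comp
      (by fun_prop : Continuous fun q : (ℝ × ℝ) × ℝ => (q.2, q.1.2 - q.2)))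
  have h2 := intervalIntegral.continuous_parametric_intervalIntegral_of_continuous (μ := volume)
      (a₀ := 0) hf continuous_fst
  have h3 := intervalIntegral.continuous_parametric_intervalIntegral_of_continuous (μ := volume)
      (a₀ := 0) hf (continuous_snd.div_const 2)
  have e : (fun p : ℝ × ℝ => Ak r K p.1 p.2) = fun p =>
      (-(1 / 2) * r (p.2 / 2) - ∫ α in (0 : ℝ)..(p.2 / 2), r α * Ke K α (p.2 - α)) +
      ∫ α in (0 : ℝ)..p.1, r α * Ke K α (p.2 - α) := funext fun p => hK.Ak_eq hr _ _
  rw [e]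
  exact ((continuous_const.mul (hr.continuous.comp (continuous_snd.div_const 2))).sub h3).add h2

theorem hasDerivAt_Ak (hr : Pot r) (hK : IsKernel r K) (a m : ℝ) :
    HasDerivAt (fun a => Ak r K a m) (r a * Ke K a (m - a)) a := by
  have e : (fun a => Ak r K a m) = fun a =>
      Ak r K 0 m + ∫ α in (0 : ℝ)..a, r α * Ke K α (m - α) := funext fun a => hK.Ak_eq hr _ _
  rw [e]
  have hc := hK.continuous_rKe_sub hr m
  exact (intervalIntegral.integral_hasDerivAt_right (hc.intervalIntegrable _ _)
    (hc.stronglyMeasurableAtFilter _ _) hc.continuousAt).const_add _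

theorem K_eq (hr : Pot r) (hK : IsKernel r K) {s t : ℝ} (ht : 0 ≤ t) (hts : t < s) :
    Ke K (s - t) (s + t) = (1 / 2) * (∫ ξ in Ioi s, r ξ) +
      ∫ x in (0 : ℝ)..t, Bk r K (s - x) (2 * x) := by
  have hc : Continuous fun x => Bk r K (s - x) (2 * x) :=
    (hK.continuous_Bk hr).comp (by fun_prop : Continuous fun x : ℝ => (s - x, 2 * x))
  have h := intervalIntegral.integral_eq_sub_of_hasDerivAt_of_le ht
    (hK.continuous_anti s).continuousOn (f' := fun x => Bk r K (s - x) (2 * x)) (fun x hx => by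
      have e : s + x = s - x + 2 * x := by ring
      have := hK.hasDerivAt_anti hx.1 (by linarith [hx.2] : x < s)
      rw [e, hK.d2_sub_d1 hr (by linarith [hx.2]) (by linarith [hx.1])] at this
      exact this) (hc.intervalIntegrable _ _)
  simp only [sub_zero, add_zero] at h
  rw [hK.Ke_diag (ht.trans_lt hts)] at h
  linarith

/-- The sum is the derivative in `s`, with `t` fixed, of the representation `K_eq`. There the
diagonal value contributes `-½ r(s)`, and each `Bk` is differentiable in its first argument with
derivative `-r K`; hence continuity of `r` is enough. The substitution `α = s - x` turns the result
into `Ak`. -/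
theorem d1_add_d2 (hr : Pot r) (hK : IsKernel r K) {a b : ℝ} (ha : 0 < a) (hab : a < b) :
    d1 K a b + d2 K a b = Ak r K a (a + b) := by
  set t := (b - a) / 2 with ht
  set s := (a + b) / 2 with hs
  have ht0 : 0 < t := by linarith
  have hts : t < s := by linarith
  have ea : s - t = a := by rw [hs, ht]; ring
  have eb : s + t = b := by rw [hs, ht]; ring
  have h1 : HasDerivAt (fun s => Ke K (s - t) (s + t)) (d1 K a b + d2 K a b) s := by
    have h := hK.hasDerivAt_curve ((hasDerivAt_id s).sub_const t) ((hasDerivAt_id s).add_const t)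
      (t := s) ⟨by simp only [id]; linarith, by simp only [id]; linarith⟩
    simp only [id, ea, eb, one_mul] at h
    refine h.congr_of_eventuallyEq ?_
    filter_upwards [Ioi_mem_nhds hts] with x hx
    exact Ke_eq (by linarith [mem_Ioi.1 hx]) (by linarith)
  have h2 : HasDerivAt (fun s => (1 / 2) * (∫ ξ in Ioi s, r ξ)) (-(1 / 2) * r s) s := by
    have e : (fun s => ∫ ξ in Ioi s, r ξ) = fun s => (∫ ξ in Ioi 0, r ξ) - ∫ ξ in (0 : ℝ)..s, r ξ := by
      funext s
      have := intervalIntegral.integral_Ioi_sub_Ioi' (a := 0) (b := s) hr.integrable.integrableOn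
        hr.integrable.integrableOn
      linarith
    have hh : HasDerivAt (fun s => ∫ ξ in Ioi s, r ξ) (-r s) s := by
      rw [e]
      exact (intervalIntegral.integral_hasDerivAt_right (hr.continuous.intervalIntegrable _ _)
        (hr.continuous.stronglyMeasurableAtFilter _ _) hr.continuous.continuousAt).const_sub _
    exact (hh.const_mul (1 / 2)).congr_deriv (by ring)
  obtain ⟨C, hC⟩ := hr.bounded
  have h3 : HasDerivAt (fun s => ∫ x in (0 : ℝ)..t, Bk r K (s - x) (2 * x))
      (∫ x in (0 : ℝ)..t, -(r (s - x) * Ke K (s - x) (s + x))) s := by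
    refine (intervalIntegral.hasDerivAt_integral_of_dominated_loc_of_deriv_le
      (bound := fun _ => C * (CK r * sigma0 r 0)) (s := univ)
      (F' := fun s x => -(r (s - x) * Ke K (s - x) (s + x))) univ_mem
      (Eventually.of_forall fun y => ?_) ?_ ?_ ?_ ?_ ?_).2
    · exact ((hK.continuous_Bk hr).comp
        (by fun_prop : Continuous fun x : ℝ => (y - x, 2 * x))).aestronglyMeasurable
    · exact ((hK.continuous_Bk hr).comp
        (by fun_prop : Continuous fun x : ℝ => (s - x, 2 * x))).intervalIntegrable _ _
    · exact ((hr.continuous.comp (by fun_prop : Continuous fun x : ℝ => s - x)).mul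
        (hK.continuous_Ke.comp
        (by fun_prop : Continuous fun x : ℝ => (s - x, s + x)))).neg.aestronglyMeasurable
    · refine Eventually.of_forall fun x _ y _ => ?_
      rw [norm_neg]
      refine (hK.norm_rKe_le hr _ _).trans (mul_le_mul_of_nonneg_right (hC _) ?_)
      exact mul_nonneg (CK_pos r).le (Pot.sigma0_nonneg _ _)
    · exact intervalIntegrable_const
    · refine Eventually.of_forall fun x _ y _ => ?_
      have := (hK.hasDerivAt_Bk hr (y - x) (2 * x)).comp y ((hasDerivAt_id y).sub_const x)
      have e : y - x + 2 * x = y + x := by ring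
      simpa only [e, mul_one, id, Function.comp_def] using this
  have h4 := h2.add h3
  have e : (fun s => Ke K (s - t) (s + t)) =ᶠ[𝓝 s] fun s => (1 / 2) * (∫ ξ in Ioi s, r ξ) +
      ∫ x in (0 : ℝ)..t, Bk r K (s - x) (2 * x) := by
    filter_upwards [Ioi_mem_nhds hts] with x hx using hK.K_eq hr ht0.le hx
  rw [h1.unique (h4.congr_of_eventuallyEq e), Ak, ← hs, intervalIntegral.integral_neg]
  have := intervalIntegral.integral_comp_sub_left (a := 0) (b := t)
    (fun α => r α * Ke K α (a + b - α)) s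
  rw [ea, sub_zero] at this
  rw [← this]
  have e2 : ∀ x, a + b - (s - x) = s + x := fun x => by rw [hs]; ring
  simp only [e2]
  ring

/-- The continuous extension of `K_{y₁}`. -/
def k1 (r : ℝ → ℝ) (K : ℝ → ℝ → ℝ) (a b : ℝ) : ℝ := (Ak r K a (a + b) - Bk r K a (b - a)) / 2

/-- The continuous extension of `K_{y₂}`. -/
def k2 (r : ℝ → ℝ) (K : ℝ → ℝ → ℝ) (a b : ℝ) : ℝ := (Ak r K a (a + b) + Bk r K a (b - a)) / 2

theorem d1_eq (hr : Pot r) (hK : IsKernel r K) {a b : ℝ} (ha : 0 < a) (hab : a < b) :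
    d1 K a b = k1 r K a b := by
  have h1 := hK.d1_add_d2 hr ha hab
  have h2 := hK.d2_sub_d1 hr ha (sub_pos.2 hab)
  rw [add_sub_cancel] at h2
  rw [k1]; linarith

theorem d2_eq (hr : Pot r) (hK : IsKernel r K) {a b : ℝ} (ha : 0 < a) (hab : a < b) :
    d2 K a b = k2 r K a b := by
  have h1 := hK.d1_add_d2 hr ha hab
  have h2 := hK.d2_sub_d1 hr ha (sub_pos.2 hab)
  rw [add_sub_cancel] at h2
  rw [k2]; linarith

theorem continuous_k1 (hr : Pot r) (hK : IsKernel r K) :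
    Continuous fun p : ℝ × ℝ => k1 r K p.1 p.2 :=
  (((hK.continuous_Ak hr).comp (by fun_prop : Continuous fun p : ℝ × ℝ => (p.1, p.1 + p.2))).sub
    ((hK.continuous_Bk hr).comp
      (by fun_prop : Continuous fun p : ℝ × ℝ => (p.1, p.2 - p.1)))).div_const 2

theorem continuous_k2 (hr : Pot r) (hK : IsKernel r K) :
    Continuous fun p : ℝ × ℝ => k2 r K p.1 p.2 :=
  (((hK.continuous_Ak hr).comp (by fun_prop : Continuous fun p : ℝ × ℝ => (p.1, p.1 + p.2))).add
    ((hK.continuous_Bk hr).comp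
      (by fun_prop : Continuous fun p : ℝ × ℝ => (p.1, p.2 - p.1)))).div_const 2

/-- Along `b - a = c` the mean of the arguments of `K` increases from its initial value `a + c / 2`,
so `σ₀` at that value comes out of the integral; the other factor is `∫ |r|`. -/
theorem abs_Bk_le (hr : Pot r) (hK : IsKernel r K) {a c : ℝ} (ha : 0 ≤ a) (hc : 0 ≤ c) :
    |Bk r K a c| ≤ CK r * sigma0 r 0 * sigma0 r (a + c / 2) := by
  have h0 := (CK_pos r).le
  have h1 := Pot.sigma0_nonneg r (a + c / 2)
  calc |Bk r K a c| ≤ ∫ α in Ioi a, ‖r α * Ke K α (α + c)‖ := by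
        rw [← Real.norm_eq_abs]
        exact norm_integral_le_integral_norm _
    _ ≤ ∫ α in Ioi a, |r α| * (CK r * sigma0 r (a + c / 2)) := by
      refine setIntegral_mono_on (hK.integrable_rKe hr c).norm.integrableOn
        (hr.integrable.abs.integrableOn.mul_const _) measurableSet_Ioi fun α hα => ?_
      have hα' : a < α := hα
      rw [norm_mul, Real.norm_eq_abs, Real.norm_eq_abs]
      refine mul_le_mul_of_nonneg_left ((hK.abs_Ke_le' hr (by linarith) (by linarith)).trans ?_)
        (abs_nonneg _)
      exact mul_le_mul_of_nonneg_left (hr.sigma0_anti (by linarith)) h0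
    _ = sigma0 r a * (CK r * sigma0 r (a + c / 2)) := integral_mul_const _ _
    _ ≤ sigma0 r 0 * (CK r * sigma0 r (a + c / 2)) :=
      mul_le_mul_of_nonneg_right (hr.sigma0_anti ha) (mul_nonneg h0 h1)
    _ = _ := by ring

/-- Along `a + b = m` the mean of the arguments of `K` is constantly `m / 2`. The only term without
a factor `σ₀` is the explicit `½ |r(m/2)|` from the diagonal, the source of the coefficient `¼` in
the estimate of `K_{y₁}`. -/
theorem abs_Ak_le (hr : Pot r) (hK : IsKernel r K) {a m : ℝ} (ha : 0 ≤ a) (hm : a ≤ m / 2) :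
    |Ak r K a m| ≤ 1 / 2 * |r (m / 2)| + CK r * sigma0 r 0 * sigma0 r (m / 2) := by
  have h0 := (CK_pos r).le
  have h1 := Pot.sigma0_nonneg r (m / 2)
  have key : |∫ α in a..(m / 2), r α * Ke K α (m - α)| ≤ CK r * sigma0 r 0 * sigma0 r (m / 2) := by
    rw [intervalIntegral.integral_of_le hm]
    calc |∫ α in Ioc a (m / 2), r α * Ke K α (m - α)|
        ≤ ∫ α in Ioc a (m / 2), ‖r α * Ke K α (m - α)‖ := by
          rw [← Real.norm_eq_abs]
          exact norm_integral_le_integral_norm _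
      _ ≤ ∫ α in Ioc a (m / 2), |r α| * (CK r * sigma0 r (m / 2)) := by
        refine setIntegral_mono_on (hK.continuous_rKe_sub hr m).norm.integrableOn_Ioc
          (hr.integrable.abs.integrableOn.mul_const _) measurableSet_Ioc fun α hα => ?_
        rw [norm_mul, Real.norm_eq_abs, Real.norm_eq_abs]
        refine mul_le_mul_of_nonneg_left ?_ (abs_nonneg _)
        have := hK.abs_Ke_le' hr (a := α) (b := m - α) (by linarith [hα.1]) (by linarith [hα.2])
        rwa [add_sub_cancel] at this
      _ = (∫ α in Ioc a (m / 2), |r α|) * (CK r * sigma0 r (m / 2)) := integral_mul_const _ _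
      _ ≤ sigma0 r 0 * (CK r * sigma0 r (m / 2)) := by
        refine mul_le_mul_of_nonneg_right ?_ (mul_nonneg h0 h1)
        exact setIntegral_mono_set hr.integrable.abs.integrableOn
          (Eventually.of_forall fun _ => abs_nonneg _)
          (LE.le.eventuallyLE fun x hx => ha.trans_lt hx.1)
      _ = _ := by ring
  rw [Ak]
  refine (abs_sub _ _).trans (add_le_add ?_ key)
  rw [abs_mul, abs_neg, abs_of_pos (by norm_num : (0 : ℝ) < 1 / 2)]

/-- The constant `M₁`. -/
def MK (r : ℝ → ℝ) : ℝ := CK r * sigma0 r 0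

theorem abs_k1_le (hr : Pot r) (hK : IsKernel r K) {a b : ℝ} (ha : 0 ≤ a) (hab : a ≤ b) :
    |k1 r K a b| ≤ 1 / 4 * |r ((a + b) / 2)| + MK r * sigma0 r ((a + b) / 2) := by
  have h1 := hK.abs_Bk_le hr ha (sub_nonneg.2 hab)
  have h2 := hK.abs_Ak_le hr (m := a + b) ha (by linarith)
  have e : a + (b - a) / 2 = (a + b) / 2 := by ring
  rw [e] at h1
  rw [k1, abs_div, abs_two, MK]
  have := abs_sub (Ak r K a (a + b)) (Bk r K a (b - a))
  linarith

theorem abs_k2_le (hr : Pot r) (hK : IsKernel r K) {a b : ℝ} (ha : 0 ≤ a) (hab : a ≤ b) :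
    |k2 r K a b| ≤ 1 / 4 * |r ((a + b) / 2)| + MK r * sigma0 r ((a + b) / 2) := by
  have h1 := hK.abs_Bk_le hr ha (sub_nonneg.2 hab)
  have h2 := hK.abs_Ak_le hr (m := a + b) ha (by linarith)
  have e : a + (b - a) / 2 = (a + b) / 2 := by ring
  rw [e] at h1
  rw [k2, abs_div, abs_two, MK]
  have := abs_add_le (Ak r K a (a + b)) (Bk r K a (b - a))
  linarith

theorem MK_nonneg (r : ℝ → ℝ) : 0 ≤ MK r := mul_nonneg (CK_pos r).le (Pot.sigma0_nonneg _ _)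

theorem exists_kernelBound (hr : Pot r) (hK : IsKernel r K) : ∃ M1 > 0, KernelBound r K M1 := by
  -- `MK r` vanishes when `r` does; adding one makes the constant strictly positive.
  refine ⟨MK r + 1, by linarith [MK_nonneg r], fun p hp => ?_⟩
  have h := hK.abs_k1_le hr hp.1.le hp.2.le
  rw [← hK.d1_eq hr hp.1 hp.2, d1] at h
  nlinarith [Pot.sigma0_nonneg r ((p.1 + p.2) / 2)]

theorem continuous_slice1 (hK : IsKernel r K) (b : ℝ) : Continuous fun a => Ke K a b :=
  hK.continuous_Ke.comp (by fun_prop : Continuous fun a : ℝ => (a, b))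

theorem continuous_slice2 (hK : IsKernel r K) (a : ℝ) : Continuous fun b => Ke K a b :=
  hK.continuous_Ke.comp (by fun_prop : Continuous fun b : ℝ => (a, b))

theorem hasDerivAt_slice1 (hr : Pot r) (hK : IsKernel r K) {a b : ℝ} (ha : 0 < a) (hab : a < b) :
    HasDerivAt (fun y => Ke K y b) (k1 r K a b) a := by
  have h := (hK.hasDerivAt_d1 (a := a) (b := b) ⟨ha, hab⟩).differentiableAt.hasDerivAt
  change HasDerivAt _ (d1 K a b) a at h
  rw [hK.d1_eq hr ha hab] at h
  refine h.congr_of_eventuallyEq ?_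
  filter_upwards [Ioo_mem_nhds ha hab] with x hx using Ke_eq hx.1.le hx.2.le

theorem hasDerivAt_slice2 (hr : Pot r) (hK : IsKernel r K) {a b : ℝ} (ha : 0 < a) (hab : a < b) :
    HasDerivAt (fun y => Ke K a y) (k2 r K a b) b := by
  have h := (hK.hasDerivAt_d2 (a := a) (b := b) ⟨ha, hab⟩).differentiableAt.hasDerivAt
  change HasDerivAt _ (d2 K a b) b at h
  rw [hK.d2_eq hr ha hab] at h
  refine h.congr_of_eventuallyEq ?_
  filter_upwards [Ioi_mem_nhds hab] with x hx using Ke_eq ha.le (le_of_lt hx)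

theorem integral_k1 (hr : Pot r) (hK : IsKernel r K) {a a' b : ℝ} (ha : 0 ≤ a) (h : a ≤ a')
    (hb : a' ≤ b) : ∫ y in a..a', k1 r K y b = Ke K a' b - Ke K a b :=
  intervalIntegral.integral_eq_sub_of_hasDerivAt_of_le h (hK.continuous_slice1 b).continuousOn
    (fun _ hx => hK.hasDerivAt_slice1 hr (ha.trans_lt hx.1) (hx.2.trans_le hb))
    (((hK.continuous_k1 hr).comp
      (by fun_prop : Continuous fun a : ℝ => (a, b))).intervalIntegrable _ _)

theorem integral_k2 (hr : Pot r) (hK : IsKernel r K) {a b b' : ℝ} (ha : 0 < a) (h : a ≤ b)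
    (hb : b ≤ b') : ∫ y in b..b', k2 r K a y = Ke K a b' - Ke K a b :=
  intervalIntegral.integral_eq_sub_of_hasDerivAt_of_le hb (hK.continuous_slice2 a).continuousOn
    (fun _ hx => hK.hasDerivAt_slice2 hr ha (h.trans_lt hx.1))
    (((hK.continuous_k2 hr).comp
      (by fun_prop : Continuous fun b : ℝ => (a, b))).intervalIntegrable _ _)

/-- The kernel is known to be differentiable only for `0 < a < b`. Its derivative there has the
limit `k1` at `a = 0`, and continuity of `K` makes this limit the one-sided derivative occurring in
the control. -/
theorem derivWithin_eq (hr : Pot r) (hK : IsKernel r K) {b : ℝ} (hb : 0 < b) :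
    derivWithin (fun y => K y b) (Ici 0) 0 = k1 r K 0 b := by
  have hc : Continuous fun a => k1 r K a b :=
    (hK.continuous_k1 hr).comp (by fun_prop : Continuous fun a : ℝ => (a, b))
  have h := hasDerivWithinAt_Ici_of_tendsto_deriv (f := fun y => Ke K y b) (s := Ioo 0 b) (a := 0)
    (e := k1 r K 0 b)
    (fun x hx => (hK.hasDerivAt_slice1 hr hx.1 hx.2).differentiableAt.differentiableWithinAt)
    (hK.continuous_slice1 b).continuousWithinAt (Ioo_mem_nhdsGT hb) (by
      refine ((hc.tendsto 0).mono_left nhdsWithin_le_nhds).congr' ?_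
      filter_upwards [Ioo_mem_nhdsGT hb] with x hx
      exact (hK.hasDerivAt_slice1 hr hx.1 hx.2).deriv.symm)
  have h2 : HasDerivWithinAt (fun y => K y b) (k1 r K 0 b) (Ici 0) 0 := by
    refine h.congr_of_eventuallyEq ?_ (Ke_eq le_rfl hb.le).symm
    filter_upwards [Ico_mem_nhdsGE hb] with x hx using (Ke_eq hx.1 hx.2.le).symm
  exact h2.derivWithin (uniqueDiffOn_Ici 0 0 self_mem_Ici)

/-- The estimate passes to `a = 0` by continuity. The given `M₁` is retained, not replaced by `MK
r`, because the bound of the control is claimed for every admissible constant. -/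
theorem abs_k1_zero_le (hr : Pot r) (hK : IsKernel r K) {M1 : ℝ} (hM : KernelBound r K M1) {b : ℝ}
    (hb : 0 < b) : |k1 r K 0 b| ≤ 1 / 4 * |r (b / 2)| + M1 * sigma0 r (b / 2) := by
  have hc : Continuous fun a => k1 r K a b :=
    (hK.continuous_k1 hr).comp (by fun_prop : Continuous fun a : ℝ => (a, b))
  have hc2 : Continuous fun a => 1 / 4 * |r ((a + b) / 2)| + M1 * sigma0 r ((a + b) / 2) :=
    (continuous_const.mul (hr.continuous.comp (by fun_prop)).abs).add
      (continuous_const.mul (hr.sigma0_continuous.comp (by fun_prop)))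
  have h := le_of_tendsto_of_tendsto ((hc.abs.tendsto 0).mono_left nhdsWithin_le_nhds)
    ((hc2.tendsto 0).mono_left (nhdsWithin_le_nhds (s := Ioi 0))) (by
      filter_upwards [Ioo_mem_nhdsGT hb] with x hx
      have := hM (x, b) ⟨hx.1, hx.2⟩
      rw [← hK.d1_eq hr hx.1 hx.2]
      exact this)
  simpa using h

end IsKernel

/-! ### Integrals over `Ω` -/

theorem sq_integral_mul_le {α : Type*} [MeasurableSpace α] {μ : Measure α} {f g : α → ℝ}
    (hf : MemLp f 2 μ) (hg : MemLp g 2 μ) :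
    (∫ x, f x * g x ∂μ) ^ 2 ≤ (∫ x, f x ^ 2 ∂μ) * ∫ x, g x ^ 2 ∂μ := by
  have h := real_inner_mul_inner_self_le (hf.toLp f) (hg.toLp g)
  have key : ∀ {u v : α → ℝ} (hu : MemLp u 2 μ) (hv : MemLp v 2 μ),
      inner ℝ (hu.toLp u) (hv.toLp v) = ∫ x, u x * v x ∂μ := by
    intro u v hu hv
    rw [L2.inner_def]
    refine integral_congr_ae ?_
    filter_upwards [hu.coeFn_toLp, hv.coeFn_toLp] with x h1 h2
    rw [h1, h2]; simp [mul_comm]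
  rw [key, key, key] at h
  simpa only [sq] using h

theorem memLp_tensor {φ g : ℝ → ℝ} (hφ : MemLp φ 2) (hg : MemLp g 2) :
    MemLp (fun p : ℝ × ℝ => φ p.1 * g p.2) 2 := by
  have hm : AEStronglyMeasurable (fun p : ℝ × ℝ => φ p.1 * g p.2) volume :=
    (hφ.1.comp_fst).mul (hg.1.comp_snd)
  rw [memLp_two_iff_integrable_sq hm]
  simp only [mul_pow]
  exact hφ.integrable_sq.mul_prod hg.integrable_sq

theorem measurableSet_Omega : MeasurableSet Omega := isOpen_Omega.measurableSet

theorem integral_Omega_fst {F : ℝ × ℝ → ℝ} (hF : IntegrableOn F Omega) :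
    ∫ p in Omega, F p = ∫ a in Ioi 0, ∫ b in Ioi a, F (a, b) := by
  rw [← integral_indicator measurableSet_Omega, Measure.volume_eq_prod,
    integral_prod _ ((integrable_indicator_iff measurableSet_Omega).2 hF),
    ← integral_indicator measurableSet_Ioi]
  refine integral_congr_ae (Eventually.of_forall fun a => ?_)
  by_cases ha : 0 < a
  · rw [indicator_of_mem (mem_Ioi.2 ha), ← integral_indicator measurableSet_Ioi]
    refine integral_congr_ae (Eventually.of_forall fun b => ?_)
    by_cases hb : a < b <;> simp [indicator, Omega, ha, hb]
  · rw [indicator_of_notMem (by simpa using ha)]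
    simp [indicator, Omega, ha]

theorem integral_Omega_snd {F : ℝ × ℝ → ℝ} (hF : IntegrableOn F Omega) :
    ∫ p in Omega, F p = ∫ b in Ioi 0, ∫ a in (0 : ℝ)..b, F (a, b) := by
  rw [← integral_indicator measurableSet_Omega, Measure.volume_eq_prod,
    integral_prod_symm _ ((integrable_indicator_iff measurableSet_Omega).2 hF),
    ← integral_indicator measurableSet_Ioi]
  refine integral_congr_ae (Eventually.of_forall fun b => ?_)
  by_cases hb : 0 < b
  · rw [indicator_of_mem (mem_Ioi.2 hb), intervalIntegral.integral_of_le hb.le,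
      integral_Ioc_eq_integral_Ioo, ← integral_indicator measurableSet_Ioo]
    refine integral_congr_ae (Eventually.of_forall fun a => ?_)
    by_cases ha : 0 < a <;> by_cases hab : a < b <;> simp [indicator, Omega, ha, hab]
  · rw [indicator_of_notMem (by simpa using hb)]
    have : ∀ a, ¬ (0 < a ∧ a < b) := fun a h => hb (h.1.trans h.2)
    simp [indicator, Omega, this]

theorem shear_add : MeasurePreserving (fun p : ℝ × ℝ => (p.1, p.2 + p.1)) :=
  measurePreserving_prod_add_right volume volume

theorem shear_sub : MeasurePreserving (fun p : ℝ × ℝ => (p.1, p.2 - p.1)) :=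
  measurePreserving_prod_sub volume volume

theorem shear_add_emb : MeasurableEmbedding (fun p : ℝ × ℝ => (p.1, p.2 + p.1)) :=
  (Homeomorph.mk ⟨fun p : ℝ × ℝ => (p.1, p.2 + p.1), fun p => (p.1, p.2 - p.1),
    fun p => by simp, fun p => by simp⟩ (by fun_prop) (by fun_prop)).measurableEmbedding

theorem shear_sub_emb : MeasurableEmbedding (fun p : ℝ × ℝ => (p.1, p.2 - p.1)) :=
  (Homeomorph.mk ⟨fun p : ℝ × ℝ => (p.1, p.2 - p.1), fun p => (p.1, p.2 + p.1),
    fun p => by simp, fun p => by simp⟩ (by fun_prop) (by fun_prop)).measurableEmbedding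

/-- Integration over `Ω` along the lines `b - a = c`. -/
theorem integral_Omega_char {F : ℝ × ℝ → ℝ} (hF : IntegrableOn F Omega) :
    ∫ p in Omega, F p = ∫ c in Ioi 0, ∫ a in Ioi 0, F (a, a + c) := by
  have hi := (integrable_indicator_iff measurableSet_Omega).2 hF
  have hi2 : Integrable (fun p : ℝ × ℝ => Omega.indicator F (p.1, p.2 + p.1))
      (volume.prod volume) := (shear_add.integrable_comp_emb shear_add_emb).2 hi
  rw [← integral_indicator measurableSet_Omega, ← shear_add.integral_comp shear_add_emb,
    Measure.volume_eq_prod, integral_prod_symm _ hi2, ← integral_indicator measurableSet_Ioi]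
  refine integral_congr_ae (Eventually.of_forall fun c => ?_)
  by_cases hc : 0 < c
  · rw [indicator_of_mem (mem_Ioi.2 hc), ← integral_indicator measurableSet_Ioi]
    refine integral_congr_ae (Eventually.of_forall fun a => ?_)
    by_cases ha : 0 < a <;> simp [indicator, Omega, ha, hc, add_comm]
  · rw [indicator_of_notMem (by simpa using hc)]
    simp [indicator, Omega, hc]

/-- Integration over `Ω` along the lines `a + b = m`. -/
theorem integral_Omega_anti {F : ℝ × ℝ → ℝ} (hF : IntegrableOn F Omega) :
    ∫ p in Omega, F p = ∫ m in Ioi 0, ∫ a in (0 : ℝ)..(m / 2), F (a, m - a) := by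
  have hi := (integrable_indicator_iff measurableSet_Omega).2 hF
  have hi2 : Integrable (fun p : ℝ × ℝ => Omega.indicator F (p.1, p.2 - p.1))
      (volume.prod volume) := (shear_sub.integrable_comp_emb shear_sub_emb).2 hi
  rw [← integral_indicator measurableSet_Omega, ← shear_sub.integral_comp shear_sub_emb,
    Measure.volume_eq_prod, integral_prod_symm _ hi2, ← integral_indicator measurableSet_Ioi]
  refine integral_congr_ae (Eventually.of_forall fun m => ?_)
  by_cases hm : 0 < m
  · rw [indicator_of_mem (mem_Ioi.2 hm), intervalIntegral.integral_of_le (by positivity),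
      integral_Ioc_eq_integral_Ioo, ← integral_indicator measurableSet_Ioo]
    refine integral_congr_ae (Eventually.of_forall fun a => ?_)
    have e : a < m - a ↔ a < m / 2 := by constructor <;> intro h <;> linarith
    by_cases ha : 0 < a <;> by_cases hab : a < m / 2 <;> simp [indicator, Omega, ha, hab, e]
  · rw [indicator_of_notMem (by simpa using hm)]
    have : ∀ a, ¬ (0 < a ∧ a < m - a) := fun a h => hm (by linarith [h.1, h.2])
    simp [indicator, Omega, this]

/-- The antidiagonal `a + b = m` meets `Ω` for `0 < a < m/2`, so integration over `Ω` produces the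
weight `m/2`. This is where the first moment of `r` is converted into integrability of kernels. -/
theorem integrableOn_Omega_of_mean {v : ℝ → ℝ} (hc : Continuous v) (h0 : ∀ s, 0 ≤ v s)
    (hv : IntegrableOn (fun s => s * v s) (Ioi 0)) :
    IntegrableOn (fun p : ℝ × ℝ => v ((p.1 + p.2) / 2)) Omega := by
  rw [← integrable_indicator_iff measurableSet_Omega, ← shear_sub.integrable_comp_emb shear_sub_emb]
  have e : (Omega.indicator fun p : ℝ × ℝ => v ((p.1 + p.2) / 2)) ∘
      (fun p : ℝ × ℝ => (p.1, p.2 - p.1)) =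
      fun p : ℝ × ℝ => (Ioo 0 (p.2 / 2)).indicator (fun _ => v (p.2 / 2)) p.1 := by
    funext p
    have e : p.1 < p.2 - p.1 ↔ p.1 < p.2 / 2 := by constructor <;> intro h <;> linarith
    simp [indicator, Omega, e]
  have hm : AEStronglyMeasurable ((Omega.indicator fun p : ℝ × ℝ => v ((p.1 + p.2) / 2)) ∘
      (fun p : ℝ × ℝ => (p.1, p.2 - p.1))) (volume.prod volume) := by
    have h1 : AEStronglyMeasurable (Omega.indicator fun p : ℝ × ℝ => v ((p.1 + p.2) / 2)) volume :=
      (by fun_prop : Continuous fun p : ℝ × ℝ => v ((p.1 + p.2) / 2)).aestronglyMeasurable.indicator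
        measurableSet_Omega
    exact h1.comp_measurePreserving shear_sub
  rw [Measure.volume_eq_prod, integrable_prod_iff' hm, e]
  have hint : ∀ m : ℝ, ∫ a, ‖(Ioo 0 (m / 2)).indicator (fun _ => v (m / 2)) a‖ =
      (Ioi 0).indicator (fun m => m / 2 * v (m / 2)) m := by
    intro m
    have e1 : (fun a => ‖(Ioo 0 (m / 2)).indicator (fun _ => v (m / 2)) a‖) =
        (Ioo 0 (m / 2)).indicator (fun _ => v (m / 2)) := by
      funext a
      rw [norm_indicator_eq_indicator_norm]
      simp [abs_of_nonneg (h0 _)]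
    rw [e1, integral_indicator measurableSet_Ioo, setIntegral_const, smul_eq_mul,
      measureReal_def, Real.volume_Ioo, sub_zero]
    by_cases hm : 0 < m
    · rw [indicator_of_mem (mem_Ioi.2 hm), ENNReal.toReal_ofReal (by positivity)]
    · rw [indicator_of_notMem (by simpa using hm), ENNReal.ofReal_of_nonpos (by linarith)]
      simp
  refine ⟨Eventually.of_forall fun m => ?_, ?_⟩
  · simp only
    rw [integrable_indicator_iff measurableSet_Ioo]
    exact integrableOn_const (by simp)
  · simp only [hint]
    rw [integrable_indicator_iff measurableSet_Ioi]
    have := (integrableOn_Ioi_comp_mul_left_iff (fun s => s * v s) 0 (a := 1 / 2)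
      (by norm_num)).2 (by simpa using hv)
    refine this.congr_fun (fun m _ => ?_) measurableSet_Ioi
    simp only
    rw [show 1 / 2 * m = m / 2 by ring]

/-! ### Hilbert–Schmidt kernels on `Ω` -/

/-- A continuous kernel which is square integrable on `Ω`. -/
structure HS (k : ℝ → ℝ → ℝ) : Prop where
  cont : Continuous fun p : ℝ × ℝ => k p.1 p.2
  sq : IntegrableOn (fun p : ℝ × ℝ => k p.1 p.2 ^ 2) Omega

/-- `(Up k g)(a) = ∫_a^∞ k(a,b) g(b) db`. -/
def Up (k : ℝ → ℝ → ℝ) (g : ℝ → ℝ) (a : ℝ) : ℝ := ∫ b in Ioi a, k a b * g b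

/-- `(Lo k φ)(b) = ∫_0^b k(a,b) φ(a) da`. -/
def Lo (k : ℝ → ℝ → ℝ) (φ : ℝ → ℝ) (b : ℝ) : ℝ := ∫ a in (0 : ℝ)..b, k a b * φ a

/-- `∫_Ω k²`. -/
def hsq (k : ℝ → ℝ → ℝ) : ℝ := ∫ p in Omega, k p.1 p.2 ^ 2

namespace HS

variable {k : ℝ → ℝ → ℝ} {φ g : ℝ → ℝ}

theorem hsq_nonneg (k : ℝ → ℝ → ℝ) : 0 ≤ hsq k := integral_nonneg fun _ => sq_nonneg _

theorem memLp (hk : HS k) : MemLp (Omega.indicator fun p : ℝ × ℝ => k p.1 p.2) 2 := by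
  rw [memLp_indicator_iff_restrict measurableSet_Omega,
    memLp_two_iff_integrable_sq hk.cont.aestronglyMeasurable]
  exact hk.sq

theorem integral_memLp_sq (k : ℝ → ℝ → ℝ) :
    ∫ p, (Omega.indicator (fun p : ℝ × ℝ => k p.1 p.2) p) ^ 2 = hsq k := by
  rw [hsq, ← integral_indicator measurableSet_Omega]
  refine integral_congr_ae (Eventually.of_forall fun p => ?_)
  by_cases hp : p ∈ Omega <;> simp [indicator, hp]

theorem integrableOn (hk : HS k) (hφ : MemLp φ 2) (hg : MemLp g 2) :
    IntegrableOn (fun p : ℝ × ℝ => φ p.1 * k p.1 p.2 * g p.2) Omega := by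
  have h := hk.memLp.integrable_mul (memLp_tensor hφ hg)
  rw [← integrable_indicator_iff measurableSet_Omega]
  refine h.congr (Eventually.of_forall fun p => ?_)
  by_cases hp : p ∈ Omega
  · simp [indicator, hp]; ring
  · simp [indicator, hp]

theorem integral_Up (hk : HS k) (hφ : MemLp φ 2) (hg : MemLp g 2) :
    ∫ a in Ioi 0, φ a * Up k g a = ∫ p in Omega, φ p.1 * k p.1 p.2 * g p.2 := by
  rw [integral_Omega_fst (hk.integrableOn hφ hg)]
  refine setIntegral_congr_fun measurableSet_Ioi fun a _ => ?_
  simp only [Up, mul_assoc, integral_const_mul]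

theorem integral_Lo (hk : HS k) (hφ : MemLp φ 2) (hg : MemLp g 2) :
    ∫ b in Ioi 0, Lo k φ b * g b = ∫ p in Omega, φ p.1 * k p.1 p.2 * g p.2 := by
  rw [integral_Omega_snd (hk.integrableOn hφ hg)]
  refine setIntegral_congr_fun measurableSet_Ioi fun b _ => ?_
  simp only [Lo, ← intervalIntegral.integral_mul_const]
  refine intervalIntegral.integral_congr fun a _ => ?_
  ring

/-- The Hilbert–Schmidt estimate, by Cauchy–Schwarz in the inner variable. Extending the kernel by
zero outside `Ω` makes this an integral over the whole line, so that measurability and Fubini's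
theorem come from the product space. -/
theorem Up_bound (hk : HS k) (hg : MemLp g 2) :
    MemLp (Up k g) 2 (volume.restrict (Ioi 0)) ∧
    ∫ a in Ioi 0, Up k g a ^ 2 ≤ hsq k * ∫ b, g b ^ 2 := by
  set κ := Omega.indicator fun p : ℝ × ℝ => k p.1 p.2 with hκ
  set U : ℝ → ℝ := fun a => ∫ b, κ (a, b) * g b with hU
  have hUeq : ∀ a ∈ Ioi (0 : ℝ), U a = Up k g a := by
    intro a ha
    rw [hU, Up, ← integral_indicator measurableSet_Ioi]
    refine integral_congr_ae (Eventually.of_forall fun b => ?_)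
    have ha' : 0 < a := ha
    by_cases hb : a < b <;> simp [hκ, indicator, Omega, ha', hb]
  have hm : AEStronglyMeasurable U volume :=
    AEStronglyMeasurable.integral_prod_right' (f := fun p : ℝ × ℝ => κ p * g p.2)
      (hk.memLp.1.mul hg.1.comp_snd)
  have hsqi : Integrable (fun p : ℝ × ℝ => κ p ^ 2) (volume.prod volume) := hk.memLp.integrable_sq
  have hle : ∀ᵐ a, U a ^ 2 ≤ (∫ b, κ (a, b) ^ 2) * ∫ b, g b ^ 2 := by
    filter_upwards [hsqi.prod_right_ae, hk.memLp.1.prodMk_left] with a h1 h2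
    exact sq_integral_mul_le ((memLp_two_iff_integrable_sq h2).2 h1) hg
  have hi2 : Integrable fun a => (∫ b, κ (a, b) ^ 2) * ∫ b, g b ^ 2 :=
    hsqi.integral_prod_left.mul_const _
  have hi : Integrable fun a => U a ^ 2 := by
    refine hi2.mono' (hm.pow 2) ?_
    filter_upwards [hle] with a ha
    rwa [Real.norm_eq_abs, abs_of_nonneg (sq_nonneg _)]
  have hUm : MemLp U 2 := (memLp_two_iff_integrable_sq hm).2 hi
  constructor
  · refine (hUm.restrict (Ioi 0)).ae_eq ?_
    filter_upwards [ae_restrict_mem measurableSet_Ioi] with a ha using hUeq a ha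
  · calc ∫ a in Ioi 0, Up k g a ^ 2 = ∫ a in Ioi 0, U a ^ 2 :=
        setIntegral_congr_fun measurableSet_Ioi fun a ha => by simp only [hUeq a ha]
      _ ≤ ∫ a, U a ^ 2 := setIntegral_le_integral hi (Eventually.of_forall fun _ => sq_nonneg _)
      _ ≤ ∫ a, (∫ b, κ (a, b) ^ 2) * ∫ b, g b ^ 2 := integral_mono_ae hi hi2 hle
      _ = _ := by
        rw [integral_mul_const, ← integral_memLp_sq, Measure.volume_eq_prod, integral_prod _ hsqi]

theorem Lo_bound (hk : HS k) (hg : MemLp φ 2) :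
    MemLp (Lo k φ) 2 (volume.restrict (Ioi 0)) ∧
    ∫ b in Ioi 0, Lo k φ b ^ 2 ≤ hsq k * ∫ a, φ a ^ 2 := by
  set κ := Omega.indicator fun p : ℝ × ℝ => k p.1 p.2 with hκ
  set U : ℝ → ℝ := fun b => ∫ a, κ (a, b) * φ a with hU
  have hUeq : ∀ b ∈ Ioi (0 : ℝ), U b = Lo k φ b := by
    intro b hb
    rw [hU, Lo, intervalIntegral.integral_of_le (le_of_lt hb), integral_Ioc_eq_integral_Ioo,
      ← integral_indicator measurableSet_Ioo]
    refine integral_congr_ae (Eventually.of_forall fun a => ?_)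
    by_cases ha : 0 < a <;> by_cases hab : a < b <;> simp [hκ, indicator, Omega, ha, hab]
  have hm : AEStronglyMeasurable U volume :=
    AEStronglyMeasurable.integral_prod_right' (f := fun p : ℝ × ℝ => κ p.swap * φ p.2)
      ((hk.memLp.1.comp_measurePreserving Measure.measurePreserving_swap).mul hg.1.comp_snd)
  have hsqi : Integrable (fun p : ℝ × ℝ => κ p ^ 2) (volume.prod volume) := hk.memLp.integrable_sq
  have hmem2 : AEStronglyMeasurable (fun p : ℝ × ℝ => κ p.swap) (volume.prod volume) :=
    hk.memLp.1.comp_measurePreserving Measure.measurePreserving_swap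
  have hle : ∀ᵐ b, U b ^ 2 ≤ (∫ a, κ (a, b) ^ 2) * ∫ a, φ a ^ 2 := by
    filter_upwards [hsqi.prod_left_ae, hmem2.prodMk_left] with b h1 h2
    exact sq_integral_mul_le ((memLp_two_iff_integrable_sq h2).2 h1) hg
  have hi2 : Integrable fun b => (∫ a, κ (a, b) ^ 2) * ∫ a, φ a ^ 2 :=
    hsqi.integral_prod_right.mul_const _
  have hi : Integrable fun a => U a ^ 2 := by
    refine hi2.mono' (hm.pow 2) ?_
    filter_upwards [hle] with a ha
    rwa [Real.norm_eq_abs, abs_of_nonneg (sq_nonneg _)]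
  have hUm : MemLp U 2 := (memLp_two_iff_integrable_sq hm).2 hi
  constructor
  · refine (hUm.restrict (Ioi 0)).ae_eq ?_
    filter_upwards [ae_restrict_mem measurableSet_Ioi] with a ha using hUeq a ha
  · calc ∫ a in Ioi 0, Lo k φ a ^ 2 = ∫ a in Ioi 0, U a ^ 2 :=
        setIntegral_congr_fun measurableSet_Ioi fun a ha => by simp only [hUeq a ha]
      _ ≤ ∫ a, U a ^ 2 := setIntegral_le_integral hi (Eventually.of_forall fun _ => sq_nonneg _)
      _ ≤ ∫ b, (∫ a, κ (a, b) ^ 2) * ∫ b, φ b ^ 2 := integral_mono_ae hi hi2 hle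
      _ = _ := by
        rw [integral_mul_const, ← integral_memLp_sq, Measure.volume_eq_prod,
          integral_prod_symm _ hsqi]

/-- By `integrableOn_Omega_of_mean` it suffices that `s (A |r| + B σ₀)²` be integrable. The square
of `r` is controlled by boundedness and the moment, that of `σ₀` by `s σ₀(s) ≤ R` and integrability
of `σ₀`. -/
theorem of_bound {r : ℝ → ℝ} (hr : Pot r) (hc : Continuous fun p : ℝ × ℝ => k p.1 p.2) {A B : ℝ}
    (hb : ∀ a b, 0 ≤ a → a ≤ b → |k a b| ≤ A * |r ((a + b) / 2)| + B * sigma0 r ((a + b) / 2)) :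
    HS k := by
  refine ⟨hc, ?_⟩
  have hcs := hr.sigma0_continuous
  have hcr := hr.continuous
  have h1 : IntegrableOn (fun s => s * (A * |r s| + B * sigma0 r s) ^ 2) (Ioi 0) := by
    obtain ⟨C, hC⟩ := hr.bounded
    refine Integrable.mono' (((hr.moment.const_mul (2 * A ^ 2 * C)).add
      (hr.sigma0_integrableOn.const_mul (2 * B ^ 2 * R r))))
      (Continuous.aestronglyMeasurable (by fun_prop)) ?_
    filter_upwards [ae_restrict_mem measurableSet_Ioi] with s hs
    have hs0 : (0 : ℝ) < s := hs
    have h2 := hr.mul_sigma0_le_R hs0.le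
    have h3 := Pot.sigma0_nonneg r s
    have h4 := hC s
    have h5 := abs_nonneg (r s)
    rw [Real.norm_eq_abs, abs_of_nonneg (by positivity)]
    simp only [Pi.add_apply]
    calc s * (A * |r s| + B * sigma0 r s) ^ 2
        ≤ s * (2 * (A * |r s|) ^ 2 + 2 * (B * sigma0 r s) ^ 2) := by
          refine mul_le_mul_of_nonneg_left ?_ hs0.le
          nlinarith [sq_nonneg (A * |r s| - B * sigma0 r s)]
      _ = 2 * A ^ 2 * (|r s| * (s * |r s|)) + 2 * B ^ 2 * ((s * sigma0 r s) * sigma0 r s) := by ring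
      _ ≤ 2 * A ^ 2 * (C * (s * |r s|)) + 2 * B ^ 2 * (R r * sigma0 r s) := by
          gcongr
      _ = _ := by ring
  have h2 := integrableOn_Omega_of_mean (v := fun s => (A * |r s| + B * sigma0 r s) ^ 2)
    (by fun_prop) (fun s => sq_nonneg _) h1
  refine Integrable.mono' h2 (hc.pow 2).aestronglyMeasurable ?_
  filter_upwards [ae_restrict_mem measurableSet_Omega] with p hp
  rw [Real.norm_eq_abs, abs_of_nonneg (sq_nonneg _)]
  exact sq_le_sq.2 ((hb p.1 p.2 hp.1.le hp.2.le).trans (le_abs_self _))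

end HS

theorem IsPrim.integral_Ioi {f h : ℝ → ℝ} (H : IsPrim f h) (hh : IntegrableOn h (Ioi 0))
    (ht : Tendsto f atTop (𝓝 0)) : ∫ x in Ioi 0, h x = -f 0 := by
  have := tendsto_nhds_unique (H.tendsto_atTop hh) ht
  linarith

theorem LineH1.abs_le {f h : ℝ → ℝ} (L : LineH1 f h) : ∃ C, 0 ≤ C ∧ ∀ x, |f x| ≤ C :=
  ⟨_, Real.sqrt_nonneg _, L.abs_le_sqrt_energy⟩

namespace IsKernel

variable {r : ℝ → ℝ} {K : ℝ → ℝ → ℝ} {g h φ ψ : ℝ → ℝ}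

theorem hs_Ke (hr : Pot r) (hK : IsKernel r K) : HS (Ke K) :=
  HS.of_bound hr hK.continuous_Ke (A := 0) (B := CK r) fun a b ha hab => by
    simpa using hK.abs_Ke_le' hr ha hab

theorem hs_k1 (hr : Pot r) (hK : IsKernel r K) : HS (k1 r K) :=
  HS.of_bound hr (hK.continuous_k1 hr) fun _ _ ha hab => hK.abs_k1_le hr ha hab

theorem hs_k2 (hr : Pot r) (hK : IsKernel r K) : HS (k2 r K) :=
  HS.of_bound hr (hK.continuous_k2 hr) fun _ _ ha hab => hK.abs_k2_le hr ha hab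

theorem hs_rKe (hr : Pot r) (hK : IsKernel r K) : HS fun a b => r a * Ke K a b := by
  obtain ⟨C, hC⟩ := hr.bounded
  refine HS.of_bound hr ((hr.continuous.comp continuous_fst).mul hK.continuous_Ke) (A := 0)
    (B := C * CK r) fun a b ha hab => ?_
  rw [abs_mul, zero_mul, zero_add, mul_assoc]
  exact mul_le_mul (hC a) (hK.abs_Ke_le' hr ha hab) (abs_nonneg _) ((abs_nonneg _).trans (hC 0))

theorem hs_Bk (hr : Pot r) (hK : IsKernel r K) : HS fun a b => Bk r K a (b - a) := by
  refine HS.of_bound hr ((hK.continuous_Bk hr).comp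
      (by fun_prop : Continuous fun p : ℝ × ℝ => (p.1, p.2 - p.1))) (A := 0)
    (B := CK r * sigma0 r 0) fun a b ha hab => ?_
  have h1 := hK.abs_Bk_le hr ha (sub_nonneg.2 hab)
  have e : a + (b - a) / 2 = (a + b) / 2 := by ring
  rw [e] at h1
  simpa using h1

theorem hs_Ak (hr : Pot r) (hK : IsKernel r K) : HS fun a b => Ak r K a (a + b) :=
  HS.of_bound hr ((hK.continuous_Ak hr).comp
      (by fun_prop : Continuous fun p : ℝ × ℝ => (p.1, p.1 + p.2)))
    fun _ _ ha hab => hK.abs_Ak_le hr ha (by linarith)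

/-! ### The transformation on the half-line -/

/-- `T g = g + ∫_y^∞ K(y,ξ) g(ξ) dξ` for `y ≥ 0`. -/
def T (K : ℝ → ℝ → ℝ) (g : ℝ → ℝ) (y : ℝ) : ℝ := g y + Up (Ke K) g y

/-- The derivative of `T g`. -/
def T' (r : ℝ → ℝ) (K : ℝ → ℝ → ℝ) (g h : ℝ → ℝ) (y : ℝ) : ℝ :=
  h y - Ke K y y * g y + Up (k1 r K) g y

/-- The transposed operator `φ ↦ φ + ∫_0^x K(ξ,x) φ(ξ) dξ` for `x ≥ 0`. -/
def Tt (K : ℝ → ℝ → ℝ) (φ : ℝ → ℝ) (x : ℝ) : ℝ := φ x + Lo (Ke K) φ x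

/-- The derivative of `Tt φ`. -/
def Tt' (r : ℝ → ℝ) (K : ℝ → ℝ → ℝ) (φ ψ : ℝ → ℝ) (x : ℝ) : ℝ :=
  ψ x + Ke K x x * φ x + Lo (k2 r K) φ x

theorem continuous_diag (hK : IsKernel r K) : Continuous fun x => Ke K x x :=
  hK.continuous_Ke.comp (by fun_prop : Continuous fun x : ℝ => (x, x))

theorem memLp_diag_mul (hr : Pot r) (hK : IsKernel r K) (hg : MemLp g 2) :
    MemLp (fun x => Ke K x x * g x) 2 := by
  refine hg.of_le_mul (c := CK r * sigma0 r 0)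
    (hK.continuous_diag.aestronglyMeasurable.mul hg.1) (Eventually.of_forall fun x => ?_)
  rw [norm_mul]
  exact mul_le_mul_of_nonneg_right (hK.abs_Ke_le_const hr _ _) (norm_nonneg _)

theorem memLp_T (hr : Pot r) (hK : IsKernel r K) (hg : MemLp g 2) :
    MemLp (T K g) 2 (volume.restrict (Ioi 0)) :=
  (hg.restrict _).add ((hK.hs_Ke hr).Up_bound hg).1

theorem memLp_T' (hr : Pot r) (hK : IsKernel r K) (hg : MemLp g 2) (hh : MemLp h 2) :
    MemLp (T' r K g h) 2 (volume.restrict (Ioi 0)) :=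
  ((hh.restrict _).sub ((hK.memLp_diag_mul hr hg).restrict _)).add ((hK.hs_k1 hr).Up_bound hg).1

theorem memLp_Tt (hr : Pot r) (hK : IsKernel r K) (hφ : MemLp φ 2) :
    MemLp (Tt K φ) 2 (volume.restrict (Ioi 0)) :=
  (hφ.restrict _).add ((hK.hs_Ke hr).Lo_bound hφ).1

theorem memLp_Tt' (hr : Pot r) (hK : IsKernel r K) (hφ : MemLp φ 2) (hψ : MemLp ψ 2) :
    MemLp (Tt' r K φ ψ) 2 (volume.restrict (Ioi 0)) :=
  ((hψ.restrict _).add ((hK.memLp_diag_mul hr hφ).restrict _)).add ((hK.hs_k2 hr).Lo_bound hφ).1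

theorem integrableOn_slice (hr : Pot r) (hK : IsKernel r K) (L : LineH1 g h) {x : ℝ} (hx : 0 ≤ x) :
    IntegrableOn (fun b => Ke K x b * g b) (Ioi x) := by
  obtain ⟨C, hC0, hC⟩ := L.abs_le
  have h1 : IntegrableOn (fun b => sigma0 r (b / 2)) (Ioi 0) := by
    have := (integrableOn_Ioi_comp_mul_left_iff (sigma0 r) 0 (a := 1 / 2) (by norm_num)).2
      (by simpa using hr.sigma0_integrableOn)
    refine this.congr_fun (fun m _ => ?_) measurableSet_Ioi
    simp only
    rw [show 1 / 2 * m = m / 2 by ring]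
  refine Integrable.mono' ((h1.mono_set (Ioi_subset_Ioi hx)).const_mul (CK r * C))
    ((hK.continuous_slice2 x).mul L.continuous).aestronglyMeasurable ?_
  filter_upwards [ae_restrict_mem measurableSet_Ioi] with b hb
  have hb' : x < b := hb
  rw [norm_mul, Real.norm_eq_abs, Real.norm_eq_abs]
  have h2 := (hK.abs_Ke_le' hr hx hb'.le).trans (mul_le_mul_of_nonneg_left
    (hr.sigma0_anti (by linarith : b / 2 ≤ (x + b) / 2)) (CK_pos r).le)
  calc |Ke K x b| * |g b| ≤ CK r * sigma0 r (b / 2) * C :=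
        mul_le_mul h2 (hC b) (abs_nonneg _) (mul_nonneg (CK_pos r).le (Pot.sigma0_nonneg _ _))
    _ = _ := by ring

theorem memLp_indicator_Ioc (x : ℝ) : MemLp ((Ioc 0 x).indicator fun _ => (1 : ℝ)) 2 :=
  memLp_indicator_const 2 measurableSet_Ioc 1 (Or.inr (by simp))

/-- No differentiation under an integral with a variable limit is needed: `Up (k1 r K) g` is
integrated against the indicator of `(0,x]`, and Fubini puts the integral on the kernel. Its
primitive in the first variable is `K(min(x,b),b) - K(0,b)`; splitting at `b = x` gives the diagonal
term and the two values of `Up (Ke K) g`. -/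
theorem T_prim (hr : Pot r) (hK : IsKernel r K) (L : LineH1 g h) {x : ℝ} (hx : 0 ≤ x) :
    T K g x = T K g 0 + ∫ t in (0 : ℝ)..x, T' r K g h t := by
  set χ : ℝ → ℝ := (Ioc 0 x).indicator fun _ => (1 : ℝ) with hχ
  have hk := hK.hs_k1 hr
  have e1 : ∫ a in (0 : ℝ)..x, Up (k1 r K) g a = ∫ b in Ioi 0, Lo (k1 r K) χ b * g b := by
    rw [hk.integral_Lo (memLp_indicator_Ioc x) L.memLp,
      ← hk.integral_Up (memLp_indicator_Ioc x) L.memLp, intervalIntegral.integral_of_le hx]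
    have : ∀ a, χ a * Up (k1 r K) g a = (Ioc 0 x).indicator (Up (k1 r K) g) a := fun a => by
      by_cases ha : a ∈ Ioc 0 x <;> simp [hχ, ha]
    simp only [← hχ, this]
    rw [setIntegral_indicator measurableSet_Ioc, inter_eq_self_of_subset_right]
    exact fun a ha => ha.1
  have e2 : ∀ b ∈ Ioi (0 : ℝ), Lo (k1 r K) χ b = Ke K (min x b) b - Ke K 0 b := by
    intro b hb
    have hb' : 0 < b := hb
    rw [← hK.integral_k1 hr le_rfl (le_min hx hb'.le) (min_le_right _ _), Lo,
      intervalIntegral.integral_of_le hb'.le, intervalIntegral.integral_of_le (le_min hx hb'.le)]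
    have : ∀ a, k1 r K a b * χ a = (Ioc 0 x).indicator (fun a => k1 r K a b) a := fun a => by
      by_cases ha : a ∈ Ioc 0 x <;> simp [hχ, ha]
    simp only [this]
    rw [setIntegral_indicator measurableSet_Ioc, Ioc_inter_Ioc, max_self, min_comm]
  have i0 := hK.integrableOn_slice hr L le_rfl
  have ix := hK.integrableOn_slice hr L hx
  have id : Continuous fun x => Ke K x x * g x := (hK.continuous_diag.mul L.continuous)
  have hmin : IntegrableOn (fun b => Ke K (min x b) b * g b) (Ioi 0) ∧
      ∫ b in Ioi 0, Ke K (min x b) b * g b =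
        (∫ b in (0 : ℝ)..x, Ke K b b * g b) + ∫ b in Ioi x, Ke K x b * g b := by
    have j1 : IntegrableOn (fun b => Ke K (min x b) b * g b) (Ioc 0 x) :=
      (id.integrableOn_Icc.mono_set Ioc_subset_Icc_self).congr_fun
        (fun b hb => by simp only [min_eq_right hb.2]) measurableSet_Ioc
    have j2 : IntegrableOn (fun b => Ke K (min x b) b * g b) (Ioi x) :=
      ix.congr_fun (fun b hb => by simp only [min_eq_left (le_of_lt (mem_Ioi.1 hb))])
        measurableSet_Ioi
    have hu : Ioc 0 x ∪ Ioi x = Ioi 0 := Ioc_union_Ioi_eq_Ioi hx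
    constructor
    · rw [← hu]; exact j1.union j2
    · rw [← hu, setIntegral_union (Ioc_disjoint_Ioi le_rfl) measurableSet_Ioi j1 j2,
        intervalIntegral.integral_of_le hx]
      congr 1
      · exact setIntegral_congr_fun measurableSet_Ioc fun b hb => by simp only [min_eq_right hb.2]
      · exact setIntegral_congr_fun measurableSet_Ioi fun b hb => by
          simp only [min_eq_left (le_of_lt (mem_Ioi.1 hb))]
  have e3 : ∫ b in Ioi 0, Lo (k1 r K) χ b * g b =
      (∫ b in (0 : ℝ)..x, Ke K b b * g b) + Up (Ke K) g x - Up (Ke K) g 0 := by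
    rw [Up, Up, ← hmin.2, ← integral_sub hmin.1 i0]
    exact setIntegral_congr_fun measurableSet_Ioi fun b hb => by simp only [e2 b hb]; ring
  have hU : IntervalIntegrable (Up (k1 r K) g) volume 0 x := by
    rw [intervalIntegrable_iff_integrableOn_Ioc_of_le hx]
    have := (hk.Up_bound L.memLp).1.mono_measure
      (Measure.restrict_mono (fun a ha => ha.1 : Ioc 0 x ⊆ Ioi 0) le_rfl)
    exact this.integrable (by norm_num)
  have hT : ∫ t in (0 : ℝ)..x, T' r K g h t = (∫ t in (0 : ℝ)..x, h t) -
      (∫ t in (0 : ℝ)..x, Ke K t t * g t) + ∫ t in (0 : ℝ)..x, Up (k1 r K) g t := by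
    simp only [T']
    rw [intervalIntegral.integral_add ((L.loc.intervalIntegrable' _ _).sub
      (id.intervalIntegrable _ _)) hU, intervalIntegral.integral_sub (L.loc.intervalIntegrable' _ _)
      (id.intervalIntegrable _ _)]
  rw [hT, e1, e3, T, T, L.eq x]
  ring

/-- The transposed argument: for `0 < a ≤ x` the integral of `k2` over `b` from `a` to `x` is
`K(a,x) - K(a,a)`, and for `a > x` there is nothing to integrate. -/
theorem Tt_prim (hr : Pot r) (hK : IsKernel r K) (L : LineH1 φ ψ) {x : ℝ} (hx : 0 ≤ x) :
    Tt K φ x = Tt K φ 0 + ∫ t in (0 : ℝ)..x, Tt' r K φ ψ t := by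
  set χ : ℝ → ℝ := (Ioc 0 x).indicator fun _ => (1 : ℝ) with hχ
  have hk := hK.hs_k2 hr
  have e1 : ∫ b in (0 : ℝ)..x, Lo (k2 r K) φ b = ∫ a in Ioi 0, φ a * Up (k2 r K) χ a := by
    rw [hk.integral_Up L.memLp (memLp_indicator_Ioc x),
      ← hk.integral_Lo L.memLp (memLp_indicator_Ioc x), intervalIntegral.integral_of_le hx]
    have : ∀ a, Lo (k2 r K) φ a * χ a = (Ioc 0 x).indicator (Lo (k2 r K) φ) a := fun a => by
      by_cases ha : a ∈ Ioc 0 x <;> simp [hχ, ha]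
    simp only [← hχ, this]
    rw [setIntegral_indicator measurableSet_Ioc, inter_eq_self_of_subset_right]
    exact fun a ha => ha.1
  have e2 : ∀ a ∈ Ioi (0 : ℝ), φ a * Up (k2 r K) χ a =
      (Ioc 0 x).indicator (fun a => φ a * (Ke K a x - Ke K a a)) a := by
    intro a ha
    have ha' : 0 < a := ha
    have : ∀ b, k2 r K a b * χ b = (Ioc 0 x).indicator (fun b => k2 r K a b) b := fun b => by
      by_cases hb : b ∈ Ioc 0 x <;> simp [hχ, hb]
    have hs : Ioi a ∩ Ioc 0 x = Ioc a x := by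
      ext b
      simp only [mem_inter_iff, mem_Ioi, mem_Ioc]
      exact ⟨fun h => ⟨h.1, h.2.2⟩, fun h => ⟨h.1, ha'.trans h.1, h.2⟩⟩
    rw [Up]
    simp only [this]
    rw [setIntegral_indicator measurableSet_Ioc, hs]
    by_cases hax : a ≤ x
    · rw [indicator_of_mem (show a ∈ Ioc 0 x from ⟨ha', hax⟩), ← hK.integral_k2 hr ha' le_rfl hax,
        intervalIntegral.integral_of_le hax]
    · rw [indicator_of_notMem (fun h => hax h.2), Ioc_eq_empty (fun h => hax h.le)]
      simp
  have id : Continuous fun x => Ke K x x * φ x := (hK.continuous_diag.mul L.continuous)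
  have i1 : Continuous fun a => Ke K a x * φ a := (hK.continuous_slice1 x).mul L.continuous
  have e3 : ∫ a in Ioi 0, φ a * Up (k2 r K) χ a =
      Lo (Ke K) φ x - ∫ t in (0 : ℝ)..x, Ke K t t * φ t := by
    rw [setIntegral_congr_fun measurableSet_Ioi e2, setIntegral_indicator measurableSet_Ioc,
      inter_eq_self_of_subset_right (fun a ha => ha.1), ← intervalIntegral.integral_of_le hx, Lo]
    rw [← intervalIntegral.integral_sub (i1.intervalIntegrable _ _) (id.intervalIntegrable _ _)]
    refine intervalIntegral.integral_congr fun a _ => ?_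
    ring
  have hU : IntervalIntegrable (Lo (k2 r K) φ) volume 0 x := by
    rw [intervalIntegrable_iff_integrableOn_Ioc_of_le hx]
    have := (hk.Lo_bound L.memLp).1.mono_measure
      (Measure.restrict_mono (fun a ha => ha.1 : Ioc 0 x ⊆ Ioi 0) le_rfl)
    exact this.integrable (by norm_num)
  have hT : ∫ t in (0 : ℝ)..x, Tt' r K φ ψ t = (∫ t in (0 : ℝ)..x, ψ t) +
      (∫ t in (0 : ℝ)..x, Ke K t t * φ t) + ∫ t in (0 : ℝ)..x, Lo (k2 r K) φ t := by
    simp only [Tt']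
    rw [intervalIntegral.integral_add ((L.loc.intervalIntegrable' _ _).add
      (id.intervalIntegrable _ _)) hU, intervalIntegral.integral_add (L.loc.intervalIntegrable' _ _)
      (id.intervalIntegrable _ _)]
  have h0 : Lo (Ke K) φ 0 = 0 := intervalIntegral.integral_same
  rw [hT, e1, e3, Tt, Tt, L.eq x, h0]
  ring

/-- The even extension of `T g` belongs to `H¹(ℝ)`. -/
theorem lineH1_T (hr : Pot r) (hK : IsKernel r K) (L : LineH1 g h) :
    LineH1 (fun x => T K g |x|) (fun x => SignType.sign x * T' r K g h |x|) :=
  LineH1.of_half (hK.memLp_T hr L.memLp) (hK.memLp_T' hr L.memLp L.memLp_deriv)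
    fun _ hx => hK.T_prim hr L hx

theorem lineH1_Tt (hr : Pot r) (hK : IsKernel r K) (L : LineH1 φ ψ) :
    LineH1 (fun x => Tt K φ |x|) (fun x => SignType.sign x * Tt' r K φ ψ |x|) :=
  LineH1.of_half (hK.memLp_Tt hr L.memLp) (hK.memLp_Tt' hr L.memLp L.memLp_deriv)
    fun _ hx => hK.Tt_prim hr L hx

/-- `T` and `Tt` are transposed to each other. -/
theorem integral_T_mul (hr : Pot r) (hK : IsKernel r K) (hg : MemLp g 2) (hφ : MemLp φ 2) :
    ∫ x in Ioi 0, T K g x * φ x = ∫ x in Ioi 0, g x * Tt K φ x := by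
  have hk := hK.hs_Ke hr
  have i1 : Integrable (fun x => g x * φ x) (volume.restrict (Ioi 0)) :=
    (hg.restrict (Ioi 0)).integrable_mul (hφ.restrict (Ioi 0))
  have i2 : Integrable (fun x => φ x * Up (Ke K) g x) (volume.restrict (Ioi 0)) :=
    (hφ.restrict (Ioi 0)).integrable_mul (hk.Up_bound hg).1
  have i3 : Integrable (fun x => Lo (Ke K) φ x * g x) (volume.restrict (Ioi 0)) :=
    (hk.Lo_bound hφ).1.integrable_mul (hg.restrict (Ioi 0))
  have e1 : ∫ x in Ioi 0, T K g x * φ x =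
      (∫ x in Ioi 0, g x * φ x) + ∫ x in Ioi 0, φ x * Up (Ke K) g x := by
    rw [← integral_add i1 i2]
    exact integral_congr_ae (Eventually.of_forall fun x => by simp only [T]; ring)
  have e2 : ∫ x in Ioi 0, g x * Tt K φ x =
      (∫ x in Ioi 0, g x * φ x) + ∫ x in Ioi 0, Lo (Ke K) φ x * g x := by
    rw [← integral_add i1 i3]
    exact integral_congr_ae (Eventually.of_forall fun x => by simp only [Tt]; ring)
  rw [e1, e2, hk.integral_Up hφ hg, hk.integral_Lo hφ hg]

end IsKernel

/-! ### Integration by parts along the characteristics -/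

theorem integrableOn_comp_half {v : ℝ → ℝ} (hv : IntegrableOn v (Ioi 0)) :
    IntegrableOn (fun m => v (m / 2)) (Ioi 0) := by
  have := (integrableOn_Ioi_comp_mul_left_iff v 0 (a := 1 / 2) (by norm_num)).2 (by simpa using hv)
  refine this.congr_fun (fun m _ => ?_) measurableSet_Ioi
  simp only
  rw [show 1 / 2 * m = m / 2 by ring]

theorem integral_comp_half (v : ℝ → ℝ) : ∫ m in Ioi 0, v (m / 2) = 2 * ∫ x in Ioi 0, v x := by
  have := integral_comp_mul_left_Ioi v 0 (b := 1 / 2) (by norm_num)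
  rw [mul_zero, smul_eq_mul] at this
  rw [show (2 : ℝ) = (1 / 2)⁻¹ by norm_num, ← this]
  refine setIntegral_congr_fun measurableSet_Ioi fun m _ => ?_
  congr 1
  norm_num
  ring

namespace IsKernel

variable {r : ℝ → ℝ} {K : ℝ → ℝ → ℝ} {g h φ ψ : ℝ → ℝ}

theorem bk_prim (hr : Pot r) (hK : IsKernel r K) (c : ℝ) :
    IsPrim (fun a => Bk r K a c) (fun a => -(r a * Ke K a (a + c))) :=
  IsPrim.of_hasDerivAt (hK.continuous_rKe hr c).neg fun a => hK.hasDerivAt_Bk hr a c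

theorem ak_prim (hr : Pot r) (hK : IsKernel r K) (m : ℝ) :
    IsPrim (fun a => Ak r K a m) (fun a => r a * Ke K a (m - a)) :=
  IsPrim.of_hasDerivAt (hK.continuous_rKe_sub hr m) fun a => hK.hasDerivAt_Ak hr a m

theorem abs_Bk_le_const (hr : Pot r) (hK : IsKernel r K) {a c : ℝ} (ha : 0 ≤ a) (hc : 0 ≤ c) :
    |Bk r K a c| ≤ CK r * sigma0 r 0 * sigma0 r 0 :=
  (hK.abs_Bk_le hr ha hc).trans (mul_le_mul_of_nonneg_left
    (hr.sigma0_anti (by positivity)) (MK_nonneg r))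

/-- Integration by parts along the lines `b - a = c`. -/
theorem integral_char (hr : Pot r) (hK : IsKernel r K) (L : LineH1 g h) (M : LineH1 φ ψ) {c : ℝ}
    (hc : 0 < c) :
    ∫ a in Ioi 0, (Bk r K a c * (φ a * h (a + c) + ψ a * g (a + c))
      - r a * Ke K a (a + c) * (φ a * g (a + c))) = -(Bk r K 0 c * (φ 0 * g c)) := by
  have P := (hK.bk_prim hr c).mul (M.toIsPrim.mul (L.toIsPrim.comp_add c))
  have hmp := measurePreserving_add_right (volume : Measure ℝ) c
  have gm : MemLp (fun a => g (a + c)) 2 := L.memLp.comp_measurePreserving hmp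
  have hm : MemLp (fun a => h (a + c)) 2 := L.memLp_deriv.comp_measurePreserving hmp
  obtain ⟨Cg, hCg0, hCg⟩ := L.abs_le
  obtain ⟨Cφ, hCφ0, hCφ⟩ := M.abs_le
  have i1 : Integrable fun a => -(r a * Ke K a (a + c)) * (φ a * g (a + c)) :=
    (hK.integrable_rKe hr c).neg.mul_bdd (c := Cφ * Cg)
      (M.continuous.mul (L.continuous.comp (by fun_prop))).aestronglyMeasurable
      (Eventually.of_forall fun a => by
        rw [norm_mul]
        exact mul_le_mul (hCφ _) (hCg _) (norm_nonneg _) hCφ0)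
  have i2 : Integrable fun a => ψ a * g (a + c) + φ a * h (a + c) :=
    (M.memLp_deriv.integrable_mul gm).add (M.memLp.integrable_mul hm)
  have i3 : IntegrableOn (fun a => Bk r K a c * (ψ a * g (a + c) + φ a * h (a + c))) (Ioi 0) :=
    i2.integrableOn.bdd_mul (c := CK r * sigma0 r 0 * sigma0 r 0)
      ((hK.bk_prim hr c).continuous).aestronglyMeasurable
      (by filter_upwards [ae_restrict_mem measurableSet_Ioi] with a ha
          exact hK.abs_Bk_le_const hr (le_of_lt ha) hc.le)
  have t : Tendsto (fun a => Bk r K a c * (φ a * g (a + c))) atTop (𝓝 0) := by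
    have t1 : Tendsto (fun a => CK r * sigma0 r 0 * sigma0 r 0 * (|φ a| * Cg)) atTop (𝓝 0) := by
      simpa using ((M.tendsto_atTop.abs).mul_const Cg).const_mul (CK r * sigma0 r 0 * sigma0 r 0)
    refine squeeze_zero_norm' ?_ t1
    filter_upwards [Ici_mem_atTop 0] with a ha
    rw [norm_mul, norm_mul]
    exact mul_le_mul (hK.abs_Bk_le_const hr ha hc.le)
      (mul_le_mul_of_nonneg_left (hCg _) (norm_nonneg _)) (by positivity)
      (mul_nonneg (MK_nonneg r) (Pot.sigma0_nonneg _ _))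
  have e := P.integral_Ioi (i1.integrableOn.add i3) t
  rw [zero_add] at e
  rw [← e]
  exact setIntegral_congr_fun measurableSet_Ioi fun a _ => by ring

/-- Integration by parts along the lines `a + b = m`. -/
theorem integral_anti (hr : Pot r) (hK : IsKernel r K) (L : LineH1 g h) (M : LineH1 φ ψ) (m : ℝ) :
    ∫ a in (0 : ℝ)..(m / 2), (Ak r K a m * (φ a * h (m - a) - ψ a * g (m - a))
      - r a * Ke K a (m - a) * (φ a * g (m - a))) =
    1 / 2 * (r (m / 2) * (φ (m / 2) * g (m / 2))) + φ 0 * (Ak r K 0 m * g m) := by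
  have P := (hK.ak_prim hr m).mul (M.toIsPrim.mul (L.toIsPrim.const_sub_comp m))
  have e := P.sub_eq 0 (m / 2)
  have h0 : Ak r K (m / 2) m = -(1 / 2) * r (m / 2) := by simp [Ak]
  rw [h0, sub_zero, show m - m / 2 = m / 2 by ring] at e
  calc _ = -∫ t in (0 : ℝ)..(m / 2), (r t * Ke K t (m - t) * (φ t * g (m - t)) +
        Ak r K t m * (ψ t * g (m - t) + φ t * -h (m - t))) := by
        rw [← intervalIntegral.integral_neg]
        exact intervalIntegral.integral_congr fun a _ => by ring
    _ = _ := by rw [← e]; ring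

theorem integrableOn_Bk_mul (hr : Pot r) (hK : IsKernel r K) (L : LineH1 g h) :
    IntegrableOn (fun c => Bk r K 0 c * g c) (Ioi 0) := by
  obtain ⟨C, hC0, hC⟩ := L.abs_le
  refine Integrable.mono' (((integrableOn_comp_half hr.sigma0_integrableOn).const_mul
      (CK r * sigma0 r 0)).mul_const C)
    (((hK.continuous_Bk hr).comp (by fun_prop : Continuous fun c : ℝ => ((0 : ℝ), c))).mul
      L.continuous).aestronglyMeasurable ?_
  filter_upwards [ae_restrict_mem measurableSet_Ioi] with c hc
  rw [norm_mul]
  have := hK.abs_Bk_le hr le_rfl (le_of_lt hc)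
  rw [zero_add] at this
  exact mul_le_mul this (hC c) (norm_nonneg _) (mul_nonneg (MK_nonneg r) (Pot.sigma0_nonneg _ _))

theorem integrableOn_Ak_mul (hr : Pot r) (hK : IsKernel r K) (L : LineH1 g h) :
    IntegrableOn (fun m => Ak r K 0 m * g m) (Ioi 0) := by
  obtain ⟨C, hC0, hC⟩ := L.abs_le
  refine Integrable.mono' (((integrableOn_comp_half
      ((hr.integrableOn.abs.const_mul (1 / 2)).add
        (hr.sigma0_integrableOn.const_mul (CK r * sigma0 r 0))))).mul_const C)
    (((hK.continuous_Ak hr).comp (by fun_prop : Continuous fun c : ℝ => ((0 : ℝ), c))).mul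
      L.continuous).aestronglyMeasurable ?_
  filter_upwards [ae_restrict_mem measurableSet_Ioi] with m hm
  rw [norm_mul]
  have hm' : (0 : ℝ) < m := hm
  have := hK.abs_Ak_le hr (le_refl 0) (by linarith : 0 ≤ m / 2)
  exact mul_le_mul this (hC m) (norm_nonneg _) ((abs_nonneg _).trans this)

/-- Along `b - a = c` the combination `φ h + ψ g` is the derivative of `φ(a) g(b)`, and `Bk` has
derivative `-r K`. The boundary contributes only at `a = 0`, since the diagonal is itself the line
`c = 0`. -/
theorem integral_Bk_mul (hr : Pot r) (hK : IsKernel r K) (L : LineH1 g h) (M : LineH1 φ ψ) :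
    ∫ p in Omega, (Bk r K p.1 (p.2 - p.1) * (φ p.1 * h p.2 + ψ p.1 * g p.2)) =
      (∫ p in Omega, φ p.1 * (r p.1 * Ke K p.1 p.2) * g p.2)
        - φ 0 * ∫ c in Ioi 0, Bk r K 0 c * g c := by
  have i1 := (hK.hs_Bk hr).integrableOn M.memLp L.memLp_deriv
  have i2 := (hK.hs_Bk hr).integrableOn M.memLp_deriv L.memLp
  have i3 := (hK.hs_rKe hr).integrableOn M.memLp L.memLp
  have i4 : IntegrableOn (fun p : ℝ × ℝ =>
      Bk r K p.1 (p.2 - p.1) * (φ p.1 * h p.2 + ψ p.1 * g p.2)) Omega :=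
    (i1.add i2).congr_fun (fun p _ => by simp only [Pi.add_apply]; ring) measurableSet_Omega
  have e := integral_Omega_char (i4.sub i3)
  simp only [Pi.sub_apply] at e
  rw [integral_sub i4 i3] at e
  have e2 : ∫ c in Ioi 0, ∫ a in Ioi 0, (Bk r K a (a + c - a) * (φ a * h (a + c) + ψ a * g (a + c))
      - φ a * (r a * Ke K a (a + c)) * g (a + c)) = -(φ 0 * ∫ c in Ioi 0, Bk r K 0 c * g c) := by
    rw [← integral_const_mul, ← integral_neg]
    refine setIntegral_congr_fun measurableSet_Ioi fun c hc => ?_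
    rw [show φ 0 * (Bk r K 0 c * g c) = Bk r K 0 c * (φ 0 * g c) by ring,
      ← hK.integral_char hr L M hc]
    refine setIntegral_congr_fun measurableSet_Ioi fun a _ => ?_
    simp only [add_sub_cancel_left]
    ring
  linarith

/-- Along `a + b = m` the combination `φ h - ψ g` is minus the derivative of `φ(a) g(b)`. Here both
ends contribute: `a = 0` gives a trace term, and the diagonal end, where `Ak = -½ r`, gives `∫ r φ
g` after the substitution `m = 2x`. -/
theorem integral_Ak_mul (hr : Pot r) (hK : IsKernel r K) (L : LineH1 g h) (M : LineH1 φ ψ) :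
    ∫ p in Omega, (Ak r K p.1 (p.1 + p.2) * (φ p.1 * h p.2 - ψ p.1 * g p.2)) =
      (∫ p in Omega, φ p.1 * (r p.1 * Ke K p.1 p.2) * g p.2)
        + (∫ x in Ioi 0, r x * (φ x * g x)) + φ 0 * ∫ m in Ioi 0, Ak r K 0 m * g m := by
  have i1 := (hK.hs_Ak hr).integrableOn M.memLp L.memLp_deriv
  have i2 := (hK.hs_Ak hr).integrableOn M.memLp_deriv L.memLp
  have i3 := (hK.hs_rKe hr).integrableOn M.memLp L.memLp
  have i4 : IntegrableOn (fun p : ℝ × ℝ =>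
      Ak r K p.1 (p.1 + p.2) * (φ p.1 * h p.2 - ψ p.1 * g p.2)) Omega :=
    (i1.sub i2).congr_fun (fun p _ => by simp only [Pi.sub_apply]; ring) measurableSet_Omega
  have e := integral_Omega_anti (i4.sub i3)
  simp only [Pi.sub_apply] at e
  rw [integral_sub i4 i3] at e
  obtain ⟨C, hC⟩ := hr.bounded
  have i5 : Integrable fun x => r x * (φ x * g x) :=
    (M.memLp.integrable_mul L.memLp).bdd_mul hr.continuous.aestronglyMeasurable
      (Eventually.of_forall hC)
  have i6 := integrableOn_comp_half (i5.integrableOn (s := Ioi 0))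
  have e2 : ∫ m in Ioi 0, ∫ a in (0 : ℝ)..(m / 2),
      (Ak r K a (a + (m - a)) * (φ a * h (m - a) - ψ a * g (m - a))
        - φ a * (r a * Ke K a (m - a)) * g (m - a)) =
      (∫ x in Ioi 0, r x * (φ x * g x)) + φ 0 * ∫ m in Ioi 0, Ak r K 0 m * g m := by
    have e3 : ∫ x in Ioi 0, r x * (φ x * g x) =
        ∫ m in Ioi 0, 1 / 2 * (r (m / 2) * (φ (m / 2) * g (m / 2))) := by
      rw [integral_const_mul, integral_comp_half fun x => r x * (φ x * g x)]; ring
    rw [e3, ← integral_const_mul, ← integral_add (i6.const_mul _)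
      ((hK.integrableOn_Ak_mul hr L).const_mul _)]
    refine setIntegral_congr_fun measurableSet_Ioi fun m _ => ?_
    rw [← hK.integral_anti hr L M m]
    refine intervalIntegral.integral_congr fun a _ => ?_
    simp only [add_sub_cancel]
    ring
  linarith

theorem integral_diag (hr : Pot r) (hK : IsKernel r K) (L : LineH1 g h) (M : LineH1 φ ψ) :
    ∫ x in Ioi 0, Ke K x x * (φ x * h x + ψ x * g x) =
      1 / 2 * (∫ x in Ioi 0, r x * (φ x * g x)) - 1 / 2 * (φ 0 * g 0) * ∫ x in Ioi 0, r x := by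
  -- The diagonal value of `K` is prescribed only for positive arguments. The function `κ` is an
  -- explicit primitive of `-½ r` which agrees with it there and has the required value at the
  -- origin.
  obtain ⟨κ, hκ, hκe, hκ0⟩ : ∃ κ, IsPrim κ (fun x => -(1 / 2) * r x) ∧
      (∀ x, 0 < x → κ x = Ke K x x) ∧ κ 0 = 1 / 2 * ∫ ξ in Ioi 0, r ξ := by
    refine ⟨fun x => 1 / 2 * ((∫ ξ in Ioi 0, r ξ) - ∫ t in (0 : ℝ)..x, r t),
      IsPrim.of_hasDerivAt (continuous_const.mul hr.continuous) fun x => ?_, fun x hx => ?_, by simp⟩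
    · exact ((((hr.continuous.integral_hasStrictDerivAt 0 x).hasDerivAt).const_sub
        (∫ ξ in Ioi 0, r ξ)).const_mul (1 / 2)).congr_deriv (by ring)
    · simp only
      rw [hK.Ke_diag hx, ← intervalIntegral.integral_Ioi_sub_Ioi hr.integrableOn hx.le]
      ring
  obtain ⟨C, hC⟩ := hr.bounded
  have i5 : Integrable fun x => r x * (φ x * g x) :=
    (M.memLp.integrable_mul L.memLp).bdd_mul hr.continuous.aestronglyMeasurable
      (Eventually.of_forall hC)
  have i2 : Integrable fun a => ψ a * g a + φ a * h a :=
    (M.memLp_deriv.integrable_mul L.memLp).add (M.memLp.integrable_mul L.memLp_deriv)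
  have i3 : IntegrableOn (fun a => κ a * (ψ a * g a + φ a * h a)) (Ioi 0) :=
    i2.integrableOn.bdd_mul (c := CK r * sigma0 r 0) hκ.continuous.aestronglyMeasurable
      (by filter_upwards [ae_restrict_mem measurableSet_Ioi] with a ha
          rw [hκe a ha]
          exact hK.abs_Ke_le_const hr _ _)
  have i4 : IntegrableOn (fun x => -(1 / 2) * r x * (φ x * g x)) (Ioi 0) :=
    (i5.const_mul (-(1 / 2))).integrableOn.congr_fun (fun x _ => by ring) measurableSet_Ioi
  have P := hκ.mul (M.toIsPrim.mul L.toIsPrim)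
  have t : Tendsto (fun x => κ x * (φ x * g x)) atTop (𝓝 0) := by
    have t1 : Tendsto (fun a => CK r * sigma0 r 0 * (|φ a| * |g a|)) atTop (𝓝 0) := by
      simpa using ((M.tendsto_atTop.abs).mul L.tendsto_atTop.abs).const_mul (CK r * sigma0 r 0)
    refine squeeze_zero_norm' ?_ t1
    filter_upwards [Ioi_mem_atTop 0] with a ha
    rw [norm_mul, norm_mul, hκe a ha]
    exact mul_le_mul_of_nonneg_right (hK.abs_Ke_le_const hr _ _) (by positivity)
  have e := P.integral_Ioi (i4.add i3) t
  rw [integral_add i4 i3] at e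
  have e1 : ∫ x in Ioi 0, -(1 / 2) * r x * (φ x * g x) =
      -(1 / 2) * ∫ x in Ioi 0, r x * (φ x * g x) := by
    rw [← integral_const_mul]; exact setIntegral_congr_fun measurableSet_Ioi fun x _ => by ring
  have e2 : ∫ x in Ioi 0, Ke K x x * (φ x * h x + ψ x * g x) =
      ∫ a in Ioi 0, κ a * (ψ a * g a + φ a * h a) :=
    setIntegral_congr_fun measurableSet_Ioi fun x hx => by
      rw [hκe x hx]; ring
  rw [e1, hκ0] at e
  rw [e2]
  linarith

/-- The transformation intertwines the two Dirichlet forms, up to a boundary term. -/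
theorem integral_deriv_T (hr : Pot r) (hK : IsKernel r K) (L : LineH1 g h) (M : LineH1 φ ψ) :
    ∫ x in Ioi 0, h x * Tt' r K φ ψ x =
      (∫ x in Ioi 0, T' r K g h x * ψ x) + (∫ x in Ioi 0, r x * T K g x * φ x) +
        φ 0 * (Up (k1 r K) g 0 - 1 / 2 * g 0 * ∫ x in Ioi 0, r x) := by
  obtain ⟨C, hC⟩ := hr.bounded
  have mφ := M.memLp.restrict (Ioi 0)
  have mψ := M.memLp_deriv.restrict (Ioi 0)
  have mg := L.memLp.restrict (Ioi 0)
  have mh := L.memLp_deriv.restrict (Ioi 0)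
  have mκφ := (hK.memLp_diag_mul hr M.memLp).restrict (Ioi 0)
  have mκg := (hK.memLp_diag_mul hr L.memLp).restrict (Ioi 0)
  have mL := ((hK.hs_k2 hr).Lo_bound M.memLp).1
  have mU := ((hK.hs_k1 hr).Up_bound L.memLp).1
  have mU0 := ((hK.hs_rKe hr).Up_bound L.memLp).1
  have j1 : IntegrableOn (fun x => h x * ψ x) (Ioi 0) := mh.integrable_mul mψ
  have j2 : IntegrableOn (fun x => Ke K x x * φ x * h x) (Ioi 0) := mκφ.integrable_mul mh
  have j3 : IntegrableOn (fun x => Lo (k2 r K) φ x * h x) (Ioi 0) := mL.integrable_mul mh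
  have j4 : IntegrableOn (fun x => Ke K x x * g x * ψ x) (Ioi 0) := mκg.integrable_mul mψ
  have j5 : IntegrableOn (fun x => ψ x * Up (k1 r K) g x) (Ioi 0) := mψ.integrable_mul mU
  have j6 : Integrable fun x => r x * (φ x * g x) :=
    (M.memLp.integrable_mul L.memLp).bdd_mul hr.continuous.aestronglyMeasurable
      (Eventually.of_forall hC)
  have j7 : IntegrableOn (fun x => φ x * Up (fun a b => r a * Ke K a b) g x) (Ioi 0) :=
    mφ.integrable_mul mU0
  have e1 : ∫ x in Ioi 0, h x * Tt' r K φ ψ x = (∫ x in Ioi 0, h x * ψ x) +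
      (∫ x in Ioi 0, Ke K x x * φ x * h x) + ∫ x in Ioi 0, Lo (k2 r K) φ x * h x := by
    rw [← integral_add j1 j2, ← integral_add (f := fun x => h x * ψ x + Ke K x x * φ x * h x) (j1.add j2) j3]
    exact setIntegral_congr_fun measurableSet_Ioi fun x _ => by
      simp only [Tt']; ring
  have e2 : ∫ x in Ioi 0, T' r K g h x * ψ x = (∫ x in Ioi 0, h x * ψ x) -
      (∫ x in Ioi 0, Ke K x x * g x * ψ x) + ∫ x in Ioi 0, ψ x * Up (k1 r K) g x := by
    rw [← integral_sub j1 j4, ← integral_add (f := fun x => h x * ψ x - Ke K x x * g x * ψ x) (j1.sub j4) j5]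
    exact setIntegral_congr_fun measurableSet_Ioi fun x _ => by
      simp only [T']; ring
  have e3 : ∫ x in Ioi 0, r x * T K g x * φ x = (∫ x in Ioi 0, r x * (φ x * g x)) +
      ∫ x in Ioi 0, φ x * Up (fun a b => r a * Ke K a b) g x := by
    rw [← integral_add j6.integrableOn j7]
    refine setIntegral_congr_fun measurableSet_Ioi fun x _ => ?_
    simp only [T, Up, mul_assoc, integral_const_mul]; ring
  rw [(hK.hs_k2 hr).integral_Lo M.memLp L.memLp_deriv] at e1
  rw [(hK.hs_k1 hr).integral_Up M.memLp_deriv L.memLp] at e2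
  rw [(hK.hs_rKe hr).integral_Up M.memLp L.memLp] at e3
  have e4 : ∫ x in Ioi 0, Ke K x x * (φ x * h x + ψ x * g x) =
      (∫ x in Ioi 0, Ke K x x * φ x * h x) + ∫ x in Ioi 0, Ke K x x * g x * ψ x := by
    rw [← integral_add j2 j4]
    exact setIntegral_congr_fun measurableSet_Ioi fun x _ => by ring
  have e5 := hK.integral_diag hr L M
  have iA1 := (hK.hs_Ak hr).integrableOn M.memLp L.memLp_deriv
  have iA2 := (hK.hs_Ak hr).integrableOn M.memLp_deriv L.memLp
  have iB1 := (hK.hs_Bk hr).integrableOn M.memLp L.memLp_deriv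
  have iB2 := (hK.hs_Bk hr).integrableOn M.memLp_deriv L.memLp
  -- As `k2 = (A + B)/2` and `k1 = (A - B)/2`, the difference of the two double integrals separates
  -- into an `A`-part containing `φ h - ψ g` and a `B`-part containing `φ h + ψ g`. Each is
  -- integrable by parts along its own family of characteristics.
  have e6 : (∫ p in Omega, φ p.1 * k2 r K p.1 p.2 * h p.2) -
      (∫ p in Omega, ψ p.1 * k1 r K p.1 p.2 * g p.2) =
      1 / 2 * (∫ p in Omega, (Ak r K p.1 (p.1 + p.2) * (φ p.1 * h p.2 - ψ p.1 * g p.2))) +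
      1 / 2 * ∫ p in Omega, (Bk r K p.1 (p.2 - p.1) * (φ p.1 * h p.2 + ψ p.1 * g p.2)) := by
    have iA : IntegrableOn (fun p : ℝ × ℝ =>
        Ak r K p.1 (p.1 + p.2) * (φ p.1 * h p.2 - ψ p.1 * g p.2)) Omega :=
      (iA1.sub iA2).congr_fun (fun p _ => by simp only [Pi.sub_apply]; ring) measurableSet_Omega
    have iB : IntegrableOn (fun p : ℝ × ℝ =>
        Bk r K p.1 (p.2 - p.1) * (φ p.1 * h p.2 + ψ p.1 * g p.2)) Omega :=
      (iB1.add iB2).congr_fun (fun p _ => by simp only [Pi.add_apply]; ring) measurableSet_Omega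
    rw [← integral_sub ((hK.hs_k2 hr).integrableOn M.memLp L.memLp_deriv)
        ((hK.hs_k1 hr).integrableOn M.memLp_deriv L.memLp),
      ← integral_const_mul, ← integral_const_mul,
      ← integral_add (iA.const_mul _) (iB.const_mul _)]
    exact setIntegral_congr_fun measurableSet_Omega fun p _ => by simp only [k1, k2]; ring
  rw [hK.integral_Ak_mul hr L M, hK.integral_Bk_mul hr L M] at e6
  have e7 : Up (k1 r K) g 0 = 1 / 2 * (∫ m in Ioi 0, Ak r K 0 m * g m) -
      1 / 2 * ∫ c in Ioi 0, Bk r K 0 c * g c := by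
    rw [← integral_const_mul, ← integral_const_mul, ← integral_sub
      ((hK.integrableOn_Ak_mul hr L).const_mul _) ((hK.integrableOn_Bk_mul hr L).const_mul _), Up]
    exact setIntegral_congr_fun measurableSet_Ioi fun c _ => by
      simp only [k1, zero_add, sub_zero]; ring
  rw [e1, e2, e3, e7]
  rw [e4] at e5
  linear_combination e5 + e6

end IsKernel

/-! ### Even and odd parts, and the norm of the transformation on `H¹` -/

open AbsolutelyContinuousOnInterval in
theorem AbsolutelyContinuousOnInterval.of_dist_le {X Y V : Type*} [PseudoMetricSpace X]
    [PseudoMetricSpace Y] [PseudoMetricSpace V] {f : ℝ → X} {g : ℝ → Y} {J : ℝ → V} {a b : ℝ}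
    (hf : AbsolutelyContinuousOnInterval f a b) (hg : AbsolutelyContinuousOnInterval g a b) {C : ℝ}
    (h : ∀ x ∈ uIcc a b, ∀ y ∈ uIcc a b,
      dist (J x) (J y) ≤ C * (dist (f x) (f y) + dist (g x) (g y))) :
    AbsolutelyContinuousOnInterval J a b := by
  unfold AbsolutelyContinuousOnInterval at hf hg ⊢
  have t := (hf.add hg).const_mul C
  rw [add_zero, mul_zero] at t
  refine squeeze_zero' (Eventually.of_forall fun _ => Finset.sum_nonneg fun _ _ => dist_nonneg) ?_ t
  rw [eventually_inf_principal]
  refine Eventually.of_forall fun E hE => ?_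
  rw [← Finset.sum_add_distrib, Finset.mul_sum]
  exact Finset.sum_le_sum fun i hi => h _ (hE.1 i hi).1 _ (hE.1 i hi).2

theorem integral_eq_integral_Ioi {G : ℝ → ℝ} (hG : Integrable G) :
    ∫ x, G x = ∫ x in Ioi 0, (G x + G (-x)) := by
  rw [integral_add hG.integrableOn hG.comp_neg.integrableOn, integral_comp_neg_Ioi, neg_zero,
    add_comm, intervalIntegral.integral_Iic_add_Ioi hG.integrableOn hG.integrableOn]

theorem sign_ae_eq_one {x : ℝ} (hx : x ∈ Ioi (0 : ℝ)) : ((SignType.sign x : SignType) : ℝ) = 1 := by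
  rw [sign_pos hx]; rfl

/-- An even function sees only the even part of its partner. Test functions in `ℍ¹` need not be
even, and this is how they are reduced to even ones on the half-line. -/
theorem integral_even_mul {A f : ℝ → ℝ} (hA : MemLp A 2 (volume.restrict (Ioi 0)))
    (hf : MemLp f 2) :
    ∫ x, A |x| * f x = 2 * ∫ x in Ioi 0, A x * ((f x + f (-x)) / 2) := by
  rw [integral_eq_integral_Ioi (G := fun x => A |x| * f x) ((memLp_even_ext hA).integrable_mul hf),
    ← integral_const_mul]
  refine setIntegral_congr_fun measurableSet_Ioi fun x hx => ?_
  simp only [abs_neg, abs_of_pos (mem_Ioi.1 hx)]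
  ring

theorem integral_odd_mul {A f : ℝ → ℝ} (hA : MemLp A 2 (volume.restrict (Ioi 0)))
    (hf : MemLp f 2) :
    ∫ x, SignType.sign x * A |x| * f x = 2 * ∫ x in Ioi 0, A x * ((f x - f (-x)) / 2) := by
  rw [integral_eq_integral_Ioi (G := fun x => SignType.sign x * A |x| * f x)
    ((memLp_odd_ext hA).integrable_mul hf), ← integral_const_mul]
  refine setIntegral_congr_fun measurableSet_Ioi fun x hx => ?_
  simp only [abs_neg, abs_of_pos (mem_Ioi.1 hx), sign_ae_eq_one hx, Left.sign_neg]
  push_cast [sign_ae_eq_one hx]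
  ring

theorem energy_half (f h : ℝ → ℝ) :
    energy (fun x => f |x|) (fun x => SignType.sign x * h |x|) =
      2 * ((∫ x in Ioi 0, f x ^ 2) + ∫ x in Ioi 0, h x ^ 2) := by
  have e1 : ∫ x, f |x| ^ 2 = 2 * ∫ x in Ioi 0, f x ^ 2 :=
    integral_comp_abs (f := fun x => f x ^ 2)
  have e2 : ∫ x, (SignType.sign x * h |x|) ^ 2 = 2 * ∫ x in Ioi 0, h x ^ 2 := by
    simp only [sq]
    rw [← integral_comp_abs (f := fun x => h x * h x)]
    refine integral_congr_ae ?_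
    filter_upwards [Measure.ae_ne volume (0 : ℝ)] with x hx
    rcases lt_or_gt_of_ne hx with h | h
    · simp [sign_neg h]
    · simp [sign_pos h]
  rw [energy, e1, e2, mul_add]

theorem LineH1.integral_Ioi_sq_le {f h : ℝ → ℝ} (L : LineH1 f h) :
    ∫ x in Ioi 0, f x ^ 2 ≤ ∫ x, f x ^ 2 :=
  setIntegral_le_integral L.memLp.integrable_sq (Eventually.of_forall fun _ => sq_nonneg _)

namespace LineH1

variable {f h : ℝ → ℝ}

/-- The even part of an element of `H¹(ℝ)`. -/
theorem even_part (L : LineH1 f h) :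
    LineH1 (fun x => (f x + f (-x)) / 2) (fun x => (h x - h (-x)) / 2) := by
  have e1 : (fun x => (f x + f (-x)) / 2) = fun x => 1 / 2 * (f x + f (-x)) := by funext x; ring
  have e2 : (fun x => (h x - h (-x)) / 2) = fun x => 1 / 2 * (h x + -h (-x)) := by funext x; ring
  rw [e1, e2]
  exact (L.add L.comp_neg).const_mul (1 / 2)

theorem integral_sq_half_le {u v : ℝ → ℝ} (hu : MemLp u 2) (e : ∀ x, v x = u (-x) ∨ v x = -u (-x)) :
    ∫ x, ((u x + v x) / 2) ^ 2 ≤ ∫ x, u x ^ 2 := by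
  have i1 := hu.integrable_sq
  have i2 : Integrable fun x => u (-x) ^ 2 := i1.comp_neg
  have i3 : Integrable fun x => (u x ^ 2 + u (-x) ^ 2) / 2 := (i1.add i2).div_const 2
  calc ∫ x, ((u x + v x) / 2) ^ 2 ≤ ∫ x, (u x ^ 2 + u (-x) ^ 2) / 2 := by
        refine integral_mono_of_nonneg (Eventually.of_forall fun _ => sq_nonneg _) i3
          (Eventually.of_forall fun x => ?_)
        rcases e x with e | e <;> simp only [e]
        · nlinarith [sq_nonneg (u x - u (-x))]
        · nlinarith [sq_nonneg (u x + u (-x))]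
    _ = ∫ x, u x ^ 2 := by
        rw [integral_div, integral_add i1 i2, integral_neg_eq_self (fun x => u x ^ 2)]
        ring

theorem energy_even_part_le (L : LineH1 f h) :
    energy (fun x => (f x + f (-x)) / 2) (fun x => (h x - h (-x)) / 2) ≤ energy f h := by
  have h2 := integral_sq_half_le (v := fun x => -h (-x)) L.memLp_deriv fun x => Or.inr rfl
  simp only [← sub_eq_add_neg] at h2
  exact add_le_add (integral_sq_half_le L.memLp fun x => Or.inl rfl) h2

end LineH1

theorem integral_add_sq_le {α : Type*} [MeasurableSpace α] {μ : Measure α} {u v : α → ℝ}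
    (hu : MemLp u 2 μ) (hv : MemLp v 2 μ) :
    ∫ x, (u x + v x) ^ 2 ∂μ ≤ 2 * (∫ x, u x ^ 2 ∂μ) + 2 * ∫ x, v x ^ 2 ∂μ := by
  rw [← integral_const_mul, ← integral_const_mul, ← integral_add (hu.integrable_sq.const_mul 2)
    (hv.integrable_sq.const_mul 2)]
  refine integral_mono_of_nonneg (Eventually.of_forall fun _ => sq_nonneg _)
    ((hu.integrable_sq.const_mul 2).add (hv.integrable_sq.const_mul 2))
    (Eventually.of_forall fun x => ?_)
  simp only
  nlinarith [sq_nonneg (u x - v x)]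

namespace IsKernel

variable {r : ℝ → ℝ} {K : ℝ → ℝ → ℝ} {g h φ ψ : ℝ → ℝ}

theorem integral_diag_mul_sq_le (hr : Pot r) (hK : IsKernel r K) (hg : MemLp g 2) :
    ∫ x in Ioi 0, (Ke K x x * g x) ^ 2 ≤ (CK r * sigma0 r 0) ^ 2 * ∫ x, g x ^ 2 := by
  have h1 := (hK.memLp_diag_mul hr hg).integrable_sq
  refine (setIntegral_le_integral h1 (Eventually.of_forall fun _ => sq_nonneg _)).trans ?_
  rw [← integral_const_mul]
  refine integral_mono h1 (hg.integrable_sq.const_mul _) fun x => ?_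
  simp only [mul_pow (Ke K _ _)]
  refine mul_le_mul_of_nonneg_right ?_ (sq_nonneg _)
  rw [← sq_abs]
  exact pow_le_pow_left₀ (abs_nonneg _) (hK.abs_Ke_le_const hr _ _) 2

/-- A bound of the squared norms of `T` and `Tt` as operators of `H¹`. -/
def Cop (r : ℝ → ℝ) (K : ℝ → ℝ → ℝ) : ℝ :=
  8 * (1 + hsq (Ke K) + hsq (k1 r K) + hsq (k2 r K) + (CK r * sigma0 r 0) ^ 2)

theorem Cop_pos (r : ℝ → ℝ) (K : ℝ → ℝ → ℝ) : 0 < Cop r K := by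
  have h1 := HS.hsq_nonneg (Ke K)
  have h2 := HS.hsq_nonneg (k1 r K)
  have h3 := HS.hsq_nonneg (k2 r K)
  unfold Cop
  positivity

theorem energy_T_le (hr : Pot r) (hK : IsKernel r K) (L : LineH1 g h) :
    energy (fun x => T K g |x|) (fun x => SignType.sign x * T' r K g h |x|) ≤
      Cop r K * energy g h := by
  rw [energy_half, energy]
  have u1 := (hK.hs_Ke hr).Up_bound L.memLp
  have u2 := (hK.hs_k1 hr).Up_bound L.memLp
  have a1 := integral_add_sq_le (L.memLp.restrict (Ioi 0)) u1.1
  have md := ((hK.memLp_diag_mul hr L.memLp).restrict (Ioi 0)).neg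
  have a2 := integral_add_sq_le ((L.memLp_deriv.restrict (Ioi 0)).add md) u2.1
  have a3 := integral_add_sq_le (L.memLp_deriv.restrict (Ioi 0)) md
  have a4 := hK.integral_diag_mul_sq_le hr L.memLp
  have a5 := L.integral_Ioi_sq_le
  have a6 : ∫ x in Ioi 0, h x ^ 2 ≤ ∫ x, h x ^ 2 :=
    setIntegral_le_integral L.memLp_deriv.integrable_sq (Eventually.of_forall fun _ => sq_nonneg _)
  have e1 : ∫ x in Ioi 0, T K g x ^ 2 = ∫ x in Ioi 0, (g x + Up (Ke K) g x) ^ 2 := rfl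
  have e2 : ∫ x in Ioi 0, T' r K g h x ^ 2 =
      ∫ x in Ioi 0, ((h + -fun x => Ke K x x * g x) x + Up (k1 r K) g x) ^ 2 :=
    setIntegral_congr_fun measurableSet_Ioi fun x _ => by
      simp only [T', Pi.add_apply, Pi.neg_apply]; ring
  have p1 := HS.hsq_nonneg (Ke K)
  have p2 := HS.hsq_nonneg (k1 r K)
  have p3 := HS.hsq_nonneg (k2 r K)
  have p4 : 0 ≤ ∫ x, g x ^ 2 := integral_nonneg fun _ => sq_nonneg _
  have p5 : 0 ≤ ∫ x, h x ^ 2 := integral_nonneg fun _ => sq_nonneg _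
  have p6 := sq_nonneg (CK r * sigma0 r 0)
  have b1 := u1.2
  have b2 := u2.2
  simp only [Pi.add_apply, Pi.neg_apply, neg_sq] at a2 a3 e2
  -- The factor `8` in `Cop` is `2` for the two half-lines times `4` for two successive uses of `(u
  -- + v)² ≤ 2 u² + 2 v²` on the three terms of `T'`.
  rw [e1, e2, Cop]
  nlinarith [mul_nonneg p1 p4, mul_nonneg p2 p4, mul_nonneg p3 p4, mul_nonneg p6 p4,
    mul_nonneg p1 p5, mul_nonneg p2 p5, mul_nonneg p3 p5, mul_nonneg p6 p5]

theorem energy_Tt_le (hr : Pot r) (hK : IsKernel r K) (L : LineH1 φ ψ) :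
    energy (fun x => Tt K φ |x|) (fun x => SignType.sign x * Tt' r K φ ψ |x|) ≤
      Cop r K * energy φ ψ := by
  rw [energy_half, energy]
  have u1 := (hK.hs_Ke hr).Lo_bound L.memLp
  have u2 := (hK.hs_k2 hr).Lo_bound L.memLp
  have a1 := integral_add_sq_le (L.memLp.restrict (Ioi 0)) u1.1
  have md := (hK.memLp_diag_mul hr L.memLp).restrict (Ioi 0)
  have a2 := integral_add_sq_le ((L.memLp_deriv.restrict (Ioi 0)).add md) u2.1
  have a3 := integral_add_sq_le (L.memLp_deriv.restrict (Ioi 0)) md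
  have a4 := hK.integral_diag_mul_sq_le hr L.memLp
  have a5 := L.integral_Ioi_sq_le
  have a6 : ∫ x in Ioi 0, ψ x ^ 2 ≤ ∫ x, ψ x ^ 2 :=
    setIntegral_le_integral L.memLp_deriv.integrable_sq (Eventually.of_forall fun _ => sq_nonneg _)
  have e1 : ∫ x in Ioi 0, Tt K φ x ^ 2 = ∫ x in Ioi 0, (φ x + Lo (Ke K) φ x) ^ 2 := rfl
  have e2 : ∫ x in Ioi 0, Tt' r K φ ψ x ^ 2 =
      ∫ x in Ioi 0, (ψ x + Ke K x x * φ x + Lo (k2 r K) φ x) ^ 2 := rfl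
  have p1 := HS.hsq_nonneg (Ke K)
  have p2 := HS.hsq_nonneg (k1 r K)
  have p3 := HS.hsq_nonneg (k2 r K)
  have p4 : 0 ≤ ∫ x, φ x ^ 2 := integral_nonneg fun _ => sq_nonneg _
  have p5 : 0 ≤ ∫ x, ψ x ^ 2 := integral_nonneg fun _ => sq_nonneg _
  have p6 := sq_nonneg (CK r * sigma0 r 0)
  have b1 := u1.2
  have b2 := u2.2
  simp only [Pi.add_apply] at a2
  rw [e1, e2, Cop]
  nlinarith [mul_nonneg p1 p4, mul_nonneg p2 p4, mul_nonneg p3 p4, mul_nonneg p6 p4,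
    mul_nonneg p1 p5, mul_nonneg p2 p5, mul_nonneg p3 p5, mul_nonneg p6 p5]

theorem Tt_add (hK : IsKernel r K) {φ₁ φ₂ : ℝ → ℝ} (h1 : Continuous φ₁) (h2 : Continuous φ₂)
    (x : ℝ) : Tt K (fun y => φ₁ y + φ₂ y) x = Tt K φ₁ x + Tt K φ₂ x := by
  have i1 : Continuous fun a => Ke K a x * φ₁ a := (hK.continuous_slice1 x).mul h1
  have i2 : Continuous fun a => Ke K a x * φ₂ a := (hK.continuous_slice1 x).mul h2
  simp only [Tt, Lo, mul_add]
  rw [intervalIntegral.integral_add (i1.intervalIntegrable _ _) (i2.intervalIntegrable _ _)]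
  ring

theorem Tt_smul (c : ℝ) (φ : ℝ → ℝ) (x : ℝ) : Tt K (fun y => c * φ y) x = c * Tt K φ x := by
  simp only [Tt, Lo, mul_add, ← intervalIntegral.integral_const_mul]
  congr 1
  exact intervalIntegral.integral_congr fun a _ => by ring

end IsKernel

/-! ### The transformed state as a solution in `ℍ⁻¹` -/

theorem _root_.AbsolutelyContinuousOnInterval.of_clm {V W : Type*} [NormedAddCommGroup V]
    [NormedSpace ℝ V] [NormedAddCommGroup W] [NormedSpace ℝ W] {f : ℝ → V} {g : ℝ → W} {a b : ℝ}
    (hf : AbsolutelyContinuousOnInterval f a b) (L : V →L[ℝ] W)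
    (h : ∀ x ∈ uIcc a b, g x = L (f x)) : AbsolutelyContinuousOnInterval g a b := by
  refine AbsolutelyContinuousOnInterval.of_dist_le hf hf (C := ‖L‖) fun x hx y hy => ?_
  rw [h x hx, h y hy, dist_eq_norm, ← map_sub, dist_eq_norm]
  exact (L.le_opNorm _).trans (mul_le_mul_of_nonneg_left
    (by linarith [norm_nonneg (f x - f y)]) (norm_nonneg _))

theorem _root_.HasDerivAt.of_clm {V W : Type*} [NormedAddCommGroup V] [NormedSpace ℝ V]
    [NormedAddCommGroup W] [NormedSpace ℝ W] {f : ℝ → V} {f' : V} {g : ℝ → W} {t : ℝ}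
    (hf : HasDerivAt f f' t) (L : V →L[ℝ] W) (h : ∀ᶠ s in 𝓝 t, g s = L (f s)) :
    HasDerivAt g (L f') t :=
  (L.hasFDerivAt.comp_hasDerivAt t hf).congr_of_eventuallyEq h

/-- Composition of functionals with a continuous linear map. -/
def preHneg {d d' : Coeffs} (B : H1 d →L[ℝ] H1 d') : Hneg d' →L[ℝ] Hneg d :=
  ContinuousLinearMap.precomp ℝ B

theorem preHneg_apply {d d' : Coeffs} (B : H1 d →L[ℝ] H1 d') (F : Hneg d') (p : H1 d) :
    preHneg B F p = F (B p) := rfl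

namespace IsKernel

variable {d : Coeffs} {K : ℝ → ℝ → ℝ}

/-- The transformed state `𝕋̂ z`. -/
def transform (hK : IsKernel d.r K) (z : H1 unitCoeffs) : H1 d :=
  H1.mk d (hK.lineH1_T d.pot (H1.lineH1_rep z))

theorem transform_isEven (hK : IsKernel d.r K) (z : H1 unitCoeffs) :
    H1.IsEven (hK.transform z) := by
  rw [H1.isEven_iff, transform, H1.rep_mk]
  intro y
  simp only [abs_neg]

theorem norm_transform_le (hK : IsKernel d.r K) (z : H1 unitCoeffs) :
    ‖hK.transform z‖ ≤ √(Cop d.r K) * ‖z‖ := by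
  refine abs_le_of_sq_le_sq' ?_ (by positivity) |>.2
  rw [mul_pow, Real.sq_sqrt (Cop_pos _ _).le, transform, H1.energy_mk, H1.norm_sq]
  exact hK.energy_T_le d.pot (H1.lineH1_rep z)

theorem fn_unit_ae_eq (z : H1 unitCoeffs) : H1.fn z =ᵐ[volume] H1.rep z := by
  have := H1.fn_ae_eq z
  rwa [S_unit] at this

theorem fn_transform (hK : IsKernel d.r K) {z : H1 unitCoeffs} (hz : H1.IsEven z) :
    H1.fn (hK.transform z) =ᵐ[volume] That d K (H1.fn z) := by
  refine (H1.fn_mk _).trans (d.S_congr ?_)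
  rw [H1.isEven_iff] at hz
  filter_upwards [fn_unit_ae_eq z] with y hy
  have e : ∫ ξ in Ioi |y|, K |y| ξ * H1.fn z ξ = Up (Ke K) (H1.rep z) |y| := by
    refine integral_congr_ae ?_
    filter_upwards [ae_restrict_of_ae (fn_unit_ae_eq z), ae_restrict_mem measurableSet_Ioi]
      with ξ h1 h2
    rw [h1, Ke_eq (abs_nonneg y) (le_of_lt h2)]
  rw [Tr, e, hy, T]
  congr 1
  rcases abs_choice y with h | h <;> rw [h]
  exact hz y

/-- The operator `φ ↦ Tt φ_e` on the test functions, where `φ_e` is the even part of `φ`. -/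
def adjTest (hK : IsKernel d.r K) (p : H1 d) : H1 unitCoeffs :=
  H1.mk unitCoeffs (hK.lineH1_Tt d.pot (H1.lineH1_rep p).even_part)

theorem rep_adjTest (hK : IsKernel d.r K) (p : H1 d) : H1.rep (hK.adjTest p) =
    fun x => Tt K (fun x => (H1.rep p x + H1.rep p (-x)) / 2) |x| := H1.rep_mk _

theorem norm_adjTest_le (hK : IsKernel d.r K) (p : H1 d) :
    ‖hK.adjTest p‖ ≤ √(Cop d.r K) * ‖p‖ := by
  refine abs_le_of_sq_le_sq' ?_ (by positivity) |>.2
  rw [mul_pow, Real.sq_sqrt (Cop_pos _ _).le, adjTest, H1.energy_mk, H1.norm_sq]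
  exact (hK.energy_Tt_le d.pot (H1.lineH1_rep p).even_part).trans
    (mul_le_mul_of_nonneg_left (H1.lineH1_rep p).energy_even_part_le (Cop_pos _ _).le)

/-- `adjTest` as a continuous linear map. -/
def adjCLM (hK : IsKernel d.r K) : H1 d →L[ℝ] H1 unitCoeffs :=
  LinearMap.mkContinuous
    { toFun := hK.adjTest
      map_add' := fun p p' => by
        apply H1.ext_rep
        rw [H1.rep_add]
        simp only [rep_adjTest, H1.rep_add]
        funext x
        rw [← hK.Tt_add (H1.lineH1_rep p).even_part.continuous (H1.lineH1_rep p').even_part.continuous]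
        congr 1
        funext y; ring
      map_smul' := fun c p => by
        apply H1.ext_rep
        rw [RingHom.id_apply, H1.rep_smul]
        simp only [rep_adjTest, H1.rep_smul]
        funext x
        rw [← Tt_smul]
        congr 1
        funext y; ring }
    (√(Cop d.r K)) hK.norm_adjTest_le

theorem adjCLM_apply (hK : IsKernel d.r K) (p : H1 d) : hK.adjCLM p = hK.adjTest p := rfl

/-- Pairing with an even state replaces a test function by its even part, and there `T` is moved
across as `Tt`. The transformed state is thus the image of `Z` under a bounded operator of `ℍ⁻¹`
spaces that does not depend on time, so no regularity in time with values in `ℍ¹` is needed. -/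
theorem toHneg_transform (hK : IsKernel d.r K) {z : H1 unitCoeffs} (hz : H1.IsEven z) :
    H1.toHneg (hK.transform z) = preHneg hK.adjCLM (H1.toHneg z) := by
  rw [H1.isEven_iff] at hz
  ext p
  have L := (H1.lineH1_rep z)
  have M := (H1.lineH1_rep p).even_part
  rw [preHneg_apply, H1.toHneg_apply, H1.toHneg_apply, adjCLM_apply, rep_adjTest,
    transform, H1.rep_mk, integral_even_mul (hK.memLp_T d.pot L.memLp) (H1.lineH1_rep p).memLp,
    hK.integral_T_mul d.pot L.memLp M.memLp]
  simp only [mul_comm (H1.rep z _)]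
  rw [integral_even_mul (hK.memLp_Tt d.pot M.memLp) L.memLp]
  congr 1
  refine setIntegral_congr_fun measurableSet_Ioi fun x _ => ?_
  simp only [hz]
  ring

/-- The trace of `K_{y₁} ` and the boundary value of the state, in the control. -/
def feedback (r : ℝ → ℝ) (K : ℝ → ℝ → ℝ) (g : ℝ → ℝ) : ℝ :=
  Up (k1 r K) g 0 - 1 / 2 * g 0 * ∫ ξ in Ioi 0, r ξ

theorem unit_w4 (x : ℝ) : unitCoeffs.w4 x = 1 := by
  simp [Coeffs.w4, Coeffs.w, unitCoeffs]

theorem newControl_eq (hK : IsKernel d.r K) (u : ℝ → ℝ) (Z : ℝ → H1 unitCoeffs) (t : ℝ) :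
    newControl d K u Z t = (u t + feedback d.r K (H1.rep (Z t))) / d.w4 0 := by
  have e : ∫ x in Ioi 0, derivWithin (fun y => K y x) (Ici 0) 0 * H1.fn (Z t) x =
      Up (k1 d.r K) (H1.rep (Z t)) 0 := by
    refine integral_congr_ae ?_
    filter_upwards [ae_restrict_of_ae (fn_unit_ae_eq (Z t)), ae_restrict_mem measurableSet_Ioi]
      with ξ h1 h2
    rw [h1, hK.derivWithin_eq d.pot h2]
  rw [newControl, e, H1.rightValue_fn, unit_w4, feedback, Coeffs.w4, Coeffs.w]
  ring

theorem repD_odd {z : H1 unitCoeffs} (hz : H1.IsEven z) :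
    ∀ᵐ x, H1.repD z (-x) = -H1.repD z x := by
  rw [H1.isEven_iff] at hz
  have h1 := (H1.lineH1_rep z).toIsPrim.comp_neg
  have e : (fun x => H1.rep z (-x)) = H1.rep z := funext hz
  rw [e] at h1
  filter_upwards [h1.deriv_ae_eq (H1.lineH1_rep z).toIsPrim] with x hx
  linarith

theorem integral_unit_q (p p' : H1 unitCoeffs) :
    ∫ x, unitCoeffs.q x * H1.fn p x * H1.fn p' x * unitCoeffs.rho x = 0 := by
  have : ∀ x, unitCoeffs.q x = 0 := fun x => by simp [Coeffs.q, unitCoeffs, Q2_one]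
  simp [this]

/-- The transformed functional, in terms of the transformed state and control. -/
theorem functional_transform (hK : IsKernel d.r K) {z : H1 unitCoeffs} (hz : H1.IsEven z) (c : ℝ)
    (p : H1 d) :
    -inner ℝ (H1.D z) (H1.D (hK.adjTest p)) - 2 * c * H1.rep (hK.adjTest p) 0 =
      -inner ℝ (H1.D (hK.transform z)) (H1.D p)
      - (∫ x, d.q x * H1.fn (hK.transform z) x * H1.fn p x * d.rho x)
      - 2 * √(d.rho 0 * d.k 0) * ((c + feedback d.r K (H1.rep z)) / d.w4 0) *
        valueAtZero (H1.fn p) := by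
  have L := (H1.lineH1_rep z)
  have P := (H1.lineH1_rep p)
  have M := P.even_part
  have key := hK.integral_deriv_T d.pot L M
  have e1 : inner ℝ (H1.D z) (H1.D (hK.adjTest p)) = 2 * ∫ x in Ioi 0, H1.repD z x *
      Tt' d.r K (fun x => (H1.rep p x + H1.rep p (-x)) / 2)
        (fun x => (H1.repD p x - H1.repD p (-x)) / 2) x := by
    rw [adjTest, H1.inner_eq (H1.D_ae_eq z) (H1.D_mk (hK.lineH1_Tt d.pot M))]
    simp only [mul_comm (H1.repD z _)]
    rw [integral_odd_mul (hK.memLp_Tt' d.pot M.memLp M.memLp_deriv) L.memLp_deriv]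
    congr 1
    refine integral_congr_ae ?_
    filter_upwards [ae_restrict_of_ae (repD_odd hz)] with x hx
    rw [hx]; ring
  have e2 : inner ℝ (H1.D (hK.transform z)) (H1.D p) = 2 * ∫ x in Ioi 0,
      T' d.r K (H1.rep z) (H1.repD z) x * ((H1.repD p x - H1.repD p (-x)) / 2) := by
    rw [transform, H1.inner_eq (H1.D_mk (hK.lineH1_T d.pot L)) (H1.D_ae_eq p),
      integral_odd_mul (hK.memLp_T' d.pot L.memLp L.memLp_deriv) P.memLp_deriv]
  have e3 : ∫ x, d.q x * H1.fn (hK.transform z) x * H1.fn p x * d.rho x = 2 * ∫ x in Ioi 0,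
      d.r x * T K (H1.rep z) x * ((H1.rep p x + H1.rep p (-x)) / 2) := by
    rw [H1.integral_q, transform, H1.rep_mk]
    obtain ⟨C, hC⟩ := d.pot.bounded
    have mA : MemLp (fun x => d.r x * T K (H1.rep z) x) 2 (volume.restrict (Ioi 0)) := by
      refine (hK.memLp_T d.pot L.memLp).of_le_mul (c := C)
        (d.pot.continuous.aestronglyMeasurable.mul (hK.memLp_T d.pot L.memLp).1)
        (Eventually.of_forall fun x => ?_)
      rw [norm_mul]
      exact mul_le_mul_of_nonneg_right (hC x) (norm_nonneg _)
    rw [← integral_even_mul mA P.memLp]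
    refine integral_congr_ae (Eventually.of_forall fun x => ?_)
    simp only
    congr 2
    rcases abs_choice x with h | h <;> rw [h]
    rw [d.pot.even]
  have e4 : H1.rep (hK.adjTest p) 0 = H1.rep p 0 := by
    rw [rep_adjTest]; simp [Tt, Lo]
  -- The weights cancel: `√(ρk)(0)` is the square of `(ρk)(0)^{1/4}`, and one inverse factor comes
  -- from the control, the other from the value of the test function at zero.
  have e5 : √(d.rho 0 * d.k 0) = d.w4 0 * d.w4 0 := by
    rw [Coeffs.w4, ← Real.rpow_add (d.w_pos 0), Real.sqrt_eq_rpow]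
    norm_num [Coeffs.w]
  have hw := (d.w4_pos 0).ne'
  rw [e1, e2, e3, e4, e5, key, H1.valueAtZero_fn, feedback]
  simp only [neg_zero]
  field_simp
  ring

theorem abs_cont_transform (hK : IsKernel d.r K) {T : ℝ} (hT : 0 < T) {u : ℝ → ℝ}
    {Z0 : H1 unitCoeffs} {Z : ℝ → H1 unitCoeffs} (hZ : IsSolution unitCoeffs T u Z0 Z) :
    AbsolutelyContinuousOnInterval (fun t => H1.toHneg (hK.transform (Z t))) 0 T :=
  AbsolutelyContinuousOnInterval.of_clm (V := Hneg unitCoeffs) (W := Hneg d) hZ.abs_cont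
    (preHneg hK.adjCLM) fun t ht =>
    hK.toHneg_transform (hZ.even t (by rwa [uIcc_of_le hT.le] at ht))

theorem equation_transform (hK : IsKernel d.r K) {T : ℝ} {u : ℝ → ℝ}
    {Z0 : H1 unitCoeffs} {Z : ℝ → H1 unitCoeffs} (hZ : IsSolution unitCoeffs T u Z0 Z)
    {t : ℝ} (ht : t ∈ Ioo 0 T) {F : Hneg unitCoeffs}
    (hF : HasDerivAt (fun s => H1.toHneg (Z s)) F t) :
    HasDerivAt (fun s => H1.toHneg (hK.transform (Z s))) (preHneg hK.adjCLM F) t := by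
  refine HasDerivAt.of_clm (V := Hneg unitCoeffs) (W := Hneg d) hF (preHneg hK.adjCLM) ?_
  filter_upwards [Ioo_mem_nhds ht.1 ht.2] with s hs
  exact hK.toHneg_transform (hZ.even s ⟨hs.1.le, hs.2.le⟩)

theorem isSolution_transform (hK : IsKernel d.r K) {T : ℝ} (hT : 0 < T) {u : ℝ → ℝ}
    {Z0 : H1 unitCoeffs} {Z : ℝ → H1 unitCoeffs} (hZ : IsSolution unitCoeffs T u Z0 Z) :
    IsSolution d T (newControl d K u Z) (hK.transform Z0) fun t => hK.transform (Z t) where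
  initial := by rw [hZ.initial]
  even t _ := hK.transform_isEven _
  abs_cont := hK.abs_cont_transform hT hZ
  equation := by
    filter_upwards [hZ.equation, ae_restrict_mem measurableSet_Ioo] with t ⟨F, hF, hφ⟩ ht
    refine ⟨preHneg hK.adjCLM F, hK.equation_transform hZ ht hF, fun p => ?_⟩
    have e : F (hK.adjTest p) = -inner ℝ (H1.D (Z t)) (H1.D (hK.adjTest p)) -
        2 * u t * H1.rep (hK.adjTest p) 0 := by
      rw [hφ, integral_unit_q, H1.valueAtZero_fn, unit_w4, div_one]
      simp [unitCoeffs]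
    rw [preHneg_apply, adjCLM_apply, e, hK.newControl_eq u Z t,
      ← hK.functional_transform (hZ.even t ⟨ht.1.le, ht.2.le⟩) (u t) p]

end IsKernel

/-! ### The heat kernel -/

/-- The heat kernel `e^{-x²/(4τ)} / √(4πτ)`. -/
def hk (τ x : ℝ) : ℝ := Real.exp (-x ^ 2 / (4 * τ)) / √(4 * Real.pi * τ)

/-- The derivative of the heat kernel with respect to `x`. -/
def hkx (τ x : ℝ) : ℝ := -(x / (2 * τ)) * hk τ x

/-- The derivative of the heat kernel with respect to `τ`. -/
def hkt (τ x : ℝ) : ℝ := (x ^ 2 / (4 * τ ^ 2) - 1 / (2 * τ)) * hk τ x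

/-- The mixed second derivative of the heat kernel. -/
def hkxt (τ x : ℝ) : ℝ := x / (2 * τ ^ 2) * hk τ x - x / (2 * τ) * hkt τ x

theorem hk_nonneg (τ x : ℝ) : 0 ≤ hk τ x := div_nonneg (Real.exp_pos _).le (Real.sqrt_nonneg _)

theorem hk_neg (τ x : ℝ) : hk τ (-x) = hk τ x := by simp [hk]

theorem hkx_neg (τ x : ℝ) : hkx τ (-x) = -hkx τ x := by simp only [hkx, hk_neg]; ring

theorem continuous_hk (τ : ℝ) : Continuous (hk τ) := by unfold hk; fun_prop

theorem continuous_hkx (τ : ℝ) : Continuous (hkx τ) := by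
  have := continuous_hk τ
  unfold hkx; fun_prop

theorem continuous_hkt (τ : ℝ) : Continuous (hkt τ) := by
  have := continuous_hk τ
  unfold hkt; fun_prop

theorem hasDerivAt_hk {τ : ℝ} (hτ : 0 < τ) (x : ℝ) : HasDerivAt (hk τ) (hkx τ x) x := by
  have h1 : HasDerivAt (fun x : ℝ => -x ^ 2 / (4 * τ)) (-(2 * x) / (4 * τ)) x := by
    simpa using ((hasDerivAt_pow 2 x).neg).div_const (4 * τ)
  have h2 := (h1.exp).div_const (√(4 * Real.pi * τ))
  refine h2.congr_deriv ?_
  rw [hkx, hk]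
  field_simp
  ring

theorem hasDerivAt_hkx {τ : ℝ} (hτ : 0 < τ) (x : ℝ) : HasDerivAt (hkx τ) (hkt τ x) x := by
  have h1 : HasDerivAt (fun x : ℝ => -(x / (2 * τ))) (-(1 / (2 * τ))) x :=
    ((hasDerivAt_id x).div_const _).neg
  refine (h1.mul (hasDerivAt_hk hτ x)).congr_deriv ?_
  rw [hkx, hkt]
  field_simp
  ring

theorem hasDerivAt_hk_time {τ : ℝ} (hτ : 0 < τ) (x : ℝ) :
    HasDerivAt (fun τ => hk τ x) (hkt τ x) τ := by
  have hp : 0 < 4 * Real.pi * τ := by positivity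
  have h1 : HasDerivAt (fun τ : ℝ => -x ^ 2 / (4 * τ)) (x ^ 2 / (4 * τ ^ 2)) τ := by
    have := ((hasDerivAt_id τ).const_mul 4).fun_inv (by positivity : (4 : ℝ) * id τ ≠ 0)
    refine ((this.const_mul (-x ^ 2)).congr_deriv ?_).congr_of_eventuallyEq
      (Eventually.of_forall fun σ => ?_)
    · simp only [id]; field_simp
    · simp only [id, div_eq_mul_inv]
  have h2 : HasDerivAt (fun τ : ℝ => √(4 * Real.pi * τ)) (4 * Real.pi / (2 * √(4 * Real.pi * τ))) τ := by
    have := ((hasDerivAt_id τ).const_mul (4 * Real.pi)).sqrt (by simpa using hp.ne')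
    simpa using this
  have hs : √(4 * Real.pi * τ) ≠ 0 := (Real.sqrt_pos.2 hp).ne'
  refine (h1.exp.div h2 hs).congr_deriv ?_
  rw [hkt, hk]
  have hsq : √(4 * Real.pi * τ) ^ 2 = 4 * Real.pi * τ := Real.sq_sqrt hp.le
  set s := √(4 * Real.pi * τ)
  rw [show (4 : ℝ) * Real.pi = s ^ 2 / τ by rw [hsq]; field_simp]
  field_simp

theorem hasDerivAt_hkx_time {τ : ℝ} (hτ : 0 < τ) (x : ℝ) :
    HasDerivAt (fun τ => hkx τ x) (hkxt τ x) τ := by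
  have h1 : HasDerivAt (fun τ : ℝ => -(x / (2 * τ))) (x / (2 * τ ^ 2)) τ := by
    have := ((hasDerivAt_id τ).const_mul 2).fun_inv (by positivity : (2 : ℝ) * id τ ≠ 0)
    refine ((this.const_mul (-x)).congr_deriv ?_).congr_of_eventuallyEq
      (Eventually.of_forall fun σ => ?_)
    · simp only [id]; field_simp
    · simp only [id, div_eq_mul_inv]; ring
  refine (h1.mul (hasDerivAt_hk_time hτ x)).congr_deriv ?_
  rw [hkxt]; ring

/-- Polynomial factors are absorbed by giving up half of the exponent: `m (1 + x²) ≤ 1 + x²/(16b) ≤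
e^{x²/(16b)}`, and this is squared. -/
theorem exists_gauss_bound {b : ℝ} (hb : 0 < b) :
    ∃ C, 0 ≤ C ∧ ∀ x : ℝ, (1 + x ^ 2) ^ 2 * Real.exp (-x ^ 2 / (4 * b)) ≤
      C * Real.exp (-x ^ 2 / (8 * b)) := by
  set m := min 1 (1 / (16 * b)) with hm
  have hm0 : 0 < m := lt_min one_pos (by positivity)
  refine ⟨(m ^ 2)⁻¹, by positivity, fun x => ?_⟩
  have h1 : m * (1 + x ^ 2) ≤ Real.exp (x ^ 2 / (16 * b)) := by
    have := Real.add_one_le_exp (x ^ 2 / (16 * b))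
    have h2 : m ≤ 1 := min_le_left _ _
    have h3 : m * x ^ 2 ≤ 1 / (16 * b) * x ^ 2 :=
      mul_le_mul_of_nonneg_right (min_le_right _ _) (sq_nonneg x)
    have h4 : 1 / (16 * b) * x ^ 2 = x ^ 2 / (16 * b) := by ring
    nlinarith
  have h2 : (m * (1 + x ^ 2)) ^ 2 ≤ Real.exp (x ^ 2 / (8 * b)) := by
    calc _ ≤ Real.exp (x ^ 2 / (16 * b)) ^ 2 := pow_le_pow_left₀ (by positivity) h1 2
      _ = _ := by rw [← Real.exp_nat_mul]; congr 1; push_cast; ring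
  have h3 : Real.exp (x ^ 2 / (8 * b)) * Real.exp (-x ^ 2 / (4 * b)) = Real.exp (-x ^ 2 / (8 * b)) := by
    rw [← Real.exp_add]; congr 1; field_simp; ring
  rw [← h3, ← mul_assoc]
  refine mul_le_mul_of_nonneg_right ?_ (Real.exp_pos _).le
  rw [inv_mul_eq_div, le_div_iff₀ (by positivity)]
  linarith [mul_pow m (1 + x ^ 2) 2]

theorem exists_hk_bound {a b : ℝ} (ha : 0 < a) (hab : a ≤ b) :
    ∃ C, 0 ≤ C ∧ ∀ τ ∈ Icc a b, ∀ x, |hk τ x| ≤ C * Real.exp (-x ^ 2 / (8 * b)) ∧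
      |hkx τ x| ≤ C * Real.exp (-x ^ 2 / (8 * b)) ∧ |hkt τ x| ≤ C * Real.exp (-x ^ 2 / (8 * b)) ∧
      |hkxt τ x| ≤ C * Real.exp (-x ^ 2 / (8 * b)) := by
  obtain ⟨C, hC0, hC⟩ := exists_gauss_bound (ha.trans_le hab)
  -- The functions to be bounded are `hk` times polynomials of degree at most three in `x` and in
  -- `1/τ`. The powers of `x` are dominated by `(1 + x²)²`, and `D` dominates the coefficients since
  -- `1/τ ≤ 1/a`.
  set D := 4 * (1 + 1 / a) ^ 3 with hD
  set s := √(4 * Real.pi * a) with hs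
  have hs0 : 0 < s := Real.sqrt_pos.2 (by positivity)
  refine ⟨D * (C / s), by positivity, fun τ hτ x => ?_⟩
  have hτ0 : 0 < τ := ha.trans_le hτ.1
  have h1 : (1 + x ^ 2) ^ 2 * hk τ x ≤ C / s * Real.exp (-x ^ 2 / (8 * b)) := by
    have e1 : Real.exp (-x ^ 2 / (4 * τ)) ≤ Real.exp (-x ^ 2 / (4 * b)) := by
      apply Real.exp_le_exp.2
      rw [neg_div, neg_div, neg_le_neg_iff]
      exact div_le_div_of_nonneg_left (sq_nonneg x) (by positivity) (by linarith [hτ.2])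
    have e2 : s ≤ √(4 * Real.pi * τ) :=
      Real.sqrt_le_sqrt (mul_le_mul_of_nonneg_left hτ.1 (by positivity))
    have e3 : hk τ x ≤ Real.exp (-x ^ 2 / (4 * b)) / s :=
      div_le_div₀ (Real.exp_pos _).le e1 hs0 e2
    calc (1 + x ^ 2) ^ 2 * hk τ x ≤ (1 + x ^ 2) ^ 2 * (Real.exp (-x ^ 2 / (4 * b)) / s) :=
          mul_le_mul_of_nonneg_left e3 (by positivity)
      _ = (1 + x ^ 2) ^ 2 * Real.exp (-x ^ 2 / (4 * b)) / s := by ring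
      _ ≤ C * Real.exp (-x ^ 2 / (8 * b)) / s := div_le_div_of_nonneg_right (hC x) hs0.le
      _ = _ := by ring
  set i := 1 / a with hi
  have hi0 : 0 < i := by positivity
  set j := 1 / τ with hj
  have hj0 : 0 < j := by positivity
  have hji : j ≤ i := one_div_le_one_div_of_le ha hτ.1
  have hx : |x| ≤ (1 + x ^ 2) := by nlinarith [sq_abs x, sq_nonneg (|x| - 1), abs_nonneg x]
  have hk0 := hk_nonneg τ x
  have key : ∀ c, |c| ≤ D * (1 + x ^ 2) ^ 2 →
      |c * hk τ x| ≤ D * (C / s) * Real.exp (-x ^ 2 / (8 * b)) := fun c hc => by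
    rw [abs_mul, abs_of_nonneg hk0]
    calc |c| * hk τ x ≤ D * (1 + x ^ 2) ^ 2 * hk τ x := mul_le_mul_of_nonneg_right hc hk0
      _ = D * ((1 + x ^ 2) ^ 2 * hk τ x) := by ring
      _ ≤ D * (C / s * Real.exp (-x ^ 2 / (8 * b))) := mul_le_mul_of_nonneg_left h1 (by positivity)
      _ = _ := by ring
  have y0 := sq_nonneg x
  have hj2 : j ^ 2 ≤ i ^ 2 := pow_le_pow_left₀ hj0.le hji 2
  have hj3 : j ^ 3 ≤ i ^ 3 := pow_le_pow_left₀ hj0.le hji 3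
  have q0 : (1 + x ^ 2) ^ 2 = 1 + 2 * x ^ 2 + x ^ 2 * x ^ 2 := by ring
  have y2 := mul_nonneg y0 y0
  have q1 : (1 : ℝ) ≤ (1 + x ^ 2) ^ 2 := by linarith
  have q2 : |x| ≤ (1 + x ^ 2) ^ 2 := by linarith
  have q3 : x ^ 2 ≤ (1 + x ^ 2) ^ 2 := by linarith
  have q4 : |x| * x ^ 2 ≤ (1 + x ^ 2) ^ 2 := by
    linarith [mul_le_mul_of_nonneg_right hx y0, add_mul 1 (x ^ 2) (x ^ 2)]
  have hDe : D = 4 + 12 * i + 12 * i ^ 2 + 4 * i ^ 3 := by rw [hD]; ring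
  have i2 := pow_pos hi0 2
  have i3 := pow_pos hi0 3
  have b1 : (1 : ℝ) ≤ D := by linarith
  have b2 : i ≤ D := by linarith
  have b3 : i ^ 2 + i ≤ D := by linarith
  have b4 : 2 * i ^ 2 + i ^ 3 ≤ D := by linarith
  have Q0 : 0 ≤ (1 + x ^ 2) ^ 2 := by positivity
  clear_value D
  refine ⟨?_, ?_, ?_, ?_⟩
  · have := key 1 (by rw [abs_one]; linarith [mul_le_mul_of_nonneg_right b1 Q0])
    rwa [one_mul] at this
  · refine key _ ?_
    have e : |-(x / (2 * τ))| = |x| * j / 2 := by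
      rw [abs_neg, abs_div, abs_of_pos (by positivity : 0 < 2 * τ), hj]; field_simp
    rw [e]
    have : |x| * j ≤ (1 + x ^ 2) ^ 2 * i := mul_le_mul q2 hji hj0.le Q0
    linarith [mul_le_mul_of_nonneg_left b2 Q0, mul_nonneg Q0 hi0.le]
  · refine key _ ?_
    have e : x ^ 2 / (4 * τ ^ 2) - 1 / (2 * τ) = x ^ 2 * j ^ 2 / 4 - j / 2 := by
      rw [hj]; field_simp
    rw [e, abs_le]
    have t1 : x ^ 2 * j ^ 2 ≤ (1 + x ^ 2) ^ 2 * i ^ 2 := mul_le_mul q3 hj2 (by positivity) Q0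
    have t2 : 1 * j ≤ (1 + x ^ 2) ^ 2 * i := mul_le_mul q1 hji hj0.le Q0
    have t3 := mul_le_mul_of_nonneg_left b3 Q0
    have t4 : 0 ≤ x ^ 2 * j ^ 2 := by positivity
    have t5 := mul_nonneg Q0 hi0.le
    have t6 := mul_nonneg Q0 i2.le
    rw [mul_add] at t3
    constructor <;> linarith
  · have e : hkxt τ x = (x * j ^ 2 / 2 - x * j / 2 * (x ^ 2 * j ^ 2 / 4 - j / 2)) * hk τ x := by
      rw [hkxt, hkt, hj]; field_simp
    rw [e]
    refine key _ ?_
    have t1 : |x| * j ^ 2 ≤ (1 + x ^ 2) ^ 2 * i ^ 2 := mul_le_mul q2 hj2 (by positivity) Q0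
    have t2 : |x| * x ^ 2 * j ^ 3 ≤ (1 + x ^ 2) ^ 2 * i ^ 3 := mul_le_mul q4 hj3 (by positivity) Q0
    have t3 := mul_le_mul_of_nonneg_left b4 Q0
    have e2 : x * j ^ 2 / 2 - x * j / 2 * (x ^ 2 * j ^ 2 / 4 - j / 2) =
        3 / 4 * (x * j ^ 2) - 1 / 8 * (x * x ^ 2 * j ^ 3) := by ring
    rw [e2]
    refine (abs_sub _ _).trans ?_
    rw [abs_mul, abs_mul, abs_mul, abs_mul, abs_mul, abs_of_pos (pow_pos hj0 2),
      abs_of_pos (pow_pos hj0 3), abs_of_nonneg y0, abs_of_pos (by norm_num : (0 : ℝ) < 3 / 4),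
      abs_of_pos (by norm_num : (0 : ℝ) < 1 / 8)]
    have p1 : 0 ≤ |x| * j ^ 2 := by positivity
    have p2 : 0 ≤ |x| * x ^ 2 * j ^ 3 := by positivity
    have t5 := mul_nonneg Q0 i3.le
    have t6 := mul_nonneg Q0 i2.le
    rw [mul_add] at t3
    linarith

theorem integrable_gauss {b : ℝ} (hb : 0 < b) : Integrable fun x : ℝ => Real.exp (-x ^ 2 / b) := by
  refine (integrable_exp_neg_mul_sq (b := 1 / b) (by positivity)).congr
    (Eventually.of_forall fun x => ?_)
  simp only; congr 1; ring

theorem memLp_gauss {b : ℝ} (hb : 0 < b) : MemLp (fun x : ℝ => Real.exp (-x ^ 2 / b)) 2 := by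
  rw [memLp_two_iff_integrable_sq (by fun_prop)]
  refine (integrable_gauss (b := b / 2) (by positivity)).congr (Eventually.of_forall fun x => ?_)
  simp only
  rw [← Real.exp_nat_mul]; congr 1; push_cast; field_simp

theorem memLp_of_le_gauss {f : ℝ → ℝ} (hf : Continuous f) {C b : ℝ} (hb : 0 < b)
    (h : ∀ x, |f x| ≤ C * Real.exp (-x ^ 2 / b)) : MemLp f 2 := by
  refine (memLp_gauss hb).of_le_mul (c := C) hf.aestronglyMeasurable (Eventually.of_forall fun x => ?_)
  rw [Real.norm_eq_abs, Real.norm_eq_abs, abs_of_pos (Real.exp_pos _)]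
  exact h x

theorem integrable_of_le_gauss {f : ℝ → ℝ} (hf : Continuous f) {C b : ℝ} (hb : 0 < b)
    (h : ∀ x, |f x| ≤ C * Real.exp (-x ^ 2 / b)) : Integrable f :=
  Integrable.mono' ((integrable_gauss hb).const_mul C) hf.aestronglyMeasurable
    (Eventually.of_forall h)

theorem lineH1_hk {τ : ℝ} (hτ : 0 < τ) : LineH1 (hk τ) (hkx τ) := by
  obtain ⟨C, hC0, hC⟩ := exists_hk_bound hτ le_rfl
  exact ⟨IsPrim.of_hasDerivAt (continuous_hkx τ) (hasDerivAt_hk hτ),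
    memLp_of_le_gauss (continuous_hk τ) (by positivity) fun x => (hC τ ⟨le_rfl, le_rfl⟩ x).1,
    memLp_of_le_gauss (continuous_hkx τ) (by positivity) fun x => (hC τ ⟨le_rfl, le_rfl⟩ x).2.1⟩

theorem lineH1_hkx {τ : ℝ} (hτ : 0 < τ) : LineH1 (hkx τ) (hkt τ) := by
  obtain ⟨C, hC0, hC⟩ := exists_hk_bound hτ le_rfl
  exact ⟨IsPrim.of_hasDerivAt (continuous_hkt τ) (hasDerivAt_hkx hτ),
    memLp_of_le_gauss (continuous_hkx τ) (by positivity) fun x => (hC τ ⟨le_rfl, le_rfl⟩ x).2.1,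
    memLp_of_le_gauss (continuous_hkt τ) (by positivity) fun x => (hC τ ⟨le_rfl, le_rfl⟩ x).2.2.1⟩

theorem LineH1.const_sub_comp {f h : ℝ → ℝ} (L : LineH1 f h) (x : ℝ) :
    LineH1 (fun y => f (x - y)) (fun y => -h (x - y)) := by
  have hmp : MeasurePreserving (fun y : ℝ => x - y) := Measure.measurePreserving_sub_left volume x
  exact ⟨L.toIsPrim.const_sub_comp x, L.memLp.comp_measurePreserving hmp,
    (L.memLp_deriv.comp_measurePreserving hmp).neg⟩

/-- The heat kernel `y ↦ hk τ (x - y)` as a test function. -/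
def heatTest (x τ : ℝ) : H1 unitCoeffs :=
  if hτ : 0 < τ then H1.mk unitCoeffs ((lineH1_hk hτ).const_sub_comp x) else 0

theorem rep_heatTest (x : ℝ) {τ : ℝ} (hτ : 0 < τ) :
    H1.rep (heatTest x τ) = fun y => hk τ (x - y) := by
  rw [heatTest, dif_pos hτ, H1.rep_mk]

theorem repD_heatTest (x : ℝ) {τ : ℝ} (hτ : 0 < τ) :
    H1.repD (heatTest x τ) =ᵐ[volume] fun y => -hkx τ (x - y) := by
  rw [heatTest, dif_pos hτ]
  exact H1.repD_mk _

theorem energy_le_of_le_gauss {f h : ℝ → ℝ} {C b : ℝ} (hb : 0 < b) (x : ℝ)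
    (h1 : ∀ y, |f y| ≤ C * Real.exp (-(x - y) ^ 2 / b))
    (h2 : ∀ y, |h y| ≤ C * Real.exp (-(x - y) ^ 2 / b)) :
    energy f h ≤ C ^ 2 * (2 * ∫ y, Real.exp (-y ^ 2 / b) ^ 2) := by
  have hi := (memLp_gauss hb).integrable_sq
  have hi2 : Integrable fun y => Real.exp (-(x - y) ^ 2 / b) ^ 2 := hi.comp_sub_left x
  have e : ∫ y, Real.exp (-(x - y) ^ 2 / b) ^ 2 = ∫ y, Real.exp (-y ^ 2 / b) ^ 2 :=
    integral_sub_left_eq_self (fun y => Real.exp (-y ^ 2 / b) ^ 2) volume x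
  have key : ∀ f : ℝ → ℝ, (∀ y, |f y| ≤ C * Real.exp (-(x - y) ^ 2 / b)) →
      ∫ y, f y ^ 2 ≤ C ^ 2 * ∫ y, Real.exp (-y ^ 2 / b) ^ 2 := fun f h => by
    rw [← e, ← integral_const_mul]
    refine integral_mono_of_nonneg (Eventually.of_forall fun _ => sq_nonneg _) (hi2.const_mul _)
      (Eventually.of_forall fun y => ?_)
    simp only
    rw [← sq_abs, ← mul_pow]
    exact pow_le_pow_left₀ (abs_nonneg _) (h y) 2
  have := add_le_add (key f h1) (key h h2)
  unfold energy
  linarith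

/-- The mean value inequality in time, with the uniform Gaussian bounds for the time derivatives of
`hk` and `hkx`, gives a Lipschitz bound in the norm of `H¹`. It makes the moving test function in
Duhamel's argument absolutely continuous. -/
theorem exists_heatTest_lipschitz (x : ℝ) {a b : ℝ} (ha : 0 < a) (hab : a ≤ b) :
    ∃ C, 0 ≤ C ∧ ∀ τ ∈ Icc a b, ∀ σ ∈ Icc a b,
      ‖heatTest x τ - heatTest x σ‖ ≤ C * |τ - σ| := by
  obtain ⟨C, hC0, hC⟩ := exists_hk_bound ha hab
  have hb : 0 < b := ha.trans_le hab
  set N := 2 * ∫ y : ℝ, Real.exp (-y ^ 2 / (8 * b)) ^ 2 with hN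
  have hN0 : 0 ≤ N := by
    have : 0 ≤ ∫ y : ℝ, Real.exp (-y ^ 2 / (8 * b)) ^ 2 := integral_nonneg fun _ => sq_nonneg _
    positivity
  refine ⟨C * √N, by positivity, fun τ hτ σ hσ => ?_⟩
  have hτ0 := ha.trans_le hτ.1
  have hσ0 := ha.trans_le hσ.1
  have L := ((lineH1_hk hτ0).const_sub_comp x).add (((lineH1_hk hσ0).const_sub_comp x).const_mul (-1))
  have e : heatTest x τ - heatTest x σ = H1.mk unitCoeffs L := by
    apply H1.ext_rep
    rw [H1.rep_mk, sub_eq_add_neg, ← neg_one_smul ℝ, H1.rep_add, H1.rep_smul, rep_heatTest x hτ0,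
      rep_heatTest x hσ0]
  have m1 : ∀ y, |hk τ y - hk σ y| ≤ C * Real.exp (-y ^ 2 / (8 * b)) * |τ - σ| := fun y =>
    (convex_Icc a b).norm_image_sub_le_of_norm_hasDerivWithin_le
      (fun t ht => (hasDerivAt_hk_time (ha.trans_le ht.1) y).hasDerivWithinAt)
      (fun t ht => (hC t ht y).2.2.1) hσ hτ
  have m2 : ∀ y, |hkx τ y - hkx σ y| ≤ C * Real.exp (-y ^ 2 / (8 * b)) * |τ - σ| := fun y =>
    (convex_Icc a b).norm_image_sub_le_of_norm_hasDerivWithin_le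
      (fun t ht => (hasDerivAt_hkx_time (ha.trans_le ht.1) y).hasDerivWithinAt)
      (fun t ht => (hC t ht y).2.2.2) hσ hτ
  rw [e]
  refine abs_le_of_sq_le_sq' ?_ (by positivity) |>.2
  rw [H1.energy_mk]
  refine (energy_le_of_le_gauss (C := C * |τ - σ|) (b := 8 * b) (by positivity) x
    (fun y => ?_) (fun y => ?_)).trans (le_of_eq ?_)
  · have := m1 (x - y)
    rw [show hk τ (x - y) + -1 * hk σ (x - y) = hk τ (x - y) - hk σ (x - y) by ring]
    linarith
  · have := m2 (x - y)
    rw [show -hkx τ (x - y) + -1 * -hkx σ (x - y) = -(hkx τ (x - y) - hkx σ (x - y)) by ring,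
      abs_neg]
    linarith
  · rw [← hN, mul_pow, mul_pow, mul_pow, Real.sq_sqrt hN0]; ring

/-- Differentiation of `τ ↦ ∫ z(y) hk τ (x - y) dy`. -/
theorem hasDerivAt_integral_hk {z z' : ℝ → ℝ} (L : LineH1 z z') (x : ℝ) {τ : ℝ} (hτ : 0 < τ) :
    HasDerivAt (fun τ => ∫ y, z y * hk τ (x - y)) (∫ y, z' y * hkx τ (x - y)) τ := by
  obtain ⟨C, hC0, hC⟩ := exists_hk_bound (half_pos hτ) (by linarith : τ / 2 ≤ 2 * τ)
  have hmp : MeasurePreserving (fun y : ℝ => x - y) := Measure.measurePreserving_sub_left volume x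
  have hs : Ioo (τ / 2) (2 * τ) ∈ 𝓝 τ := Ioo_mem_nhds (by linarith) (by linarith)
  have mg : MemLp (fun y => Real.exp (-(x - y) ^ 2 / (8 * (2 * τ)))) 2 :=
    (memLp_gauss (by positivity)).comp_measurePreserving hmp
  have h := hasDerivAt_integral_of_dominated_loc_of_deriv_le (μ := volume)
    (F := fun τ y => z y * hk τ (x - y)) (F' := fun τ y => z y * hkt τ (x - y)) (x₀ := τ)
    (bound := fun y => C * (|z y| * Real.exp (-(x - y) ^ 2 / (8 * (2 * τ))))) hs
    (Eventually.of_forall fun σ => (L.continuous.mul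
      ((continuous_hk σ).comp (by fun_prop))).aestronglyMeasurable)
    (L.memLp.integrable_mul ((lineH1_hk hτ).const_sub_comp x).memLp)
    (L.continuous.mul ((continuous_hkt τ).comp (by fun_prop))).aestronglyMeasurable
    (Eventually.of_forall fun y σ hσ => by
      rw [norm_mul, Real.norm_eq_abs, Real.norm_eq_abs]
      have := mul_le_mul_of_nonneg_left (hC σ ⟨hσ.1.le, hσ.2.le⟩ (x - y)).2.2.1 (abs_nonneg (z y))
      linarith)
    ((L.memLp.abs.integrable_mul mg).const_mul C)
    (Eventually.of_forall fun y σ hσ =>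
      (hasDerivAt_hk_time ((half_pos hτ).trans hσ.1) (x - y)).const_mul (z y))
  have e := L.integral_mul_deriv ((lineH1_hkx hτ).const_sub_comp x)
  have e2 : ∫ y, z y * hkt τ (x - y) = ∫ y, z' y * hkx τ (x - y) := by
    simp only [mul_neg, integral_neg, neg_inj] at e
    exact e
  rw [← e2]
  exact h.2

theorem ae_abs_le_normLinfty {T : ℝ} {u : ℝ → ℝ} (hu : MemLp u ⊤ (volume.restrict (Ioo 0 T))) :
    ∀ᵐ s ∂volume.restrict (Ioo 0 T), |u s| ≤ normLinfty T u := by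
  have h := ae_le_eLpNormEssSup (f := u) (μ := volume.restrict (Ioo 0 T))
  have hfin := hu.2
  rw [eLpNorm_exponent_top] at hfin
  filter_upwards [h] with s hs
  rw [normLinfty, eLpNorm_exponent_top]
  have := ENNReal.toReal_mono hfin.ne hs
  simpa using this

theorem normLinfty_nonneg (T : ℝ) (u : ℝ → ℝ) : 0 ≤ normLinfty T u := ENNReal.toReal_nonneg

theorem intervalIntegrable_inv_sqrt (t : ℝ) : IntervalIntegrable (fun s : ℝ => (√s)⁻¹) volume 0 t := by
  have h := intervalIntegral.intervalIntegrable_rpow' (a := 0) (b := t) (r := -(1 / 2)) (by norm_num)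
  rcases le_total 0 t with ht | ht
  · refine h.congr ?_
    rw [uIoc_of_le ht]
    intro s hs
    simp only
    rw [Real.rpow_neg hs.1.le, Real.sqrt_eq_rpow]
  · refine (IntervalIntegrable.zero (μ := volume) (a := 0) (b := t)).congr ?_
    rw [uIoc_of_ge ht]
    intro s hs
    simp [Real.sqrt_eq_zero_of_nonpos hs.2]

theorem integral_inv_sqrt {t : ℝ} (ht : 0 ≤ t) : ∫ s in (0 : ℝ)..t, (√s)⁻¹ = 2 * √t := by
  have e : ∫ s in (0 : ℝ)..t, (√s)⁻¹ = ∫ s in (0 : ℝ)..t, s ^ (-(1 / 2) : ℝ) := by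
    refine intervalIntegral.integral_congr_ae (Eventually.of_forall fun s hs => ?_)
    rw [uIoc_of_le ht] at hs
    rw [Real.rpow_neg hs.1.le, Real.sqrt_eq_rpow]
  rw [e, integral_rpow (Or.inl (by norm_num)), Real.zero_rpow (by norm_num), Real.sqrt_eq_rpow]
  norm_num
  ring

/-! ### Heat averages and Duhamel's formula -/

/-- The convolution of `z` with the heat kernel at time `τ ≥ 0`. -/
def heatAvg (z : ℝ → ℝ) (τ x : ℝ) : ℝ :=
  (√Real.pi)⁻¹ * ∫ w, z (x - 2 * √τ * w) * Real.exp (-w ^ 2)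

/-- The substitution `y = x - 2 √τ w` removes the singularity of the kernel at `τ = 0`. In the form
`heatAvg` the convolution with a bounded continuous `z` is jointly continuous down to `τ = 0`, where
it returns `z`. -/
theorem integral_mul_hk (z : ℝ → ℝ) {τ : ℝ} (hτ : 0 < τ) (x : ℝ) :
    ∫ y, z y * hk τ (x - y) = heatAvg z τ x := by
  have e1 : ∫ y, z y * hk τ (x - y) = ∫ v, z (x - v) * hk τ v := by
    rw [← integral_sub_left_eq_self (fun y => z y * hk τ (x - y)) volume x]
    simp only [sub_sub_cancel]
  have hs : 0 < 2 * √τ := by have := Real.sqrt_pos.2 hτ; positivity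
  have e2 := Measure.integral_comp_mul_left (fun v => z (x - v) * hk τ v) (2 * √τ)
  rw [abs_of_pos (inv_pos.2 hs), smul_eq_mul, inv_mul_eq_div, eq_div_iff hs.ne'] at e2
  rw [e1, ← e2, heatAvg, mul_comm, ← integral_const_mul, ← integral_const_mul]
  refine integral_congr_ae (Eventually.of_forall fun w => ?_)
  simp only [hk]
  have h1 : -(2 * √τ * w) ^ 2 / (4 * τ) = -w ^ 2 := by
    rw [mul_pow, mul_pow, Real.sq_sqrt hτ.le]; field_simp; ring
  have h2 : √(4 * Real.pi * τ) = 2 * √Real.pi * √τ := by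
    rw [Real.sqrt_mul (by positivity), Real.sqrt_mul (by norm_num),
      show (4 : ℝ) = 2 ^ 2 by norm_num, Real.sqrt_sq (by norm_num)]
  rw [h1, h2]
  have := Real.sqrt_pos.2 hτ
  have := Real.sqrt_pos.2 Real.pi_pos
  field_simp

theorem integrable_exp_neg_sq : Integrable fun w : ℝ => Real.exp (-w ^ 2) := by
  simpa using integrable_gauss one_pos

theorem integral_exp_neg_sq : ∫ w : ℝ, Real.exp (-w ^ 2) = √Real.pi := by
  simpa using integral_gaussian 1

theorem continuous_heatAvg {z : ℝ → ℝ} (hz : Continuous z) {C : ℝ} (hC : ∀ x, |z x| ≤ C) :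
    Continuous fun p : ℝ × ℝ => heatAvg z p.1 p.2 := by
  refine continuous_const.mul (continuous_of_dominated
    (bound := fun w => C * Real.exp (-w ^ 2)) (fun p => ?_) (fun p => ?_) ?_ ?_)
  · exact (by fun_prop : Continuous fun w => z (p.2 - 2 * √p.1 * w) * Real.exp (-w ^ 2)).aestronglyMeasurable
  · refine Eventually.of_forall fun w => ?_
    rw [norm_mul, Real.norm_eq_abs, Real.norm_eq_abs, abs_of_pos (Real.exp_pos _)]
    exact mul_le_mul_of_nonneg_right (hC _) (Real.exp_pos _).le
  · exact integrable_exp_neg_sq.const_mul C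
  · exact Eventually.of_forall fun w => by fun_prop

theorem heatAvg_zero (z : ℝ → ℝ) (x : ℝ) : heatAvg z 0 x = z x := by
  simp only [heatAvg, Real.sqrt_zero, mul_zero, zero_mul, sub_zero]
  rw [integral_const_mul, integral_exp_neg_sq]
  have := Real.sqrt_pos.2 Real.pi_pos
  field_simp

theorem abs_heatAvg_le {z : ℝ → ℝ} {C : ℝ} (hC : ∀ x, |z x| ≤ C) (τ x : ℝ) :
    |heatAvg z τ x| ≤ C := by
  have hp := Real.sqrt_pos.2 Real.pi_pos
  rw [heatAvg, abs_mul, abs_of_pos (inv_pos.2 hp), inv_mul_le_iff₀ hp, ← integral_exp_neg_sq,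
    ← integral_mul_const]
  rw [← Real.norm_eq_abs]
  refine norm_integral_le_of_norm_le (integrable_exp_neg_sq.mul_const C)
    (Eventually.of_forall fun w => ?_)
  rw [norm_mul, mul_comm, Real.norm_eq_abs, Real.norm_eq_abs, abs_of_pos (Real.exp_pos _)]
  exact mul_le_mul_of_nonneg_left (hC _) (Real.exp_pos _).le

/-- The product rule in the form `Φ_σ(p_σ) - Φ_s(p_s) = (Φ_σ - Φ_s)(p_σ) + (Φ_s(p_σ) - Φ_s(p_s))`.
The curve `p` need only be continuous at `s`, provided that its scalar image under the frozen
functional is differentiable. -/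
theorem hasDerivAt_pairing {V : Type*} [NormedAddCommGroup V] [NormedSpace ℝ V]
    {Φ : ℝ → StrongDual ℝ V} {p : ℝ → V} {F : StrongDual ℝ V} {c s : ℝ} (hΦ : HasDerivAt Φ F s)
    (hp : ContinuousAt p s) (hc : HasDerivAt (fun σ => Φ s (p σ)) c s) :
    HasDerivAt (fun σ => Φ σ (p σ)) (F (p s) + c) s := by
  rw [hasDerivAt_iff_tendsto_slope] at hΦ hc ⊢
  have h1 : Tendsto (fun σ => slope Φ s σ (p σ)) (𝓝[≠] s) (𝓝 (F (p s))) :=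
    (isBoundedBilinearMap_apply.continuous.tendsto (F, p s)).comp
      (hΦ.prodMk_nhds (hp.tendsto.mono_left nhdsWithin_le_nhds))
  refine (h1.add hc).congr fun σ => ?_
  simp only [slope_def_module, smul_apply, sub_apply]
  rw [← smul_add]
  congr 1
  ring

theorem ac_pairing {V : Type*} [NormedAddCommGroup V] [NormedSpace ℝ V]
    {Φ : ℝ → StrongDual ℝ V} {p : ℝ → V} {a b : ℝ} (hΦ : AbsolutelyContinuousOnInterval Φ a b)
    (hp : AbsolutelyContinuousOnInterval p a b) :
    AbsolutelyContinuousOnInterval (fun s => Φ s (p s)) a b := by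
  obtain ⟨C, hC⟩ := hΦ.exists_bound
  obtain ⟨D, hD⟩ := hp.exists_bound
  have hC0 : 0 ≤ C := (norm_nonneg _).trans (hC a left_mem_uIcc)
  have hD0 : 0 ≤ D := (norm_nonneg _).trans (hD a left_mem_uIcc)
  refine AbsolutelyContinuousOnInterval.of_dist_le hΦ hp (C := C + D) fun x hx y hy => ?_
  rw [dist_eq_norm, dist_eq_norm, dist_eq_norm]
  have e : Φ x (p x) - Φ y (p y) = (Φ x - Φ y) (p x) + Φ y (p x - p y) := by
    rw [sub_apply, map_sub]; ring
  rw [e]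
  have h1 := ((Φ x - Φ y).le_opNorm (p x)).trans
    (mul_le_mul_of_nonneg_left (hD x hx) (norm_nonneg _))
  have h2 := ((Φ y).le_opNorm (p x - p y)).trans
    (mul_le_mul_of_nonneg_right (hC y hy) (norm_nonneg _))
  have h3 := norm_add_le ((Φ x - Φ y) (p x)) (Φ y (p x - p y))
  nlinarith [norm_nonneg (Φ x - Φ y), norm_nonneg (p x - p y)]

section Heat

variable {T : ℝ} {u : ℝ → ℝ} {Z0 : H1 unitCoeffs} {Z : ℝ → H1 unitCoeffs}

theorem toHneg_heatTest (z : H1 unitCoeffs) (x : ℝ) {τ : ℝ} (hτ : 0 < τ) :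
    H1.toHneg z (heatTest x τ) = ∫ y, H1.rep z y * hk τ (x - y) := by
  rw [H1.toHneg_apply, rep_heatTest x hτ]

theorem functional_heatTest {c : ℝ} {z : H1 unitCoeffs} {F : Hneg unitCoeffs}
    (hφ : ∀ φ : H1 unitCoeffs, F φ = -inner ℝ (H1.D z) (H1.D φ)
      - (∫ x, unitCoeffs.q x * H1.fn z x * H1.fn φ x * unitCoeffs.rho x)
      - 2 * √(unitCoeffs.rho 0 * unitCoeffs.k 0) * c * valueAtZero (H1.fn φ))
    (x : ℝ) {τ : ℝ} (hτ : 0 < τ) :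
    F (heatTest x τ) = (∫ y, H1.repD z y * hkx τ (x - y)) - 2 * c * hk τ x := by
  have e1 : inner ℝ (H1.D z) (H1.D (heatTest x τ)) = -∫ y, H1.repD z y * hkx τ (x - y) := by
    rw [H1.inner_D, ← integral_neg]
    refine integral_congr_ae ?_
    filter_upwards [repD_heatTest x hτ] with y hy
    rw [hy, mul_neg]
  rw [hφ, IsKernel.integral_unit_q, H1.valueAtZero_fn, IsKernel.unit_w4, div_one,
    rep_heatTest x hτ, e1]
  simp [unitCoeffs]

/-- `Z(s)` is paired with the heat kernel of age `t + ε - s`. The contribution of the diffusion and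
that of the ageing of the kernel cancel, only the source term is left, and the pairing is absolutely
continuous, so it is recovered from its derivative. The shift `ε` keeps the kernel a regular test
function up to `s = t`. -/
theorem heat_identity (hZ : IsSolution unitCoeffs T u Z0 Z) {t : ℝ} (ht : t ∈ Ioc 0 T) {ε : ℝ}
    (hε : 0 < ε) (x : ℝ) :
    heatAvg (H1.rep (Z t)) ε x = heatAvg (H1.rep Z0) (t + ε) x -
      2 * ∫ s in (0 : ℝ)..t, u s * hk (t + ε - s) x := by
  obtain ⟨C, hC0, hC⟩ := exists_heatTest_lipschitz x hε (by linarith [ht.1] : ε ≤ t + ε)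
  have hp : LipschitzOnWith C.toNNReal (fun s => heatTest x (t + ε - s)) (Icc 0 t) := by
    refine LipschitzOnWith.of_dist_le_mul fun s hs σ hσ => ?_
    rw [dist_eq_norm, Real.dist_eq, Real.coe_toNNReal C hC0]
    refine (hC _ ⟨by linarith [hs.2], by linarith [hs.1]⟩ _
      ⟨by linarith [hσ.2], by linarith [hσ.1]⟩).trans (le_of_eq ?_)
    rw [show t + ε - s - (t + ε - σ) = σ - s by ring, abs_sub_comm]
  have ac := ac_pairing (V := H1 unitCoeffs)
    (hZ.abs_cont.mono (c := 0) (d := t) (by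
      rw [uIcc_of_le ht.1.le, uIcc_of_le (ht.1.le.trans ht.2)]
      exact Icc_subset_Icc_right ht.2))
    (LipschitzOnWith.absolutelyContinuousOnInterval (a := 0) (b := t) (by
      rw [uIcc_of_le ht.1.le]; exact hp))
  have hd : ∀ᵐ s, s ∈ uIoc 0 t → deriv (fun s => H1.toHneg (Z s) (heatTest x (t + ε - s))) s =
      -2 * (u s * hk (t + ε - s) x) := by
    have h1 : ∀ᵐ s ∂volume.restrict (Ioo 0 t), ∃ F : Hneg unitCoeffs,
        HasDerivAt (fun σ => H1.toHneg (Z σ)) F s ∧ ∀ φ : H1 unitCoeffs, F φ =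
          -inner ℝ (H1.D (Z s)) (H1.D φ)
          - (∫ x, unitCoeffs.q x * H1.fn (Z s) x * H1.fn φ x * unitCoeffs.rho x)
          - 2 * √(unitCoeffs.rho 0 * unitCoeffs.k 0) * u s * valueAtZero (H1.fn φ) :=
      ae_restrict_of_ae_restrict_of_subset (Ioo_subset_Ioo_right ht.2) hZ.equation
    rw [uIoc_of_le ht.1.le]
    rw [Measure.restrict_congr_set Ioo_ae_eq_Ioc, ae_restrict_iff' measurableSet_Ioc] at h1
    filter_upwards [h1, Measure.ae_ne volume t] with s hs hst hmem
    obtain ⟨F, hF, hφ⟩ := hs hmem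
    have hs2 : s < t := lt_of_le_of_ne hmem.2 hst
    have hpos : 0 < t + ε - s := by linarith
    have hcont : ContinuousAt (fun σ => heatTest x (t + ε - σ)) s :=
      (hp.continuousOn s ⟨hmem.1.le, hmem.2⟩).continuousAt (Icc_mem_nhds hmem.1 hs2)
    have hder : HasDerivAt (fun σ => H1.toHneg (Z s) (heatTest x (t + ε - σ)))
        (-∫ y, H1.repD (Z s) y * hkx (t + ε - s) (x - y)) s := by
      have h2 := (hasDerivAt_integral_hk (H1.lineH1_rep (Z s)) x hpos).comp_const_sub (t + ε) s
      refine h2.congr_of_eventuallyEq ?_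
      filter_upwards [Iio_mem_nhds hs2] with σ hσ
      exact toHneg_heatTest _ _ (by linarith [mem_Iio.1 hσ])
    have h3 := hasDerivAt_pairing (V := H1 unitCoeffs) hF hcont hder
    rw [functional_heatTest hφ x hpos] at h3
    rw [h3.deriv]
    ring
  have e := ac.integral_deriv_eq_sub
  rw [intervalIntegral.integral_congr_ae hd, intervalIntegral.integral_const_mul] at e
  simp only [sub_zero, add_sub_cancel_left] at e
  rw [toHneg_heatTest _ _ hε, toHneg_heatTest _ _ (by linarith [ht.1] : 0 < t + ε),
    integral_mul_hk _ hε, integral_mul_hk _ (by linarith [ht.1] : 0 < t + ε), hZ.initial] at e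
  linarith

theorem hk_le_inv_sqrt (τ x : ℝ) (hτ : 0 ≤ τ) : hk τ x ≤ (√(4 * Real.pi))⁻¹ * (√τ)⁻¹ := by
  rw [hk, ← mul_inv, ← Real.sqrt_mul (by positivity), ← one_div]
  refine div_le_div_of_nonneg_right ?_ (Real.sqrt_nonneg _)
  rw [Real.exp_le_one_iff]
  exact div_nonpos_of_nonpos_of_nonneg (by nlinarith [sq_nonneg x]) (by positivity)

theorem ae_abs_le_Ioc (hu : MemLp u ⊤ (volume.restrict (Ioo 0 T))) {t : ℝ} (ht : t ≤ T) :
    ∀ᵐ s, s ∈ Ioc 0 t → |u s| ≤ normLinfty T u := by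
  have h1 := ae_restrict_of_ae_restrict_of_subset (Ioo_subset_Ioo_right ht) (ae_abs_le_normLinfty hu)
  rwa [Measure.restrict_congr_set Ioo_ae_eq_Ioc, ae_restrict_iff' measurableSet_Ioc] at h1

theorem aestronglyMeasurable_Ioc (hu : MemLp u ⊤ (volume.restrict (Ioo 0 T))) {t : ℝ} (ht : t ≤ T) :
    AEStronglyMeasurable u (volume.restrict (Ioc 0 t)) := by
  rw [← Measure.restrict_congr_set Ioo_ae_eq_Ioc]
  exact hu.1.mono_measure (Measure.restrict_mono (Ioo_subset_Ioo_right ht) le_rfl)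

/-- Duhamel's formula. -/
theorem heat_formula (hu : MemLp u ⊤ (volume.restrict (Ioo 0 T)))
    (hZ : IsSolution unitCoeffs T u Z0 Z) {t : ℝ} (ht : t ∈ Ioc 0 T) (x : ℝ) :
    H1.rep (Z t) x = heatAvg (H1.rep Z0) t x - 2 * ∫ s in (0 : ℝ)..t, u (t - s) * hk s x := by
  have hc : ∀ (p : H1 unitCoeffs) (τ : ℝ), Tendsto (fun ε : ℝ => heatAvg (H1.rep p) (τ + ε) x)
      (𝓝[>] 0) (𝓝 (heatAvg (H1.rep p) τ x)) := fun p τ => by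
    have h := (continuous_heatAvg (H1.lineH1_rep p).continuous (H1.abs_rep_le p)).comp
      (by fun_prop : Continuous fun ε : ℝ => (τ + ε, x))
    have h2 := h.tendsto 0
    simp only [Function.comp_def, add_zero] at h2
    exact h2.mono_left nhdsWithin_le_nhds
  have h1 := hc (Z t) 0
  simp only [zero_add, heatAvg_zero] at h1
  have h2 := hc Z0 t
  have hs1 : Continuous fun s : ℝ => t - s := by fun_prop
  -- For all `ε > 0` the integrand is dominated by a multiple of `(t - s)^{-1/2}`, which is
  -- integrable and independent of `ε`.
  have h3 : Tendsto (fun ε => ∫ s in (0 : ℝ)..t, u s * hk (t + ε - s) x) (𝓝[>] 0)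
      (𝓝 (∫ s in (0 : ℝ)..t, u s * hk (t - s) x)) := by
    refine intervalIntegral.tendsto_integral_filter_of_dominated_convergence
      (fun s => normLinfty T u * ((√(4 * Real.pi))⁻¹ * (√(t - s))⁻¹)) ?_ ?_ ?_ ?_
    · refine Eventually.of_forall fun ε => ?_
      rw [uIoc_of_le ht.1.le]
      refine (aestronglyMeasurable_Ioc hu ht.2).mul (Measurable.aestronglyMeasurable ?_)
      unfold hk; fun_prop
    · filter_upwards [self_mem_nhdsWithin] with ε hε
      filter_upwards [ae_abs_le_Ioc hu ht.2, Measure.ae_ne volume t] with s hs hst hmem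
      rw [uIoc_of_le ht.1.le] at hmem
      have hε' : 0 < ε := hε
      rw [norm_mul, Real.norm_eq_abs, Real.norm_eq_abs, abs_of_nonneg (hk_nonneg _ _)]
      refine mul_le_mul (hs hmem) ((hk_le_inv_sqrt _ _ (by linarith [hmem.2])).trans ?_)
        (hk_nonneg _ _) (normLinfty_nonneg _ _)
      refine mul_le_mul_of_nonneg_left ?_ (by positivity)
      have h := lt_of_le_of_ne hmem.2 hst
      exact inv_anti₀ (Real.sqrt_pos.2 (by linarith)) (Real.sqrt_le_sqrt (by linarith))
    · have := ((intervalIntegrable_inv_sqrt t).comp_sub_left t).symm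
      simp only [sub_zero, sub_self] at this
      exact (this.const_mul _).const_mul _
    · filter_upwards [Measure.ae_ne volume t] with s hs hmem
      rw [uIoc_of_le ht.1.le] at hmem
      have hpos : 0 < t - s := by
        have := lt_of_le_of_ne hmem.2 hs
        linarith
      have h4 : Tendsto (fun ε => hk (t + ε - s) x) (𝓝[>] 0) (𝓝 (hk (t - s) x)) := by
        have h5 := (hasDerivAt_hk_time hpos x).continuousAt.tendsto
        have h6 : Tendsto (fun ε : ℝ => t + ε - s) (𝓝[>] 0) (𝓝 (t - s)) := by
          have : Continuous fun ε : ℝ => t + ε - s := by fun_prop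
          have := this.tendsto 0
          rw [add_zero] at this
          exact this.mono_left nhdsWithin_le_nhds
        exact h5.comp h6
      exact h4.const_mul _
  have h4 := h2.sub (h3.const_mul 2)
  have h5 : Tendsto (fun ε : ℝ => heatAvg (H1.rep (Z t)) ε x) (𝓝[>] 0)
      (𝓝 (heatAvg (H1.rep Z0) t x - 2 * ∫ s in (0 : ℝ)..t, u s * hk (t - s) x)) := by
    refine h4.congr' ?_
    filter_upwards [self_mem_nhdsWithin] with ε hε
    exact (heat_identity hZ ht hε x).symm
  rw [tendsto_nhds_unique h1 h5]
  have e := intervalIntegral.integral_comp_sub_left (a := 0) (b := t)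
    (fun s => u s * hk (t - s) x) t
  simp only [sub_sub_cancel, sub_self, sub_zero] at e
  rw [e]

end Heat

/-! ### Estimates of the two terms in Duhamel's formula -/

theorem abs_integral_mul_le {α : Type*} [MeasurableSpace α] {μ : Measure α} {f g : α → ℝ}
    (hf : MemLp f 2 μ) (hg : MemLp g 2 μ) {A B : ℝ} (hA : 0 ≤ A) (hB : 0 ≤ B)
    (h1 : ∫ x, f x ^ 2 ∂μ ≤ A ^ 2) (h2 : ∫ x, g x ^ 2 ∂μ ≤ B ^ 2) :
    |∫ x, f x * g x ∂μ| ≤ A * B := by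
  refine abs_le_of_sq_le_sq ?_ (by positivity)
  refine (sq_integral_mul_le hf hg).trans ?_
  rw [mul_pow]
  exact mul_le_mul h1 h2 (integral_nonneg fun _ => sq_nonneg _) (sq_nonneg A)

/-- The heat semigroup contracts `L²`: Cauchy–Schwarz against the normalized Gaussian bounds the
square of the average by the average of the square, and the latter has the integral of `z²` by
Fubini and translation invariance. -/
theorem heatAvg_sq_bound {z : ℝ → ℝ} (hc : Continuous z) (hz : MemLp z 2) {C : ℝ}
    (hC : ∀ x, |z x| ≤ C) (τ : ℝ) :
    MemLp (heatAvg z τ) 2 ∧ ∫ x, heatAvg z τ x ^ 2 ≤ ∫ x, z x ^ 2 := by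
  have hp := Real.sqrt_pos.2 Real.pi_pos
  set c := 2 * √τ with hcd
  have hg : MemLp (fun w : ℝ => Real.exp (-w ^ 2 / 2)) 2 := memLp_gauss two_pos
  have hg2 : ∀ w : ℝ, Real.exp (-w ^ 2 / 2) ^ 2 = Real.exp (-w ^ 2) := fun w => by
    rw [← Real.exp_nat_mul]; congr 1; push_cast; ring
  have h1 : ∀ x, heatAvg z τ x ^ 2 ≤ (√Real.pi)⁻¹ * ∫ w, z (x - c * w) ^ 2 * Real.exp (-w ^ 2) := by
    intro x
    have hf : MemLp (fun w : ℝ => z (x - c * w) * Real.exp (-w ^ 2 / 2)) 2 := by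
      refine hg.of_le_mul (c := C) (by fun_prop) (Eventually.of_forall fun w => ?_)
      rw [norm_mul]
      exact mul_le_mul_of_nonneg_right (hC _) (norm_nonneg _)
    have h2 := sq_integral_mul_le hf hg
    simp only [mul_pow, hg2, mul_assoc, ← sq] at h2
    rw [integral_exp_neg_sq] at h2
    rw [heatAvg, mul_pow, ← hcd]
    calc _ ≤ ((√Real.pi)⁻¹) ^ 2 * ((∫ w, z (x - c * w) ^ 2 * Real.exp (-w ^ 2)) * √Real.pi) :=
          mul_le_mul_of_nonneg_left h2 (by positivity)
      _ = _ := by field_simp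
  have hm : AEStronglyMeasurable (fun p : ℝ × ℝ => z (p.1 - c * p.2) ^ 2 * Real.exp (-p.2 ^ 2))
      (volume.prod volume) :=
    (by fun_prop : Continuous fun p : ℝ × ℝ => z (p.1 - c * p.2) ^ 2 * Real.exp (-p.2 ^ 2)).aestronglyMeasurable
  have hshift : ∀ w, ∫ x, z (x - c * w) ^ 2 * Real.exp (-w ^ 2) =
      (∫ x, z x ^ 2) * Real.exp (-w ^ 2) := fun w => by
    rw [integral_mul_const, integral_sub_right_eq_self (fun x => z x ^ 2)]
  have hi : Integrable (fun p : ℝ × ℝ => z (p.1 - c * p.2) ^ 2 * Real.exp (-p.2 ^ 2))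
      (volume.prod volume) := by
    rw [integrable_prod_iff' hm]
    refine ⟨Eventually.of_forall fun w => (hz.integrable_sq.comp_sub_right (c * w)).mul_const
      (Real.exp (-w ^ 2)), ?_⟩
    refine (integrable_exp_neg_sq.const_mul (∫ x, z x ^ 2)).congr (Eventually.of_forall fun w => ?_)
    simp only
    rw [← hshift w]
    refine integral_congr_ae (Eventually.of_forall fun x => ?_)
    simp only
    rw [Real.norm_of_nonneg (by positivity)]
  have h3 : ∫ x, (√Real.pi)⁻¹ * ∫ w, z (x - c * w) ^ 2 * Real.exp (-w ^ 2) = ∫ x, z x ^ 2 := by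
    rw [integral_const_mul, integral_integral_swap hi]
    simp only [hshift]
    rw [integral_const_mul, integral_exp_neg_sq]
    field_simp
  have hcont : Continuous (heatAvg z τ) :=
    (continuous_heatAvg hc hC).comp (by fun_prop : Continuous fun x : ℝ => (τ, x))
  constructor
  · rw [memLp_two_iff_integrable_sq hcont.aestronglyMeasurable]
    refine (hi.integral_prod_left.const_mul (√Real.pi)⁻¹).mono'
      (hcont.pow 2).aestronglyMeasurable (Eventually.of_forall fun x => ?_)
    rw [Real.norm_of_nonneg (sq_nonneg _)]
    exact h1 x
  · rw [← h3]
    exact integral_mono_of_nonneg (Eventually.of_forall fun _ => sq_nonneg _)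
      (hi.integral_prod_left.const_mul _) (Eventually.of_forall h1)

section Heat

variable {T : ℝ} {u : ℝ → ℝ} {Z0 : H1 unitCoeffs} {Z : ℝ → H1 unitCoeffs}

theorem ae_abs_le_reflect (hu : MemLp u ⊤ (volume.restrict (Ioo 0 T))) {t : ℝ} (ht : t ≤ T) :
    ∀ᵐ s, s ∈ Ioc 0 t → |u (t - s)| ≤ normLinfty T u := by
  have h := (Measure.measurePreserving_sub_left volume t).quasiMeasurePreserving.ae
    (ae_abs_le_Ioc hu ht)
  filter_upwards [h, Measure.ae_ne volume t] with s hs hst hmem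
  exact hs ⟨by linarith [lt_of_le_of_ne hmem.2 hst], by linarith [hmem.1]⟩

theorem hk_le_gauss {s : ℝ} (hs : 0 < s) (hsT : s ≤ T) (x : ℝ) :
    hk s x ≤ (√(4 * Real.pi))⁻¹ * Real.exp (-x ^ 2 / (4 * T)) * (√s)⁻¹ := by
  have e1 : Real.exp (-x ^ 2 / (4 * s)) ≤ Real.exp (-x ^ 2 / (4 * T)) := by
    apply Real.exp_le_exp.2
    rw [neg_div, neg_div, neg_le_neg_iff]
    exact div_le_div_of_nonneg_left (sq_nonneg x) (by positivity) (by linarith)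
  rw [hk, Real.sqrt_mul (by positivity), div_eq_mul_inv, mul_inv]
  calc _ ≤ Real.exp (-x ^ 2 / (4 * T)) * ((√(4 * Real.pi))⁻¹ * (√s)⁻¹) :=
        mul_le_mul_of_nonneg_right e1 (by positivity)
    _ = _ := by ring

/-- The contribution of the control to the solution of the heat equation. -/
def duhamel (u : ℝ → ℝ) (t x : ℝ) : ℝ := 2 * ∫ s in (0 : ℝ)..t, u (t - s) * hk s x

/-- For `s ≤ T` the heat kernel is at most `(4πs)^{-1/2} e^{-x²/(4T)}`, which separates the
variables. The remaining integral of `s^{-1/2}` is `2 √t`, so the bound both decays in `x` and gives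
the constant at `x = 0`. -/
theorem abs_duhamel_le (hu : MemLp u ⊤ (volume.restrict (Ioo 0 T))) {t : ℝ} (ht : t ∈ Ioc 0 T)
    (x : ℝ) : |duhamel u t x| ≤
      2 * √T / √Real.pi * normLinfty T u * Real.exp (-x ^ 2 / (4 * T)) := by
  have hp := Real.sqrt_pos.2 Real.pi_pos
  set c := normLinfty T u * ((√(4 * Real.pi))⁻¹ * Real.exp (-x ^ 2 / (4 * T))) with hc
  have h4 : √(4 * Real.pi) = 2 * √Real.pi := by
    rw [Real.sqrt_mul (by norm_num), show (4 : ℝ) = 2 ^ 2 by norm_num, Real.sqrt_sq (by norm_num)]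
  have h1 : |∫ s in (0 : ℝ)..t, u (t - s) * hk s x| ≤ ∫ s in (0 : ℝ)..t, c * (√s)⁻¹ := by
    rw [← Real.norm_eq_abs]
    refine intervalIntegral.norm_integral_le_of_norm_le ht.1.le ?_
      ((intervalIntegrable_inv_sqrt t).const_mul c)
    filter_upwards [ae_abs_le_reflect hu ht.2] with s hs hmem
    rw [norm_mul, Real.norm_eq_abs, Real.norm_eq_abs, abs_of_nonneg (hk_nonneg _ _), hc, mul_assoc]
    exact mul_le_mul (hs hmem) (hk_le_gauss hmem.1 (hmem.2.trans ht.2) x) (hk_nonneg _ _)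
      (normLinfty_nonneg _ _)
  rw [intervalIntegral.integral_const_mul, integral_inv_sqrt ht.1.le] at h1
  have hc0 : 0 ≤ c := by have := normLinfty_nonneg T u; positivity
  have h2 : c * (2 * √t) ≤ c * (2 * √T) :=
    mul_le_mul_of_nonneg_left (by linarith [Real.sqrt_le_sqrt ht.2]) hc0
  rw [duhamel, abs_mul, abs_two]
  calc _ ≤ 2 * (c * (2 * √T)) := mul_le_mul_of_nonneg_left (h1.trans h2) two_pos.le
    _ = _ := by rw [hc, h4]; field_simp

theorem heat_formula' (hu : MemLp u ⊤ (volume.restrict (Ioo 0 T)))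
    (hZ : IsSolution unitCoeffs T u Z0 Z) {t : ℝ} (ht : t ∈ Ioc 0 T) (x : ℝ) :
    H1.rep (Z t) x = heatAvg (H1.rep Z0) t x - duhamel u t x := heat_formula hu hZ ht x

theorem memLp_heatAvg (p : H1 unitCoeffs) (τ : ℝ) : MemLp (heatAvg (H1.rep p) τ) 2 :=
  (heatAvg_sq_bound (H1.lineH1_rep p).continuous (H1.lineH1_rep p).memLp (H1.abs_rep_le p) τ).1

theorem integral_heatAvg_sq_le (p : H1 unitCoeffs) (τ : ℝ) :
    ∫ x in Ioi 0, heatAvg (H1.rep p) τ x ^ 2 ≤ ‖p‖ ^ 2 := by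
  refine (setIntegral_le_integral (memLp_heatAvg p τ).integrable_sq
    (Eventually.of_forall fun _ => sq_nonneg _)).trans ?_
  refine (heatAvg_sq_bound (H1.lineH1_rep p).continuous (H1.lineH1_rep p).memLp
    (H1.abs_rep_le p) τ).2.trans ?_
  rw [H1.norm_sq, energy]
  have : 0 ≤ ∫ x, H1.repD p x ^ 2 := integral_nonneg fun _ => sq_nonneg _
  linarith

/-- The origin of the factor `T + 3`: the left side comes from the squared `L²` norm of the Duhamel
bound. The comparison is tightest at `T = 9`, where `2πT` is near `49`, and the square root is
replaced by its tangent there. With `2π ≤ 6.3` it remains that `T²/10 - T + 9` is nonnegative. -/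
theorem sqrt_bound {T : ℝ} (hT : 0 < T) : 4 * T * (√(2 * Real.pi * T) / 2) ≤ (T + 3) ^ 2 := by
  have h1 : √(2 * Real.pi * T) ≤ (2 * Real.pi * T / 7 + 7) / 2 := by
    rw [Real.sqrt_le_left (by positivity)]
    nlinarith [sq_nonneg (2 * Real.pi * T - 49)]
  have h2 : 2 * Real.pi * T ≤ 6.3 * T := by nlinarith [Real.pi_lt_d2]
  nlinarith [sq_nonneg (T - 9), mul_le_mul_of_nonneg_left h2 hT.le,
    mul_le_mul_of_nonneg_left h1 hT.le]

theorem integral_exp_sq (hT : 0 < T) :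
    ∫ x in Ioi 0, Real.exp (-x ^ 2 / (4 * T)) ^ 2 = √(2 * Real.pi * T) / 2 := by
  have h := integral_gaussian_Ioi (1 / (2 * T))
  rw [show Real.pi / (1 / (2 * T)) = 2 * Real.pi * T by field_simp] at h
  rw [← h]
  refine setIntegral_congr_fun measurableSet_Ioi fun x _ => ?_
  rw [← Real.exp_nat_mul]; congr 1; push_cast; field_simp; ring

theorem integral_duhamel_sq_le (hT : 0 < T) (hu : MemLp u ⊤ (volume.restrict (Ioo 0 T))) {t : ℝ}
    (ht : t ∈ Ioc 0 T) :
    ∫ x in Ioi 0, duhamel u t x ^ 2 ≤ ((T + 3) / √Real.pi * normLinfty T u) ^ 2 := by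
  have hp := Real.sqrt_pos.2 Real.pi_pos
  have hg := ((memLp_gauss (b := 4 * T) (by positivity)).restrict (Ioi 0)).integrable_sq
  calc ∫ x in Ioi 0, duhamel u t x ^ 2
      ≤ ∫ x in Ioi 0, (2 * √T / √Real.pi * normLinfty T u) ^ 2 * Real.exp (-x ^ 2 / (4 * T)) ^ 2 := by
        refine integral_mono_of_nonneg (Eventually.of_forall fun _ => sq_nonneg _)
          (hg.const_mul _) (Eventually.of_forall fun x => ?_)
        simp only
        rw [← mul_pow, ← sq_abs]
        exact pow_le_pow_left₀ (abs_nonneg _) (abs_duhamel_le hu ht x) 2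
    _ = (normLinfty T u / √Real.pi) ^ 2 * (4 * T * (√(2 * Real.pi * T) / 2)) := by
        rw [integral_const_mul, integral_exp_sq hT]
        have : √T ^ 2 = T := Real.sq_sqrt hT.le
        rw [mul_pow, div_pow, mul_pow, this]
        ring
    _ ≤ (normLinfty T u / √Real.pi) ^ 2 * (T + 3) ^ 2 :=
        mul_le_mul_of_nonneg_left (sqrt_bound hT) (sq_nonneg _)
    _ = _ := by ring

theorem continuous_toHneg_projIcc (hT : 0 < T) (hZ : IsSolution unitCoeffs T u Z0 Z)
    (p : H1 unitCoeffs) : Continuous fun t => H1.toHneg (Z (projIcc 0 T hT.le t)) p := by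
  have h : AbsolutelyContinuousOnInterval (fun t => H1.toHneg (Z t) p) 0 T :=
    AbsolutelyContinuousOnInterval.of_clm (V := Hneg unitCoeffs) hZ.abs_cont
      (ContinuousLinearMap.apply ℝ ℝ p) fun t _ => rfl
  have h1 := h.continuousOn
  rw [uIcc_of_le hT.le] at h1
  exact h1.comp_continuous (continuous_subtype_val.comp continuous_projIcc)
    fun t => Subtype.coe_prop _

theorem measurable_uncurry_swap {ζ : ℝ → ℝ → ℝ} (h : Measurable (Function.uncurry fun x t => ζ t x)) :
    Measurable (Function.uncurry ζ) := h.comp measurable_swap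

/-- A solution comes with no joint measurability in time and space. Its value at `x` is the limit of
its pairings with heat kernels concentrating at `x`, which are continuous in time; continuity in `x`
then makes the function jointly measurable. Times are clamped to `[0,T]` to have it on the whole
line. -/
theorem exists_measurable_rep (hT : 0 < T) (hZ : IsSolution unitCoeffs T u Z0 Z) :
    ∃ ζ : ℝ → ℝ → ℝ, Measurable (Function.uncurry ζ) ∧ ∀ t ∈ Icc 0 T, H1.rep (Z t) = ζ t := by
  refine ⟨fun t => H1.rep (Z (projIcc 0 T hT.le t)), measurable_uncurry_swap ?_, fun t ht => by
    simp only; rw [projIcc_of_mem hT.le ht]⟩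
  refine measurable_uncurry_of_continuous_of_measurable
    (fun t => (H1.lineH1_rep _).continuous) fun x => ?_
  refine measurable_of_tendsto_metrizable (f := fun (n : ℕ) t =>
    H1.toHneg (Z (projIcc 0 T hT.le t)) (heatTest x (1 / ((n : ℝ) + 1)))) (fun n => ?_) ?_
  · exact (continuous_toHneg_projIcc hT hZ _).measurable
  · rw [tendsto_pi_nhds]
    intro t
    have hc := (continuous_heatAvg (H1.lineH1_rep (Z (projIcc 0 T hT.le t))).continuous
      (H1.abs_rep_le _)).comp (by fun_prop : Continuous fun ε : ℝ => (ε, x))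
    have h2 := (hc.tendsto 0).comp (tendsto_one_div_add_atTop_nhds_zero_nat (𝕜 := ℝ))
    simp only [Function.comp_def, heatAvg_zero] at h2
    refine h2.congr fun n => ?_
    have hn : (0 : ℝ) < 1 / ((n : ℝ) + 1) := by positivity
    rw [toHneg_heatTest _ _ hn, integral_mul_hk _ hn]

theorem measurable_feedback {r : ℝ → ℝ} {K : ℝ → ℝ → ℝ} (hr : Pot r) (hK : IsKernel r K)
    {ζ : ℝ → ℝ → ℝ} (hm : Measurable (Function.uncurry ζ)) :
    Measurable fun t => IsKernel.feedback r K (ζ t) := by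
  have h0 : Measurable fun t => ζ t 0 := hm.comp (measurable_id.prodMk measurable_const)
  have hk : Measurable fun p : ℝ × ℝ => IsKernel.k1 r K 0 p.2 * ζ p.1 p.2 :=
    ((hK.continuous_k1 hr).measurable.comp (measurable_const.prodMk measurable_snd)).mul hm
  have h1 : Measurable fun t => Up (IsKernel.k1 r K) (ζ t) 0 :=
    (hk.stronglyMeasurable.integral_prod_right' (ν := volume.restrict (Ioi 0))).measurable
  exact h1.sub ((measurable_const.mul h0).mul measurable_const)

end Heat

/-! ### The trace of the kernel and the bound of the control -/

/-- The norm of `K_{y₁}(0, ·)` in `L²(0,∞)`. -/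
def kappa (r : ℝ → ℝ) (K : ℝ → ℝ → ℝ) : ℝ := √(∫ b in Ioi 0, IsKernel.k1 r K 0 b ^ 2)

theorem kappa_nonneg (r : ℝ → ℝ) (K : ℝ → ℝ → ℝ) : 0 ≤ kappa r K := Real.sqrt_nonneg _

section Trace

variable {r : ℝ → ℝ} {K : ℝ → ℝ → ℝ}

theorem Pot.abs_le_Linfty (hr : Pot r) {x : ℝ} (hx : 0 ≤ x) :
    |r x| ≤ (eLpNorm r ⊤ (volume.restrict (Ioi 0))).toReal := by
  obtain ⟨C, hC⟩ := hr.bounded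
  have hm : MemLp r ⊤ (volume.restrict (Ioi 0)) :=
    memLp_top_of_bound hr.continuous.aestronglyMeasurable C (Eventually.of_forall hC)
  refine Coeffs.abs_le_of_ae_Ioi hr.continuous ?_ hx
  have hfin := hm.2
  rw [eLpNorm_exponent_top] at hfin ⊢
  filter_upwards [ae_le_eLpNormEssSup (f := r) (μ := volume.restrict (Ioi 0))] with s hs
  have := ENNReal.toReal_mono hfin.ne hs
  simpa using this

/-- Squaring the estimate of `K_{y₁}` gives at most `⅛ r² + 2 M₁² σ₀²` at `b/2`. One factor is then
estimated by its supremum, `|r| ≤ 16 R₀` or `σ₀ ≤ σ₀(0)`, and the other is integrated, with `∫ σ₀ ≤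
R`. The substitution `b = 2x` doubles the result, which explains the normalization of `R₀`. -/
theorem kernelTrace_sq_bound (hr : Pot r) (hK : IsKernel r K) {M1 : ℝ} (hM : KernelBound r K M1) :
    MemLp (fun b => IsKernel.k1 r K 0 b) 2 (volume.restrict (Ioi 0)) ∧
      ∫ b in Ioi 0, IsKernel.k1 r K 0 b ^ 2 ≤ 4 * (sigma0 r 0 * (R0 r + M1 ^ 2 * R r)) := by
  set B := (eLpNorm r ⊤ (volume.restrict (Ioi 0))).toReal with hB
  have hs := Pot.sigma0_nonneg r
  have hc : Continuous fun b => IsKernel.k1 r K 0 b :=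
    (hK.continuous_k1 hr).comp (by fun_prop : Continuous fun b : ℝ => ((0 : ℝ), b))
  set v : ℝ → ℝ := fun x => 1 / 8 * (B * |r x|) + 2 * M1 ^ 2 * (sigma0 r 0 * sigma0 r x) with hv
  have hvi : IntegrableOn v (Ioi 0) :=
    ((hr.integrableOn.abs.const_mul B).const_mul (1 / 8)).add
      ((hr.sigma0_integrableOn.const_mul (sigma0 r 0)).const_mul (2 * M1 ^ 2))
  have hle : ∀ b ∈ Ioi (0 : ℝ), IsKernel.k1 r K 0 b ^ 2 ≤ v (b / 2) := fun b hb => by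
    have hb' : (0 : ℝ) < b := hb
    have h1 := hK.abs_k1_zero_le hr hM hb'
    have h2 := hr.abs_le_Linfty (half_pos hb').le
    have h3 := hr.sigma0_anti (half_pos hb').le
    rw [← sq_abs]
    calc |IsKernel.k1 r K 0 b| ^ 2 ≤ (1 / 4 * |r (b / 2)| + M1 * sigma0 r (b / 2)) ^ 2 :=
          pow_le_pow_left₀ (abs_nonneg _) h1 2
      _ ≤ 1 / 8 * (|r (b / 2)| * |r (b / 2)|) +
          2 * M1 ^ 2 * (sigma0 r (b / 2) * sigma0 r (b / 2)) := by
          nlinarith [sq_nonneg (1 / 4 * |r (b / 2)| - M1 * sigma0 r (b / 2))]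
      _ ≤ v (b / 2) := by
          rw [hv]
          exact add_le_add
            (mul_le_mul_of_nonneg_left (mul_le_mul_of_nonneg_right h2 (abs_nonneg _)) (by norm_num))
            (mul_le_mul_of_nonneg_left (mul_le_mul_of_nonneg_right h3 (hs _)) (by positivity))
  have hint : IntegrableOn (fun b => IsKernel.k1 r K 0 b ^ 2) (Ioi 0) :=
    Integrable.mono' (integrableOn_comp_half hvi) (hc.pow 2).aestronglyMeasurable
      (by filter_upwards [ae_restrict_mem measurableSet_Ioi] with b hb
          rw [Real.norm_of_nonneg (sq_nonneg _)]
          exact hle b hb)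
  refine ⟨(memLp_two_iff_integrable_sq hc.aestronglyMeasurable).2 hint, ?_⟩
  calc ∫ b in Ioi 0, IsKernel.k1 r K 0 b ^ 2 ≤ ∫ b in Ioi 0, v (b / 2) :=
        setIntegral_mono_on hint (integrableOn_comp_half hvi) measurableSet_Ioi hle
    _ = 2 * (1 / 8 * (B * sigma0 r 0) + 2 * M1 ^ 2 * (sigma0 r 0 * ∫ x in Ioi 0, sigma0 r x)) := by
        rw [integral_comp_half, hv, integral_add ((hr.integrableOn.abs.const_mul B).const_mul (1 / 8))
          ((hr.sigma0_integrableOn.const_mul (sigma0 r 0)).const_mul (2 * M1 ^ 2))]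
        simp only [integral_const_mul]
        rfl
    _ ≤ 2 * (1 / 8 * (B * sigma0 r 0) + 2 * M1 ^ 2 * (sigma0 r 0 * R r)) := by
        have := mul_le_mul_of_nonneg_left hr.integral_Ioi_sigma0_le (hs 0)
        have := mul_le_mul_of_nonneg_left this (sq_nonneg M1)
        linarith
    _ = _ := by rw [R0, ← hB]; ring

theorem kappa_le (hr : Pot r) (hK : IsKernel r K) {M1 : ℝ} (hM : KernelBound r K M1) :
    kappa r K ≤ 2 * √(sigma0 r 0) * √(R0 r + M1 ^ 2 * R r) := by
  have h := (kernelTrace_sq_bound hr hK hM).2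
  rw [kappa, mul_assoc, ← Real.sqrt_mul (Pot.sigma0_nonneg _ _)]
  refine (Real.sqrt_le_sqrt h).trans (le_of_eq ?_)
  rw [Real.sqrt_mul (by norm_num), show (4 : ℝ) = 2 ^ 2 by norm_num, Real.sqrt_sq (by norm_num)]

end Trace

section Heat

variable {T : ℝ} {u : ℝ → ℝ} {Z0 : H1 unitCoeffs} {Z : ℝ → H1 unitCoeffs}
  {r : ℝ → ℝ} {K : ℝ → ℝ → ℝ}

theorem abs_Up_le (hT : 0 < T) (hu : MemLp u ⊤ (volume.restrict (Ioo 0 T)))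
    (hZ : IsSolution unitCoeffs T u Z0 Z) (hr : Pot r) (hK : IsKernel r K) {M1 : ℝ}
    (hM : KernelBound r K M1) {t : ℝ} (ht : t ∈ Ioc 0 T) :
    |Up (IsKernel.k1 r K) (H1.rep (Z t)) 0| ≤
      kappa r K * (‖Z0‖ + (T + 3) / √Real.pi * normLinfty T u) := by
  have mk := (kernelTrace_sq_bound hr hK hM).1
  have hk : ∫ b in Ioi 0, IsKernel.k1 r K 0 b ^ 2 ≤ kappa r K ^ 2 := by
    rw [kappa, Real.sq_sqrt (integral_nonneg fun _ => sq_nonneg _)]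
  have ma := (memLp_heatAvg Z0 t).restrict (Ioi 0)
  have mz := (H1.lineH1_rep (Z t)).memLp.restrict (Ioi 0)
  have mb : MemLp (duhamel u t) 2 (volume.restrict (Ioi 0)) := by
    refine (ma.sub mz).ae_eq (Eventually.of_forall fun x => ?_)
    simp only [Pi.sub_apply]
    rw [heat_formula' hu hZ ht x]
    ring
  have h1 := abs_integral_mul_le mk ma (kappa_nonneg r K) (norm_nonneg Z0) hk
    (integral_heatAvg_sq_le Z0 t)
  have hM0 := normLinfty_nonneg T u
  have h2 := abs_integral_mul_le mk mb (kappa_nonneg r K)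
    (B := (T + 3) / √Real.pi * normLinfty T u) (by positivity) hk (integral_duhamel_sq_le hT hu ht)
  have i1 : IntegrableOn (fun b => IsKernel.k1 r K 0 b * heatAvg (H1.rep Z0) t b) (Ioi 0) :=
    mk.integrable_mul ma
  have i2 : IntegrableOn (fun b => IsKernel.k1 r K 0 b * duhamel u t b) (Ioi 0) :=
    mk.integrable_mul mb
  have e : Up (IsKernel.k1 r K) (H1.rep (Z t)) 0 =
      (∫ b in Ioi 0, IsKernel.k1 r K 0 b * heatAvg (H1.rep Z0) t b) -
        ∫ b in Ioi 0, IsKernel.k1 r K 0 b * duhamel u t b := by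
    rw [← integral_sub i1 i2, Up]
    refine setIntegral_congr_fun measurableSet_Ioi fun b _ => ?_
    rw [heat_formula' hu hZ ht b]
    ring
  rw [e, mul_add]
  exact (abs_sub _ _).trans (add_le_add h1 h2)

theorem abs_rep_zero_le (hu : MemLp u ⊤ (volume.restrict (Ioo 0 T)))
    (hZ : IsSolution unitCoeffs T u Z0 Z) {t : ℝ} (ht : t ∈ Ioc 0 T) :
    |H1.rep (Z t) 0| ≤ ‖Z0‖ + 2 * (T + 3) / √(2 * Real.pi) * normLinfty T u := by
  have hT : 0 < T := ht.1.trans_le ht.2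
  have hp := Real.sqrt_pos.2 Real.pi_pos
  have h1 := abs_heatAvg_le (H1.abs_rep_le Z0) t 0
  have h2 := abs_duhamel_le hu ht 0
  -- Replacing `√(2T)` by the larger `T + 3` lets the boundary value share the prefactor of the `L²`
  -- term in `G0`.
  have h3 : 2 * √T / √Real.pi ≤ 2 * (T + 3) / √(2 * Real.pi) := by
    rw [Real.sqrt_mul (by norm_num), div_le_div_iff₀ hp (by positivity)]
    have h4 : √2 * √T ≤ T + 3 := by
      rw [← Real.sqrt_mul (by norm_num), Real.sqrt_le_left (by positivity)]
      nlinarith [sq_nonneg T]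
    nlinarith [mul_le_mul_of_nonneg_right h4 hp.le]
  have h5 := mul_le_mul_of_nonneg_right h3 (normLinfty_nonneg T u)
  simp only [ne_eq, OfNat.ofNat_ne_zero, not_false_eq_true, zero_pow, neg_zero, zero_div,
    Real.exp_zero, mul_one] at h2
  rw [heat_formula' hu hZ ht 0]
  exact (abs_sub _ _).trans (add_le_add h1 (h2.trans h5))

theorem abs_feedback_le (hT : 0 < T) (hu : MemLp u ⊤ (volume.restrict (Ioo 0 T)))
    (hZ : IsSolution unitCoeffs T u Z0 Z) (hr : Pot r) (hK : IsKernel r K) {M1 : ℝ}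
    (hM : KernelBound r K M1) {t : ℝ} (ht : t ∈ Ioc 0 T) :
    |IsKernel.feedback r K (H1.rep (Z t))| ≤
      (T + 3) * (2 * √(sigma0 r 0) / √Real.pi * √(R0 r + M1 ^ 2 * R r)
        + sigma0 r 0 / √(2 * Real.pi)) * normLinfty T u + (kappa r K + sigma0 r 0) * ‖Z0‖ := by
  have h1 := abs_Up_le hT hu hZ hr hK hM ht
  have h2 := abs_rep_zero_le hu hZ ht
  have h3 := Pot.abs_integral_Ioi_le r 0
  have hs := Pot.sigma0_nonneg r 0
  have hM0 := normLinfty_nonneg T u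
  have hp := Real.sqrt_pos.2 Real.pi_pos
  have h4 : |1 / 2 * H1.rep (Z t) 0 * ∫ ξ in Ioi 0, r ξ| ≤
      1 / 2 * (‖Z0‖ + 2 * (T + 3) / √(2 * Real.pi) * normLinfty T u) * sigma0 r 0 := by
    rw [abs_mul, abs_mul, abs_of_pos (by norm_num : (0 : ℝ) < 1 / 2)]
    exact mul_le_mul (mul_le_mul_of_nonneg_left h2 (by norm_num)) h3 (abs_nonneg _)
      (by have := norm_nonneg Z0; positivity)
  have h5 : kappa r K * ((T + 3) / √Real.pi * normLinfty T u) ≤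
      2 * √(sigma0 r 0) * √(R0 r + M1 ^ 2 * R r) * ((T + 3) / √Real.pi * normLinfty T u) :=
    mul_le_mul_of_nonneg_right (kappa_le hr hK hM) (by positivity)
  have h6 : 0 ≤ sigma0 r 0 * ‖Z0‖ := mul_nonneg hs (norm_nonneg _)
  refine (abs_sub _ _).trans ((add_le_add h1 h4).trans ?_)
  have e : (T + 3) * (2 * √(sigma0 r 0) / √Real.pi * √(R0 r + M1 ^ 2 * R r)
        + sigma0 r 0 / √(2 * Real.pi)) * normLinfty T u =
      2 * √(sigma0 r 0) * √(R0 r + M1 ^ 2 * R r) * ((T + 3) / √Real.pi * normLinfty T u) +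
      1 / 2 * (2 * (T + 3) / √(2 * Real.pi) * normLinfty T u) * sigma0 r 0 := by ring
  rw [e]
  linarith

end Heat

section Control

variable {T : ℝ} {u : ℝ → ℝ} {Z0 : H1 unitCoeffs} {Z : ℝ → H1 unitCoeffs}
  {d : Coeffs} {K : ℝ → ℝ → ℝ}

/-- The constant in front of the initial state, in the bound of the control. -/
def E1 (d : Coeffs) (K : ℝ → ℝ → ℝ) : ℝ := (kappa d.r K + sigma0 d.r 0) / d.w4 0 + 1

theorem E1_pos (d : Coeffs) (K : ℝ → ℝ → ℝ) : 0 < E1 d K := by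
  have := kappa_nonneg d.r K
  have := Pot.sigma0_nonneg d.r 0
  have := d.w4_pos 0
  unfold E1
  positivity

theorem ae_abs_newControl_le (hT : 0 < T) (hu : MemLp u ⊤ (volume.restrict (Ioo 0 T)))
    (hZ : IsSolution unitCoeffs T u Z0 Z) (hK : IsKernel d.r K) {M1 : ℝ}
    (hM : KernelBound d.r K M1) :
    ∀ᵐ t ∂volume.restrict (Ioo 0 T), ‖newControl d K u Z t‖ ≤
      G0 d M1 T * normLinfty T u + E1 d K * ‖Z0‖ := by
  have hw := d.w4_pos 0
  filter_upwards [ae_abs_le_normLinfty hu, ae_restrict_mem measurableSet_Ioo] with t h1 ht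
  have h2 := abs_feedback_le hT hu hZ d.pot hK hM ⟨ht.1, ht.2.le⟩
  rw [hK.newControl_eq, norm_div, Real.norm_eq_abs, Real.norm_eq_abs, abs_of_pos hw,
    div_le_iff₀ hw]
  refine (abs_add_le _ _).trans ((add_le_add h1 h2).trans ?_)
  have e : (d.rho 0 * d.k 0) ^ (1 / 4 : ℝ) = d.w4 0 := rfl
  rw [G0, e, E1]
  -- The summand one in `E1` only secures positivity; its nonnegative contribution is discarded.
  have h3 : 0 ≤ ‖Z0‖ * d.w4 0 := by positivity
  have e2 : (1 / d.w4 0 * (1 + (T + 3) * (2 * √(sigma0 d.r 0) / √Real.pi *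
      √(R0 d.r + M1 ^ 2 * R d.r) + sigma0 d.r 0 / √(2 * Real.pi))) * normLinfty T u +
      ((kappa d.r K + sigma0 d.r 0) / d.w4 0 + 1) * ‖Z0‖) * d.w4 0 =
      (1 + (T + 3) * (2 * √(sigma0 d.r 0) / √Real.pi *
      √(R0 d.r + M1 ^ 2 * R d.r) + sigma0 d.r 0 / √(2 * Real.pi))) * normLinfty T u +
      (kappa d.r K + sigma0 d.r 0) * ‖Z0‖ + ‖Z0‖ * d.w4 0 := by
    generalize 1 + (T + 3) * (2 * √(sigma0 d.r 0) / √Real.pi *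
      √(R0 d.r + M1 ^ 2 * R d.r) + sigma0 d.r 0 / √(2 * Real.pi)) = X
    field_simp
    ring
  rw [e2]
  linarith

theorem memLp_newControl (hT : 0 < T) (hu : MemLp u ⊤ (volume.restrict (Ioo 0 T)))
    (hZ : IsSolution unitCoeffs T u Z0 Z) (hK : IsKernel d.r K) {M1 : ℝ}
    (hM : KernelBound d.r K M1) : MemLp (newControl d K u Z) ⊤ (volume.restrict (Ioo 0 T)) := by
  refine memLp_top_of_bound ?_ _ (ae_abs_newControl_le hT hu hZ hK hM)
  obtain ⟨ζ, hm, hζ⟩ := exists_measurable_rep hT hZ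
  have h := (hu.1.add (measurable_feedback d.pot hK hm).aestronglyMeasurable).mul_const (d.w4 0)⁻¹
  refine h.congr ?_
  filter_upwards [ae_restrict_mem measurableSet_Ioo] with t ht
  rw [hK.newControl_eq, Pi.add_apply, hζ t ⟨ht.1.le, ht.2.le⟩, div_eq_mul_inv]

theorem normLinfty_newControl_le (hT : 0 < T) (hu : MemLp u ⊤ (volume.restrict (Ioo 0 T)))
    (hZ : IsSolution unitCoeffs T u Z0 Z) (hK : IsKernel d.r K) {M1 : ℝ}
    (hM : KernelBound d.r K M1) :
    normLinfty T (newControl d K u Z) ≤ G0 d M1 T * normLinfty T u + E1 d K * ‖Z0‖ := by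
  have h := ae_abs_newControl_le hT hu hZ hK hM
  have h0 : 0 ≤ G0 d M1 T * normLinfty T u + E1 d K * ‖Z0‖ := by
    have : NeZero (volume.restrict (Ioo 0 T)) := ⟨by simp [hT]⟩
    obtain ⟨t, ht⟩ := h.exists
    exact (norm_nonneg _).trans ht
  rw [normLinfty, eLpNorm_exponent_top]
  exact ENNReal.toReal_le_of_le_ofReal h0 (eLpNormEssSup_le_of_ae_bound h)

end Control

/-! ### The Poisson-type kernel of the Neumann problem -/

/-- The kernel `(2√π)⁻¹ τ^{-3/2} e^{-1/(4τ)}`. -/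
def pk (τ : ℝ) : ℝ := (2 * √Real.pi)⁻¹ * (τ ^ (-(3 / 2) : ℝ) * Real.exp (-(1 / 4) * τ⁻¹))

/-- The derivative of `pk`. -/
def pkd (τ : ℝ) : ℝ := (1 / (4 * τ ^ 2) - 3 / (2 * τ)) * pk τ

theorem inv_eq_rpow_sq {τ : ℝ} (hτ : 0 < τ) : τ⁻¹ = (τ ^ (-(1 / 2) : ℝ)) ^ 2 := by
  rw [← Real.rpow_natCast, ← Real.rpow_mul hτ.le]
  norm_num
  rw [Real.rpow_neg_one]

theorem integrableOn_rpow_exp {b : ℝ} (hb : 0 < b) :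
    IntegrableOn (fun τ : ℝ => τ ^ (-(3 / 2) : ℝ) * Real.exp (-b * τ⁻¹)) (Ioi 0) := by
  have h := (integrableOn_Ioi_comp_rpow_iff (fun y : ℝ => Real.exp (-b * y ^ 2))
    (p := -(1 / 2)) (by norm_num)).2 (integrable_exp_neg_mul_sq hb).integrableOn
  have h2 : IntegrableOn (fun x : ℝ => 2 * ((|(-(1 / 2) : ℝ)| * x ^ (-(1 / 2) - 1 : ℝ)) •
      Real.exp (-b * (x ^ (-(1 / 2) : ℝ)) ^ 2))) (Ioi 0) := h.const_mul 2
  refine IntegrableOn.congr_fun h2 (fun τ hτ => ?_) measurableSet_Ioi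
  simp only [smul_eq_mul]
  rw [inv_eq_rpow_sq hτ, abs_of_neg (by norm_num : (-(1 / 2) : ℝ) < 0),
    show (-(1 / 2) - 1 : ℝ) = -(3 / 2) by norm_num]
  ring

/-- The substitution `y = τ^{-1/2}` turns `pk` into a Gaussian density on the half-line. -/
theorem integral_pk : ∫ τ in Ioi 0, pk τ = 1 := by
  have h := integral_comp_rpow_Ioi (fun y : ℝ => (√Real.pi)⁻¹ * Real.exp (-(1 / 4) * y ^ 2))
    (p := -(1 / 2)) (by norm_num)
  have hp := Real.sqrt_pos.2 Real.pi_pos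
  rw [integral_const_mul, integral_gaussian_Ioi] at h
  have e : √(Real.pi / (1 / 4)) = 2 * √Real.pi := by
    rw [show Real.pi / (1 / 4) = 2 ^ 2 * Real.pi by ring, Real.sqrt_mul (by norm_num),
      Real.sqrt_sq (by norm_num)]
  rw [e] at h
  have e2 : (√Real.pi)⁻¹ * (2 * √Real.pi / 2) = 1 := by field_simp
  rw [e2] at h
  rw [← h]
  refine setIntegral_congr_fun measurableSet_Ioi fun τ hτ => ?_
  simp only [smul_eq_mul]
  rw [pk, inv_eq_rpow_sq hτ, abs_of_neg (by norm_num : (-(1 / 2) : ℝ) < 0),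
    show (-(1 / 2) - 1 : ℝ) = -(3 / 2) by norm_num, mul_inv]
  ring

theorem hasDerivAt_pk {τ : ℝ} (hτ : 0 < τ) : HasDerivAt pk (pkd τ) τ := by
  have h1 := Real.hasDerivAt_rpow_const (x := τ) (p := -(3 / 2)) (Or.inl hτ.ne')
  have h2 := ((hasDerivAt_inv hτ.ne').const_mul (-(1 / 4))).exp
  refine ((h1.mul h2).const_mul ((2 * √Real.pi)⁻¹)).congr_deriv ?_
  rw [pkd, pk, Real.rpow_sub_one hτ.ne']
  field_simp
  ring

theorem pk_nonneg {τ : ℝ} (hτ : 0 < τ) : 0 ≤ pk τ := by unfold pk; positivity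

theorem measurable_pk : Measurable pk := by unfold pk; fun_prop

theorem measurable_pkd : Measurable pkd := by
  have := measurable_pk
  unfold pkd; fun_prop

theorem abs_mul_pkd_le {τ : ℝ} (hτ : 0 < τ) : |τ * pkd τ| ≤
    3 * (2 * √Real.pi)⁻¹ * (τ ^ (-(3 / 2) : ℝ) * Real.exp (-(1 / 8) * τ⁻¹)) := by
  have hp := Real.sqrt_pos.2 Real.pi_pos
  -- This is half of the exponent of `pk`. One factor `e^{-v}` is kept for integrability near zero,
  -- and the other absorbs the factor `1/(4τ)` through `v e^{-v} ≤ 1`.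
  set v := 1 / 8 * τ⁻¹ with hv
  have hv0 : 0 < v := by positivity
  have h1 : Real.exp (-(1 / 4) * τ⁻¹) = Real.exp (-v) * Real.exp (-v) := by
    rw [← Real.exp_add, hv]; congr 1; ring
  have h2 : v * Real.exp (-v) ≤ 1 := by
    rw [Real.exp_neg, ← div_eq_mul_inv, div_le_one (Real.exp_pos _)]
    linarith [Real.add_one_le_exp v]
  have h2' : Real.exp (-v) ≤ 1 := Real.exp_le_one_iff.2 (by linarith)
  have h3 : τ * pkd τ = (2 * √Real.pi)⁻¹ * τ ^ (-(3 / 2) : ℝ) * Real.exp (-v) *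
      ((2 * v - 3 / 2) * Real.exp (-v)) := by
    rw [pkd, pk, h1, hv]; field_simp; ring
  have h4 : |(2 * v - 3 / 2) * Real.exp (-v)| ≤ 3 := by
    have := mul_pos hv0 (Real.exp_pos (-v))
    have := Real.exp_pos (-v)
    rw [abs_le]
    constructor <;> nlinarith
  have h5 : -(1 / 8) * τ⁻¹ = -v := by rw [hv]; ring
  have h6 : 0 ≤ (2 * √Real.pi)⁻¹ * τ ^ (-(3 / 2) : ℝ) * Real.exp (-v) := by positivity
  rw [h3, h5, abs_mul, abs_of_nonneg h6]
  calc _ ≤ (2 * √Real.pi)⁻¹ * τ ^ (-(3 / 2) : ℝ) * Real.exp (-v) * 3 :=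
        mul_le_mul_of_nonneg_left h4 h6
    _ = _ := by ring

theorem integrableOn_mul_pkd : IntegrableOn (fun τ => τ * pkd τ) (Ioi 0) := by
  refine Integrable.mono' ((integrableOn_rpow_exp (by norm_num : (0 : ℝ) < 1 / 8)).const_mul
    (3 * (2 * √Real.pi)⁻¹)) (measurable_id.mul measurable_pkd).aestronglyMeasurable ?_
  filter_upwards [ae_restrict_mem measurableSet_Ioi] with τ hτ using abs_mul_pkd_le hτ

theorem integrableOn_pkd {a : ℝ} (ha : 0 < a) : IntegrableOn pkd (Ioi a) := by
  refine Integrable.mono' ((integrableOn_mul_pkd.mono_set (Ioi_subset_Ioi ha.le)).norm.const_mul a⁻¹)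
    measurable_pkd.aestronglyMeasurable ?_
  filter_upwards [ae_restrict_mem measurableSet_Ioi] with τ hτ
  have hτ' : a < τ := hτ
  rw [norm_mul, ← mul_assoc, Real.norm_of_nonneg (ha.trans hτ').le]
  refine le_mul_of_one_le_left (norm_nonneg _) ?_
  rw [inv_mul_eq_div, one_le_div ha]
  exact hτ'.le

theorem tendsto_pk_atTop : Tendsto pk atTop (𝓝 0) := by
  have h1 : Tendsto (fun τ : ℝ => (2 * √Real.pi)⁻¹ * τ ^ (-(3 / 2) : ℝ)) atTop (𝓝 0) := by
    simpa using (tendsto_rpow_neg_atTop (by norm_num : (0 : ℝ) < 3 / 2)).const_mul (2 * √Real.pi)⁻¹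
  refine squeeze_zero' ?_ ?_ h1
  · filter_upwards [Ioi_mem_atTop 0] with τ hτ using pk_nonneg hτ
  · filter_upwards [Ioi_mem_atTop 0] with τ hτ
    have hτ' : 0 < τ := hτ
    rw [pk]
    refine mul_le_mul_of_nonneg_left (mul_le_of_le_one_right (by positivity) ?_) (by positivity)
    rw [Real.exp_le_one_iff]
    have := inv_pos.2 hτ'
    linarith

theorem integral_Ioi_pkd {a : ℝ} (ha : 0 < a) : ∫ τ in Ioi a, pkd τ = -pk a := by
  have := integral_Ioi_of_hasDerivAt_of_tendsto (hasDerivAt_pk ha).continuousAt.continuousWithinAt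
    (fun τ hτ => hasDerivAt_pk (ha.trans hτ)) (integrableOn_pkd ha) tendsto_pk_atTop
  rw [this, zero_sub]

/-- Integration by parts against `pk`. -/
theorem integral_pk_mul {U : ℝ → ℝ} (hU : Measurable U) {M : ℝ} (hM : ∀ s, |U s| ≤ M) :
    ∫ τ in Ioi 0, pk τ * U τ = -∫ τ in Ioi 0, pkd τ * ∫ s in (0 : ℝ)..τ, U s := by
  have hM0 : 0 ≤ M := (abs_nonneg _).trans (hM 0)
  -- As `pk(a)` is minus the integral of its derivative over `(a,∞)`, both sides are iterated
  -- integrals over `Ω` of `U(a) pkd(b)`. Fubini applies because `U` is bounded and `b pkd(b)` is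
  -- integrable, although `pkd` is paired with a primitive that may grow linearly.
  set F : ℝ × ℝ → ℝ := fun p => U p.1 * pkd p.2 with hF
  have hm : Measurable F := (hU.comp measurable_fst).mul (measurable_pkd.comp measurable_snd)
  have hind : ∀ b a : ℝ, Omega.indicator F (a, b) =
      (Ioo 0 b).indicator (fun a => U a * pkd b) a := fun b a => by
    by_cases h : 0 < a ∧ a < b
    · rw [indicator_of_mem (show (a, b) ∈ Omega from h), indicator_of_mem (show a ∈ Ioo 0 b from h)]
    · rw [indicator_of_notMem (show (a, b) ∉ Omega from h),
        indicator_of_notMem (show a ∉ Ioo 0 b from h)]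
  have hUi : ∀ b, IntegrableOn U (Ioo 0 b) := fun b =>
    Measure.integrableOn_of_bounded (M := M) (by simp) hU.aestronglyMeasurable
      (Eventually.of_forall hM)
  have hi : IntegrableOn F Omega := by
    rw [← integrable_indicator_iff measurableSet_Omega, Measure.volume_eq_prod,
      integrable_prod_iff' (hm.indicator measurableSet_Omega).aestronglyMeasurable]
    constructor
    · refine Eventually.of_forall fun b => ?_
      simp only [hind]
      rw [integrable_indicator_iff measurableSet_Ioo]
      exact (hUi b).mul_const _
    · have h1 : Integrable ((Ioi (0 : ℝ)).indicator fun b => M * |b * pkd b|) :=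
        (integrable_indicator_iff measurableSet_Ioi).2 (integrableOn_mul_pkd.abs.const_mul M)
      refine Integrable.mono' h1
        (hm.indicator measurableSet_Omega).norm.stronglyMeasurable.integral_prod_left.aestronglyMeasurable
        (Eventually.of_forall fun b => ?_)
      rw [Real.norm_of_nonneg (integral_nonneg fun _ => norm_nonneg _)]
      have e : ∀ a, ‖Omega.indicator F (a, b)‖ =
          (Ioo 0 b).indicator (fun a => |U a| * |pkd b|) a := fun a => by
        rw [hind, norm_indicator_eq_indicator_norm]
        simp only [Real.norm_eq_abs, abs_mul]
      simp only [e]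
      rw [integral_indicator measurableSet_Ioo, integral_mul_const]
      by_cases hb : 0 < b
      · rw [indicator_of_mem (mem_Ioi.2 hb), abs_mul, abs_of_pos hb, ← mul_assoc]
        refine mul_le_mul_of_nonneg_right ?_ (abs_nonneg _)
        calc ∫ a in Ioo 0 b, |U a| ≤ ∫ a in Ioo 0 b, M :=
              setIntegral_mono (hUi b).abs (integrableOn_const (by simp)) hM
          _ = M * b := by
              rw [setIntegral_const, measureReal_def, Real.volume_Ioo, sub_zero,
                ENNReal.toReal_ofReal hb.le, smul_eq_mul, mul_comm]
      · rw [indicator_of_notMem (by simpa using hb), Ioo_eq_empty hb]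
        simp
  have e1 := integral_Omega_fst hi
  have e2 := integral_Omega_snd hi
  simp only [hF] at e1 e2
  have e3 : ∫ a in Ioi 0, ∫ b in Ioi a, U a * pkd b = -∫ τ in Ioi 0, pk τ * U τ := by
    rw [← integral_neg]
    refine setIntegral_congr_fun measurableSet_Ioi fun a ha => ?_
    rw [integral_const_mul, integral_Ioi_pkd ha]
    ring
  have e4 : ∫ b in Ioi 0, ∫ a in (0 : ℝ)..b, U a * pkd b =
      ∫ τ in Ioi 0, pkd τ * ∫ s in (0 : ℝ)..τ, U s := by
    refine setIntegral_congr_fun measurableSet_Ioi fun b _ => ?_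
    rw [intervalIntegral.integral_mul_const, mul_comm]
  rw [e3] at e1
  rw [e4] at e2
  linarith

theorem integral_mul_pkd : ∫ τ in Ioi 0, pkd τ * τ = -1 := by
  have h := integral_pk_mul (U := fun _ => 1) measurable_const (M := 1) (by simp)
  simp only [mul_one, integral_pk, intervalIntegral.integral_const, sub_zero, smul_eq_mul] at h
  linarith

/-- `pk` is an approximate identity at the points where the mean of `U` converges. -/
theorem tendsto_integral_pk {U : ℝ → ℝ} (hU : Measurable U) {M c : ℝ} (hM : ∀ s, |U s| ≤ M)
    (hc : Tendsto (fun s => s⁻¹ * ∫ σ in (0 : ℝ)..s, U σ) (𝓝[>] 0) (𝓝 c)) :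
    Tendsto (fun x => ∫ τ in Ioi 0, pk τ * U (x ^ 2 * τ)) (𝓝[>] 0) (𝓝 c) := by
  have hM0 : 0 ≤ M := (abs_nonneg _).trans (hM 0)
  have hv : ∀ s, 0 < s → |s⁻¹ * ∫ σ in (0 : ℝ)..s, U σ| ≤ M := fun s hs => by
    have h := intervalIntegral.norm_integral_le_of_norm_le_const (a := 0) (b := s) (C := M)
      (f := U) fun x _ => hM x
    rw [sub_zero, abs_of_pos hs, Real.norm_eq_abs] at h
    rw [abs_mul, abs_of_pos (inv_pos.2 hs), inv_mul_le_iff₀ hs]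
    linarith
  -- After integration by parts `U` enters only through its means over `(0, x² τ)`, which converge
  -- by assumption even if `U` itself has no limit. The weight becomes `-τ pkd(τ)`, again of
  -- integral one but not of constant sign, so its absolute integrability is used for domination.
  have key : ∀ x : ℝ, 0 < x → ∫ τ in Ioi 0, pk τ * U (x ^ 2 * τ) =
      -∫ τ in Ioi 0, τ * pkd τ * ((x ^ 2 * τ)⁻¹ * ∫ σ in (0 : ℝ)..(x ^ 2 * τ), U σ) := fun x hx => by
    rw [integral_pk_mul (U := fun τ => U (x ^ 2 * τ)) (hU.comp (measurable_const.mul measurable_id))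
      (M := M) (fun s => hM _)]
    congr 1
    refine setIntegral_congr_fun measurableSet_Ioi fun τ hτ => ?_
    have hτ' : 0 < τ := hτ
    have h := intervalIntegral.integral_comp_mul_left (a := 0) (b := τ) U (c := x ^ 2)
      (by positivity)
    rw [h, mul_zero, smul_eq_mul]
    field_simp
  have hlim : Tendsto (fun x : ℝ => ∫ τ in Ioi 0,
      τ * pkd τ * ((x ^ 2 * τ)⁻¹ * ∫ σ in (0 : ℝ)..(x ^ 2 * τ), U σ)) (𝓝[>] 0)
      (𝓝 (∫ τ in Ioi 0, τ * pkd τ * c)) := by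
    have hVc : Continuous fun s => ∫ σ in (0 : ℝ)..s, U σ :=
      intervalIntegral.continuous_primitive (fun a b => by
        rw [intervalIntegrable_iff]
        exact Measure.integrableOn_of_bounded (M := M) (by simp) hU.aestronglyMeasurable
          (Eventually.of_forall hM)) 0
    refine tendsto_integral_filter_of_dominated_convergence (fun τ => |τ * pkd τ| * M)
      (Eventually.of_forall fun x => Measurable.aestronglyMeasurable ?_) ?_
      (integrableOn_mul_pkd.abs.mul_const M) ?_
    · have := hVc.measurable
      exact (measurable_id.mul measurable_pkd).mul ((measurable_const.mul measurable_id).inv.mul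
        (this.comp (measurable_const.mul measurable_id)))
    · filter_upwards [self_mem_nhdsWithin] with x hx
      have hx' : 0 < x := hx
      filter_upwards [ae_restrict_mem measurableSet_Ioi] with τ hτ
      have hτ' : 0 < τ := hτ
      rw [norm_mul]
      exact mul_le_mul_of_nonneg_left (hv _ (by positivity)) (abs_nonneg _)
    · filter_upwards [ae_restrict_mem measurableSet_Ioi] with τ hτ
      have hτ' : 0 < τ := hτ
      refine (hc.comp (f := fun x : ℝ => x ^ 2 * τ) ?_).const_mul _
      refine tendsto_nhdsWithin_iff.2 ⟨?_, ?_⟩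
      · have : Continuous fun x : ℝ => x ^ 2 * τ := by fun_prop
        have := this.tendsto 0
        simp only [ne_eq, OfNat.ofNat_ne_zero, not_false_eq_true, zero_pow, zero_mul] at this
        exact this.mono_left nhdsWithin_le_nhds
      · filter_upwards [self_mem_nhdsWithin] with x hx
        have hx' : 0 < x := hx
        exact mem_Ioi.2 (by positivity)
  have e : -∫ τ in Ioi 0, τ * pkd τ * c = c := by
    rw [integral_mul_const]
    simp only [mul_comm _ (pkd _)]
    rw [integral_mul_pkd]; ring
  have h := hlim.neg
  rw [e] at h
  refine h.congr' ?_
  filter_upwards [self_mem_nhdsWithin] with x hx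
  exact (key x hx).symm

/-! ### The spatial derivative of solutions of the heat equation -/

/-- The spatial derivative of `heatAvg z t`. -/
def heatAvgD (z : ℝ → ℝ) (t x : ℝ) : ℝ := ∫ v, z (x - v) * hkx t v

theorem integrable_hkx {t : ℝ} (ht : 0 < t) : Integrable (hkx t) := by
  obtain ⟨C, -, hC⟩ := exists_hk_bound ht le_rfl
  exact integrable_of_le_gauss (continuous_hkx t) (by positivity : 0 < 8 * t)
    fun x => (hC t ⟨le_rfl, le_rfl⟩ x).2.1

theorem integrable_hk {t : ℝ} (ht : 0 < t) : Integrable (hk t) := by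
  obtain ⟨C, -, hC⟩ := exists_hk_bound ht le_rfl
  exact integrable_of_le_gauss (continuous_hk t) (by positivity : 0 < 8 * t)
    fun x => (hC t ⟨le_rfl, le_rfl⟩ x).1

theorem continuous_heatAvgD {z : ℝ → ℝ} (hz : Continuous z) {C : ℝ} (hC : ∀ x, |z x| ≤ C)
    {t : ℝ} (ht : 0 < t) : Continuous (heatAvgD z t) := by
  refine continuous_of_dominated (bound := fun v => C * |hkx t v|)
    (fun x => ((hz.comp (by fun_prop)).mul (continuous_hkx t)).aestronglyMeasurable)
    (fun x => Eventually.of_forall fun v => ?_) ((integrable_hkx ht).abs.const_mul C)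
    (Eventually.of_forall fun v => (hz.comp (by fun_prop)).mul continuous_const)
  rw [norm_mul]
  exact mul_le_mul_of_nonneg_right (hC _) (abs_nonneg _)

theorem heatAvgD_zero {z : ℝ → ℝ} (he : ∀ x, z (-x) = z x) (t : ℝ) : heatAvgD z t 0 = 0 := by
  have h := integral_neg_eq_self (fun v => z (0 - v) * hkx t v) volume
  simp only [zero_sub, neg_neg, hkx_neg, mul_neg, integral_neg] at h
  simp only [heatAvgD, zero_sub]
  simp only [he] at h ⊢
  linarith

theorem hasDerivAt_heatAvg {z : ℝ → ℝ} (hz : Continuous z) {M : ℝ} (hM : ∀ x, |z x| ≤ M)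
    {t : ℝ} (ht : 0 < t) (x : ℝ) : HasDerivAt (heatAvg z t) (heatAvgD z t x) x := by
  obtain ⟨C, hC0, hC⟩ := exists_hk_bound ht le_rfl
  have hM0 : 0 ≤ M := (abs_nonneg _).trans (hM 0)
  have hb : Integrable fun y : ℝ => M * (C * (Real.exp (1 / (8 * t)) *
      Real.exp (-(x - y) ^ 2 / (16 * t)))) :=
    ((((integrable_gauss (by positivity : 0 < 16 * t)).comp_sub_left x).const_mul _).const_mul
      _).const_mul _
  have hint : Integrable fun y => z y * hk t (x - y) := by
    refine Integrable.mono' (((integrable_hk ht).comp_sub_left x).abs.const_mul M)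
      (hz.mul ((continuous_hk t).comp (by fun_prop))).aestronglyMeasurable
      (Eventually.of_forall fun y => ?_)
    rw [norm_mul]
    exact mul_le_mul_of_nonneg_right (hM y) (abs_nonneg _)
  have h := hasDerivAt_integral_of_dominated_loc_of_deriv_le (μ := volume)
    (F := fun x y => z y * hk t (x - y)) (F' := fun x y => z y * hkx t (x - y)) (x₀ := x)
    (Metric.ball_mem_nhds x one_pos)
    (Eventually.of_forall fun x => (hz.mul
      ((continuous_hk t).comp (by fun_prop))).aestronglyMeasurable) hint
    (hz.mul ((continuous_hkx t).comp (by fun_prop))).aestronglyMeasurable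
    (Eventually.of_forall fun y x' hx' => by
      rw [norm_mul]
      refine mul_le_mul (hM y) ((hC t ⟨le_rfl, le_rfl⟩ _).2.1.trans
        (mul_le_mul_of_nonneg_left ?_ hC0)) (abs_nonneg _) hM0
      rw [← Real.exp_add]
      apply Real.exp_le_exp.2
      rw [Metric.mem_ball, Real.dist_eq, abs_lt] at hx'
      have h2 : (x - y) ^ 2 / 2 - 1 ≤ (x' - y) ^ 2 := by
        nlinarith [sq_nonneg (x - y + 2 * (x' - x)), hx'.1, hx'.2]
      rw [show -(x' - y) ^ 2 / (8 * t) = -((x' - y) ^ 2 / (8 * t)) by ring,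
        show 1 / (8 * t) + -(x - y) ^ 2 / (16 * t) = -(((x - y) ^ 2 / 2 - 1) / (8 * t)) by
          field_simp; ring, neg_le_neg_iff]
      gcongr)
    hb
    (Eventually.of_forall fun y x' _ =>
      (((hasDerivAt_hk ht (x' - y)).comp_sub_const x' y).const_mul (z y)))
  have e : ∫ y, z y * hkx t (x - y) = heatAvgD z t x := by
    rw [heatAvgD, ← integral_sub_left_eq_self (fun v => z (x - v) * hkx t v) volume x]
    simp only [sub_sub_cancel]
  rw [e] at h
  refine h.2.congr_of_eventuallyEq (Eventually.of_forall fun x' => ?_)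
  exact (integral_mul_hk z ht x').symm

/-- Away from `x = 0` the factor `x/(2s)` is absorbed by the Gaussian, again through `v e^{-v} ≤ 1`.
What remains is of order `s^{-1/2}`, integrable at `s = 0`, so the Duhamel integral may be
differentiated in `x` for `x > 0`. -/
theorem abs_hkx_le {s y : ℝ} (hs : 0 < s) (hy : 0 < y) :
    |hkx s y| ≤ 2 / y * ((√(4 * Real.pi))⁻¹ * (√s)⁻¹) := by
  set v := y ^ 2 / (4 * s) with hv
  have hv0 : 0 < v := by positivity
  have h2 : v * Real.exp (-v) ≤ 1 := by
    rw [Real.exp_neg, ← div_eq_mul_inv, div_le_one (Real.exp_pos _)]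
    linarith [Real.add_one_le_exp v]
  have e : hkx s y = -(2 / y * ((√(4 * Real.pi))⁻¹ * (√s)⁻¹) * (v * Real.exp (-v))) := by
    rw [hkx, hk, Real.sqrt_mul (by positivity), neg_div, ← hv]
    have : v * (4 * s) = y ^ 2 := by rw [hv]; field_simp
    have h3 : y / (2 * s) = 2 / y * v := by rw [hv]; field_simp; ring
    rw [h3, div_eq_mul_inv _ (√(4 * Real.pi) * √s), mul_inv]
    ring
  have h0 : 0 ≤ 2 / y * ((√(4 * Real.pi))⁻¹ * (√s)⁻¹) := by positivity
  rw [e, abs_neg, abs_mul, abs_of_nonneg h0, abs_of_nonneg (by positivity)]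
  exact mul_le_of_le_one_right h0 h2

theorem measurable_hk (x : ℝ) : Measurable fun s => hk s x := by unfold hk; fun_prop

theorem measurable_hkx (x : ℝ) : Measurable fun s => hkx s x := by
  have := measurable_hk x
  unfold hkx; fun_prop

theorem hasDerivAt_integral_mul_hk {V : ℝ → ℝ} (hV : Measurable V) {M : ℝ} (hM : ∀ s, |V s| ≤ M)
    {t : ℝ} (ht : 0 < t) {x : ℝ} (hx : 0 < x) :
    HasDerivAt (fun x => ∫ s in (0 : ℝ)..t, V s * hk s x) (∫ s in (0 : ℝ)..t, V s * hkx s x) x := by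
  have hM0 : 0 ≤ M := (abs_nonneg _).trans (hM 0)
  refine (intervalIntegral.hasDerivAt_integral_of_dominated_loc_of_deriv_le (μ := volume)
    (F := fun x s => V s * hk s x) (F' := fun x s => V s * hkx s x) (x₀ := x)
    (bound := fun s => M * (2 / (x / 2) * ((√(4 * Real.pi))⁻¹ * (√s)⁻¹)))
    (Ioi_mem_nhds (half_lt_self hx))
    (Eventually.of_forall fun x => (hV.mul (measurable_hk x)).aestronglyMeasurable) ?_
    (hV.mul (measurable_hkx x)).aestronglyMeasurable (Eventually.of_forall fun s hs y hy => ?_)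
    ((((intervalIntegrable_inv_sqrt t).const_mul _).const_mul _).const_mul _)
    (Eventually.of_forall fun s hs y _ => ?_)).2
  · refine IntervalIntegrable.mono_fun' (((intervalIntegrable_inv_sqrt t).const_mul
      (√(4 * Real.pi))⁻¹).const_mul M) (hV.mul (measurable_hk x)).aestronglyMeasurable ?_
    filter_upwards [ae_restrict_mem measurableSet_uIoc] with s hs
    rw [uIoc_of_le ht.le] at hs
    rw [norm_mul, Real.norm_of_nonneg (hk_nonneg _ _)]
    exact mul_le_mul (hM s) (hk_le_inv_sqrt s x hs.1.le) (hk_nonneg _ _) hM0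
  · rw [uIoc_of_le ht.le] at hs
    have hy' : x / 2 < y := hy
    rw [norm_mul]
    refine mul_le_mul (hM s) ((abs_hkx_le hs.1 ((half_pos hx).trans hy')).trans ?_)
      (abs_nonneg _) hM0
    gcongr
  · rw [uIoc_of_le ht.le] at hs
    exact (hasDerivAt_hk hs.1 y).const_mul _

/-- Parabolic scaling: under `s = x² τ` the measure `-2 hkx(s,x) ds` becomes `pk(τ) dτ`, with no
dependence on `x`. Differentiating the Duhamel term therefore produces averages against one fixed
density. -/
theorem pk_eq {x τ : ℝ} (hx : 0 < x) (hτ : 0 < τ) : pk τ = x ^ 2 * (-2 * hkx (x ^ 2 * τ) x) := by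
  have e1 : √(4 * Real.pi * (x ^ 2 * τ)) = 2 * √Real.pi * (x * √τ) := by
    rw [show 4 * Real.pi * (x ^ 2 * τ) = (2 * x) ^ 2 * (Real.pi * τ) by ring,
      Real.sqrt_mul (by positivity), Real.sqrt_sq (by positivity), Real.sqrt_mul Real.pi_pos.le]
    ring
  have e2 : -x ^ 2 / (4 * (x ^ 2 * τ)) = -(1 / 4) * τ⁻¹ := by field_simp
  have e3 : τ ^ (-(3 / 2) : ℝ) = τ⁻¹ * (√τ)⁻¹ := by
    rw [Real.sqrt_eq_rpow, ← Real.rpow_neg_one, ← Real.rpow_neg hτ.le, ← Real.rpow_add hτ]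
    norm_num
  have := Real.sqrt_pos.2 Real.pi_pos
  have := Real.sqrt_pos.2 hτ
  rw [pk, hkx, hk, e1, e2, e3]
  field_simp

/-- The vanishing of `V` beyond `t` allows the integral to be extended to the half-line before
rescaling. It holds for `V(s) = U(t - s)` because the modified control is zero outside `(0,T)`. -/
theorem integral_hkx_eq {V : ℝ → ℝ} {t : ℝ} (ht : 0 < t) (h0 : ∀ s, t < s → V s = 0) {x : ℝ}
    (hx : 0 < x) : -2 * ∫ s in (0 : ℝ)..t, V s * hkx s x = ∫ τ in Ioi 0, pk τ * V (x ^ 2 * τ) := by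
  have h := integral_comp_mul_left_Ioi (fun s => V s * hkx s x) 0 (b := x ^ 2) (by positivity)
  have e : ∫ τ in Ioi 0, pk τ * V (x ^ 2 * τ) =
      -2 * (x ^ 2 * ∫ τ in Ioi 0, V (x ^ 2 * τ) * hkx (x ^ 2 * τ) x) := by
    rw [← integral_const_mul, ← integral_const_mul]
    refine setIntegral_congr_fun measurableSet_Ioi fun τ hτ => ?_
    rw [pk_eq hx hτ]; ring
  rw [e, h, mul_zero, smul_eq_mul, mul_inv_cancel_left₀ (by positivity),
    intervalIntegral.integral_of_le ht.le]
  congr 1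
  symm
  refine setIntegral_eq_of_subset_of_forall_sdiff_eq_zero measurableSet_Ioi Ioc_subset_Ioi_self ?_
  rintro s ⟨hs, hs'⟩
  have : t < s := by
    by_contra hc
    exact hs' ⟨hs, not_lt.1 hc⟩
  rw [h0 s this, zero_mul]

/-- A bounded measurable modification of a control, vanishing outside `(0,T)`. -/
theorem exists_measurable_control {T : ℝ} {u : ℝ → ℝ} (hu : MemLp u ⊤ (volume.restrict (Ioo 0 T))) :
    ∃ U : ℝ → ℝ, Measurable U ∧ (∀ s, |U s| ≤ normLinfty T u) ∧ (∀ s ∉ Ioo 0 T, U s = 0) ∧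
      ∀ᵐ s, s ∈ Ioo 0 T → U s = u s := by
  have hn := normLinfty_nonneg T u
  set M := normLinfty T u with hMdef
  refine ⟨(Ioo 0 T).indicator fun s => max (-M) (min M (hu.1.mk u s)), ?_, fun s => ?_,
    fun s hs => indicator_of_notMem hs _, ?_⟩
  · exact (measurable_const.max (measurable_const.min
      hu.1.stronglyMeasurable_mk.measurable)).indicator measurableSet_Ioo
  · by_cases hs : s ∈ Ioo 0 T
    · rw [indicator_of_mem hs, abs_le]
      exact ⟨le_max_left _ _, max_le (by linarith) (min_le_left _ _)⟩
    · rw [indicator_of_notMem hs, abs_zero]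
      exact hn
  · rw [← ae_restrict_iff' measurableSet_Ioo]
    filter_upwards [hu.1.ae_eq_mk, ae_abs_le_normLinfty hu, ae_restrict_mem measurableSet_Ioo]
      with s h1 h2 h3
    rw [indicator_of_mem h3, ← h1, min_eq_right (le_of_abs_le h2), max_eq_right (neg_le_of_abs_le h2)]

/-- Almost every point is a left Lebesgue point. -/
theorem ae_tendsto_left_mean {U : ℝ → ℝ} (hU : Measurable U) {M : ℝ} (hM : ∀ s, |U s| ≤ M) :
    ∀ᵐ t, Tendsto (fun s => s⁻¹ * ∫ σ in (0 : ℝ)..s, U (t - σ)) (𝓝[>] 0) (𝓝 (U t)) := by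
  have hi : ∀ a b, IntervalIntegrable U volume a b := fun a b => by
    rw [intervalIntegrable_iff]
    exact Measure.integrableOn_of_bounded (M := M) (by simp) hU.aestronglyMeasurable
      (Eventually.of_forall hM)
  have hP : IsPrim (fun x => ∫ s in (0 : ℝ)..x, U s) U :=
    ⟨locallyIntegrable_of_intervalIntegrable hi, fun x => by simp⟩
  filter_upwards [hP.ae_hasDerivAt] with t ht
  have h1 := hasDerivWithinAt_iff_tendsto_slope.1 (ht.hasDerivWithinAt (s := Iio t))
  have h2 : Tendsto (fun s : ℝ => t - s) (𝓝[>] 0) (𝓝[<] t) := by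
    refine tendsto_nhdsWithin_iff.2 ⟨?_, ?_⟩
    · have : Continuous fun s : ℝ => t - s := by fun_prop
      have := this.tendsto 0
      rw [sub_zero] at this
      exact this.mono_left nhdsWithin_le_nhds
    · filter_upwards [self_mem_nhdsWithin] with s hs
      have : 0 < s := hs
      exact mem_Iio.2 (by linarith)
  rw [sdiff_singleton_eq_self (by simp)] at h1
  refine (h1.comp h2).congr' ?_
  filter_upwards [self_mem_nhdsWithin] with s hs
  have hs' : 0 < s := hs
  rw [Function.comp_apply, slope_def_field, intervalIntegral.integral_comp_sub_left, sub_zero,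
    intervalIntegral.integral_interval_sub_left (hi _ _) (hi _ _),
    intervalIntegral.integral_symm (t - s) t, show t - s - t = -s by ring, neg_div_neg_eq,
    div_eq_inv_mul]

variable {T : ℝ} {u : ℝ → ℝ} {Z0 : H1 unitCoeffs} {Z : ℝ → H1 unitCoeffs}

/-- The Neumann trace of solutions of the heat equation. -/
theorem heat_neumann (hT : 0 < T) (hu : MemLp u ⊤ (volume.restrict (Ioo 0 T)))
    (hZ : IsSolution unitCoeffs T u Z0 Z) :
    ∀ᵐ t ∂(volume.restrict (Ioo 0 T)), ∃ f : ℝ → ℝ,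
      (∀ᵐ x, x ∈ Ioi 0 → H1.repD (Z t) x = f x) ∧ Tendsto f (𝓝[>] 0) (𝓝 (u t)) := by
  obtain ⟨U, hUm, hUM, hU0, hUu⟩ := exists_measurable_control hu
  have heven : ∀ x, H1.rep Z0 (-x) = H1.rep Z0 x := by
    have := hZ.even 0 ⟨le_rfl, hT.le⟩
    rwa [H1.isEven_iff, hZ.initial] at this
  have hc := (H1.lineH1_rep Z0).continuous
  filter_upwards [ae_restrict_of_ae (ae_tendsto_left_mean hUm hUM), ae_restrict_of_ae hUu,
    ae_restrict_mem measurableSet_Ioo] with t h1 h2 ht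
  have hVm : Measurable fun s => U (t - s) := hUm.comp (measurable_const.sub measurable_id)
  have hdu : ∀ x, duhamel u t x = 2 * ∫ s in (0 : ℝ)..t, U (t - s) * hk s x := fun x => by
    have hq := (Measure.measurePreserving_sub_left volume t).quasiMeasurePreserving.ae hUu
    rw [duhamel]
    congr 1
    refine intervalIntegral.integral_congr_ae ?_
    filter_upwards [hq, Measure.ae_ne volume t] with s hs hst hmem
    rw [uIoc_of_le ht.1.le] at hmem
    rw [hs ⟨by linarith [lt_of_le_of_ne hmem.2 hst], by linarith [hmem.1, ht.2]⟩]
  -- This is the derivative of Duhamel's formula at `x > 0`. As `x → 0⁺` the first term tends to its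
  -- value at zero, which vanishes since the initial state is even. The second tends to `u(t)`
  -- whenever `t` is a left Lebesgue point of the control.
  refine ⟨fun x => heatAvgD (H1.rep Z0) t x + ∫ τ in Ioi 0, pk τ * U (t - x ^ 2 * τ), ?_, ?_⟩
  · filter_upwards [(H1.lineH1_rep (Z t)).toIsPrim.ae_hasDerivAt] with x hx hx0
    refine hx.unique ?_
    have ha := hasDerivAt_heatAvg hc (H1.abs_rep_le Z0) ht.1 x
    have hb := (hasDerivAt_integral_mul_hk hVm (fun s => hUM (t - s)) ht.1 hx0).const_mul 2
    have e := integral_hkx_eq (V := fun s => U (t - s)) ht.1 (fun s hs => hU0 _ fun h => by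
      linarith [h.1]) hx0
    refine ((ha.sub hb).congr_deriv ?_).congr_of_eventuallyEq (Eventually.of_forall fun y => ?_)
    · rw [← e]; ring
    · rw [heat_formula' hu hZ ⟨ht.1, ht.2.le⟩, hdu]
      rfl
  · have ha := ((continuous_heatAvgD hc (H1.abs_rep_le Z0) ht.1).tendsto 0).mono_left
      (nhdsWithin_le_nhds (s := Ioi 0))
    rw [heatAvgD_zero heven] at ha
    have hb := tendsto_integral_pk hVm (fun s => hUM (t - s)) h1
    have := ha.add hb
    rwa [zero_add, h2 ht] at this

/-! ### The Neumann trace of the transformed solution -/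

theorem Coeffs.hasRightValue_of_S (d : Coeffs) {F f g : ℝ → ℝ} {c : ℝ} (hF : F =ᵐ[volume] S d f)
    (hfg : ∀ᵐ x, x ∈ Ioi (0 : ℝ) → f x = g x) (hg : Tendsto g (𝓝[>] 0) (𝓝 c)) :
    HasRightValue F (c / d.w4 0) := by
  classical
  let g' : ℝ → ℝ := fun x => if 0 < x then g x else f x
  have hpos : ∀ x, 0 < x → g' x = g x := fun x hx => if_pos hx
  have hneg : ∀ x, ¬0 < x → g' x = f x := fun x hx => if_neg hx
  have e : f =ᵐ[volume] g' := by
    filter_upwards [hfg] with x hx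
    by_cases h : 0 < x
    · rw [hpos x h, hx h]
    · rw [hneg x h]
  refine tendsto_inf_ae_congr (hF.trans (d.S_congr e)) ?_
  have h1 : Tendsto g' (𝓝[>] 0) (𝓝 c) := by
    refine hg.congr' ?_
    filter_upwards [self_mem_nhdsWithin] with x hx
    exact (hpos x hx).symm
  have h2 : Tendsto d.sig (𝓝[>] 0) (𝓝[>] 0) := by
    refine tendsto_nhdsWithin_iff.2 ⟨?_, ?_⟩
    · have := d.sig_continuous.tendsto 0
      rw [d.sig_zero] at this
      exact this.mono_left nhdsWithin_le_nhds
    · filter_upwards [self_mem_nhdsWithin] with x hx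
      have := d.sig_strictMono (mem_Ioi.1 hx)
      rwa [d.sig_zero] at this
  exact (h1.comp h2).div ((d.w4_continuous.tendsto 0).mono_left nhdsWithin_le_nhds) (d.w4_pos 0).ne'

namespace IsKernel

variable {r : ℝ → ℝ} {K : ℝ → ℝ → ℝ}

/-- With `b = 2η - a` the mean of the two kernel arguments is `η`. The estimate of `K_{y₁}` then
becomes a function of `η` alone, a dominating function independent of `a` for the limit `a → 0⁺`;
boundedness of `r` at a moving argument would not be enough. -/
theorem Up_eq_reflect (k : ℝ → ℝ → ℝ) (g : ℝ → ℝ) (a : ℝ) :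
    Up k g a = 2 * ∫ η in Ioi a, k a (2 * η - a) * g (2 * η - a) := by
  have h1 := integral_comp_mul_left_Ioi (fun y => k a (y - a) * g (y - a)) a (b := 2) two_pos
  have h2 : ∫ y in Ioi (2 * a), k a (y - a) * g (y - a) = Up k g a := by
    rw [Up, ← integral_indicator measurableSet_Ioi, ← integral_indicator measurableSet_Ioi,
      ← integral_sub_right_eq_self ((Ioi a).indicator fun b => k a b * g b) a]
    refine integral_congr_ae (Eventually.of_forall fun y => ?_)
    beta_reduce
    by_cases h : 2 * a < y
    · rw [indicator_of_mem (mem_Ioi.2 h), indicator_of_mem (mem_Ioi.2 (by linarith))]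
    · rw [indicator_of_notMem (by simpa using h), indicator_of_notMem]
      rw [mem_Ioi]; intro h'; exact h (by linarith)
  rw [h1, h2, smul_eq_mul]
  ring

theorem tendsto_Up_k1 (hr : Pot r) (hK : IsKernel r K) {g : ℝ → ℝ} (hg : Continuous g) {C : ℝ}
    (hC : ∀ x, |g x| ≤ C) : Tendsto (Up (k1 r K) g) (𝓝[>] 0) (𝓝 (Up (k1 r K) g 0)) := by
  have hC0 : 0 ≤ C := (abs_nonneg _).trans (hC 0)
  have hk := hK.continuous_k1 hr
  have hcont : Continuous fun p : ℝ × ℝ => k1 r K p.1 (2 * p.2 - p.1) * g (2 * p.2 - p.1) :=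
    (hk.comp (by fun_prop : Continuous fun p : ℝ × ℝ => (p.1, 2 * p.2 - p.1))).mul
      (hg.comp (by fun_prop))
  set G : ℝ → ℝ → ℝ := fun a η => (Ioi a).indicator
    (fun η => k1 r K a (2 * η - a) * g (2 * η - a)) η with hG
  have e : ∀ a, 0 ≤ a → Up (k1 r K) g a = 2 * ∫ η in Ioi 0, G a η := fun a ha => by
    rw [Up_eq_reflect, hG]
    simp only
    rw [setIntegral_indicator measurableSet_Ioi, Ioi_inter_Ioi, max_eq_right ha]
  have hlim : Tendsto (fun a => ∫ η in Ioi 0, G a η) (𝓝[>] 0) (𝓝 (∫ η in Ioi 0, G 0 η)) := by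
    refine tendsto_integral_filter_of_dominated_convergence
      (fun η => (1 / 4 * |r η| + MK r * sigma0 r η) * C)
      (Eventually.of_forall fun a => ?_) ?_
      (((hr.integrableOn.abs.const_mul _).add (hr.sigma0_integrableOn.const_mul _)).mul_const C) ?_
    · exact ((hcont.comp (by fun_prop : Continuous fun η : ℝ => (a, η))).measurable.indicator
        measurableSet_Ioi).aestronglyMeasurable
    · filter_upwards [self_mem_nhdsWithin] with a ha
      have ha' : 0 < a := ha
      filter_upwards [ae_restrict_mem measurableSet_Ioi] with η hη
      have hs := Pot.sigma0_nonneg r η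
      have hM := MK_nonneg r
      by_cases h : a < η
      · have h1 := hK.abs_k1_le hr ha'.le (by linarith : a ≤ 2 * η - a)
        rw [show (a + (2 * η - a)) / 2 = η by ring] at h1
        rw [hG]
        simp only
        rw [indicator_of_mem (mem_Ioi.2 h), norm_mul]
        exact mul_le_mul h1 (hC _) (abs_nonneg _) (by positivity)
      · rw [hG]
        simp only
        rw [indicator_of_notMem (by simpa using h), norm_zero]
        positivity
    · filter_upwards [ae_restrict_mem measurableSet_Ioi] with η hη
      have hη' : 0 < η := hη
      have h1 := ((hcont.comp (by fun_prop : Continuous fun a : ℝ => (a, η))).tendsto 0).mono_left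
        (nhdsWithin_le_nhds (s := Ioi 0))
      rw [hG]
      simp only
      rw [indicator_of_mem (mem_Ioi.2 hη')]
      refine h1.congr' ?_
      filter_upwards [mem_nhdsWithin_of_mem_nhds (Iio_mem_nhds hη')] with a ha
      rw [indicator_of_mem (mem_Ioi.2 ha)]
      rfl
  rw [e 0 le_rfl]
  refine (hlim.const_mul 2).congr' ?_
  filter_upwards [self_mem_nhdsWithin] with a ha using (e a (mem_Ioi.1 ha).le).symm

theorem tendsto_Ke_diag (hr : Pot r) (hK : IsKernel r K) :
    Tendsto (fun y => Ke K y y) (𝓝[>] 0) (𝓝 (1 / 2 * ∫ ξ in Ioi 0, r ξ)) := by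
  have h1 : Tendsto (fun y => ∫ ξ in (0 : ℝ)..y, r ξ) (𝓝[>] 0) (𝓝 0) := by
    have := (intervalIntegral.continuous_primitive
      (μ := volume) (fun a b => hr.continuous.intervalIntegrable a b) 0).tendsto 0
    rw [intervalIntegral.integral_same] at this
    exact this.mono_left nhdsWithin_le_nhds
  have h2 := (h1.const_sub (∫ ξ in Ioi 0, r ξ)).const_mul (1 / 2)
  rw [sub_zero] at h2
  refine h2.congr' ?_
  filter_upwards [self_mem_nhdsWithin] with y hy
  have hy' : 0 < y := hy
  rw [hK.Ke_diag hy', ← intervalIntegral.integral_Ioi_sub_Ioi hr.integrableOn hy'.le]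
  ring

variable {d : Coeffs} {T : ℝ} {u : ℝ → ℝ} {Z0 : H1 unitCoeffs} {Z : ℝ → H1 unitCoeffs}

/-- For `x > 0` the derivative of the transformed state is `T'`. Its three terms tend to `u(t)`, to
`-½ Z(0⁺,t) ∫ r` and to the integral of `K_{y₁}(0,·) Z`; division by the weight at zero gives the
new control. -/
theorem neumann_transform (hK : IsKernel d.r K) (hT : 0 < T)
    (hu : MemLp u ⊤ (volume.restrict (Ioo 0 T))) (hZ : IsSolution unitCoeffs T u Z0 Z) :
    ∀ᵐ t ∂(volume.restrict (Ioo 0 T)),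
      HasRightValue (H1.D (hK.transform (Z t))) (newControl d K u Z t) := by
  filter_upwards [heat_neumann hT hu hZ] with t ⟨f, hf, hlim⟩
  have L := H1.lineH1_rep (Z t)
  rw [hK.newControl_eq]
  refine d.hasRightValue_of_S (H1.D_mk _)
    (g := fun y => f y - Ke K y y * H1.rep (Z t) y + Up (k1 d.r K) (H1.rep (Z t)) y) ?_ ?_
  · filter_upwards [hf] with x hx hx0
    rw [sign_ae_eq_one hx0, one_mul, abs_of_pos hx0, T', hx hx0]
  · have h1 := (L.continuous.tendsto 0).mono_left (nhdsWithin_le_nhds (s := Ioi 0))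
    have h := (hlim.sub ((hK.tendsto_Ke_diag d.pot).mul h1)).add
      (hK.tendsto_Up_k1 d.pot L.continuous (H1.abs_rep_le (Z t)))
    convert h using 2
    rw [feedback]
    ring

end IsKernel
end HeatNeumann

end

/-! ### The main theorem -/

theorem mainTheorem4 (d : Coeffs) (K : ℝ → ℝ → ℝ) (hK : IsKernel d.r K) :
    (∃ M1 > 0, KernelBound d.r K M1) ∧
    ∃ E0 > 0, ∃ E1 > 0, ∀ M1 > 0, KernelBound d.r K M1 →
      ∀ T > 0, ∀ u : ℝ → ℝ, MemLp u ⊤ (volume.restrict (Ioo 0 T)) →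
      ∀ (Z0 : H1 unitCoeffs) (Z : ℝ → H1 unitCoeffs), IsSolution unitCoeffs T u Z0 Z →
      ∃ (W0 : H1 d) (W : ℝ → H1 d),
        H1.fn W0 =ᵐ[volume] That d K (H1.fn Z0) ∧
        (∀ t ∈ Icc 0 T, H1.fn (W t) =ᵐ[volume] That d K (H1.fn (Z t))) ∧
        MemLp (newControl d K u Z) ⊤ (volume.restrict (Ioo 0 T)) ∧
        IsSolution d T (newControl d K u Z) W0 W ∧
        (∀ᵐ t ∂(volume.restrict (Ioo 0 T)),
          HasRightValue (H1.D (W t)) (newControl d K u Z t)) ∧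
        (∀ t ∈ Icc 0 T, ‖W t‖ ≤ E0 * ‖Z t‖) ∧
        normLinfty T (newControl d K u Z) ≤ G0 d M1 T * normLinfty T u + E1 * ‖Z0‖ := by
  refine ⟨hK.exists_kernelBound d.pot, √(IsKernel.Cop d.r K), Real.sqrt_pos.2 (IsKernel.Cop_pos _ _),
    HeatNeumann.E1 d K, E1_pos d K, fun M1 _ hM T hT u hu Z0 Z hZ => ?_⟩
  have heven : H1.IsEven Z0 := hZ.initial ▸ hZ.even 0 ⟨le_rfl, hT.le⟩
  exact ⟨hK.transform Z0, fun t => hK.transform (Z t), hK.fn_transform heven,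
    fun t ht => hK.fn_transform (hZ.even t ht), memLp_newControl hT hu hZ hK hM,
    hK.isSolution_transform hT hZ, hK.neumann_transform hT hu hZ,
    fun t _ => hK.norm_transform_le (Z t), normLinfty_newControl_le hT hu hZ hK hM⟩
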